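/- **Setting.** Let $L\ge 1$ and let $\mathcal R_1,\dots,\mathcal R_L$ be arbitrary (possibly dependent, not necessarily identically distributed) random variables, the fading envelopes, with $\mathcal R_\ell>0$ almost surely. Let $p\in\mathbb R$, $q\in\mathbb R\setminus\{0\}$, $\mathrm K,E_s,N_0,\theta,T,B>0$, and put $X=\sum_{\ell=1}^L\mathcal R_\ell^p$, $\gamma_{\rm end}=\mathrm K\frac{E_s}{N_0}X^q$, $A=\theta TB/\ln 2$, $\kappa=\left(\mathrm K\frac{E_s}{N_0}\right)^{1/q}$ and $\mathcal M(u)=\mathbb E\langle e^{-uX}\rangle$. The effective capacity under optimal rate adaptation (ORA) is $$R^{\rm ORA}(\theta)=-\frac1{\theta TB}\ln\mathbb E\left\langle(1+\gamma_{\rm end})^{-A}\right\rangle ,$$ which is also the value of $-\lim_{N\to\infty}\frac1{N\theta TB}\ln\mathbb E\langle e^{-\theta\sum_{n=1}^N S[n]}\rangle$ for $S[n]=BT\log_2(1+\gamma_{\rm end}[n])$, when the fading vectors of the blocks $n=1,2,\dots$ are independent copies of $(\mathcal R_1,\dots,\mathcal R_L)$. For $u>0$ define the kernel by Fox $H$-functions,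 $$C_q(u)=\begin{cases}\dfrac{u^{-1}}{q\,\Gamma(A)}\,H^{1,1}_{1,2}\left[u\,\middle|\,\begin{matrix}(1,1/q)\\(A,1/q),(1,1)\end{matrix}\right],&q>0,\\[2ex]\dfrac1{|q|\,\Gamma(A)}\,H^{1,1}_{1,2}\left[u\,\middle|\,\begin{matrix}(1-A,1/|q|)\\(0,1/|q|),(0,1)\end{matrix}\right],&q<0,\end{cases}$$ where $H^{1,1}_{1,2}\left[u\,\middle|\,\begin{matrix}(a,\alpha)\\(b_1,\beta_1),(b_2,\beta_2)\end{matrix}\right]=\frac1{2\pi\imath}\int_{\mathcal L}\frac{\Gamma(b_1+\beta_1s)\Gamma(1-a-\alpha s)}{\Gamma(1-b_2-\beta_2s)}u^{-s}\,ds$, with $\mathcal L$ a loop from $-\infty-\imath$ to $-\infty+\imath$ that encircles the poles of $\Gamma(b_1+\beta_1s)$ and none of $\Gamma(1-a-\alpha s)$. **Proposition.** (i) Suppose that the integral below converges as an improper integral at infinity (this is automatic if $|q|<2$, and then the integral converges absolutely). Then $$R^{\rm ORA}(\theta)=\begin{cases}-\dfrac1{\theta TB}\ln\left[\displaystyle\int_0^\infty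 C_q(u)\,\mathcal M(\kappa u)\,du\right],&q>0,\\[2ex]-\dfrac1{\theta TB}\ln\left[-\displaystyle\int_0^\infty C_q(u)\,\frac{\partial\mathcal M(\kappa u)}{\partial u}\,du\right],&q<0,\end{cases}$$ and the argument of the logarithm is positive. (ii) $C_q$ is real-valued, and for $q>0$ it is the inverse Laplace transform of $(1+x^q)^{-A}$: one has $\int_0^\infty e^{-xu}C_q(u)\,du=(1+x^q)^{-A}$ for every $x>0$ for which the improper integral converges; it converges absolutely for all $x>0$ if $q\le2$, and for all $x>1$ in any case. (iii) Special cases: $C_1(u)=\dfrac{u^{A-1}e^{-u}}{\Gamma(A)}$ (MRC), $C_2(u)=\dfrac{\sqrt\pi}{\Gamma(A)}\left(\dfrac u2\right)^{A-1/2}J_{A-1/2}(u)$ (EGC), and $C_{-1}(u)={}_1F_1(A;1;-u)$ (AF). -/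

import Mathlib

open MeasureTheory ProbabilityTheory Filter Topology Set

noncomputable section

/-! ### Fox's H-function -/

/-- The Mellin-Barnes density of `H^{m,n}_{P,Q}` with upper parameters `(a i, α i)` and lower
parameters `(b j, β j)`:
`∏_{j ≤ m} Γ(b_j + β_j s) ∏_{i ≤ n} Γ(1 - a_i - α_i s)` divided by
`∏_{j > m} Γ(1 - b_j - β_j s) ∏_{i > n} Γ(a_i + α_i s)`. -/
def foxDensity {P Q : ℕ} (m n : ℕ) (a α : Fin P → ℝ) (b β : Fin Q → ℝ) (s : ℂ) : ℂ :=
  (∏ j : Fin Q, if (j : ℕ) < m then Complex.Gamma ((b j : ℂ) + (β j : ℂ) * s)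
    else (Complex.Gamma (1 - (b j : ℂ) - (β j : ℂ) * s))⁻¹) *
  (∏ i : Fin P, if (i : ℕ) < n then Complex.Gamma (1 - (a i : ℂ) - (α i : ℂ) * s)
    else (Complex.Gamma ((a i : ℂ) + (α i : ℂ) * s))⁻¹)

/-- The abscissa `c` lies strictly to the right of all the poles `-(b_j + k)/β_j` of the factors
`Γ(b_j + β_j s)`, `j ≤ m`, and strictly to the left of all the poles `(1 - a_i + k)/α_i` of the
factors `Γ(1 - a_i - α_i s)`, `i ≤ n`. -/
def FoxSeparates {P Q : ℕ} (m n : ℕ) (a α : Fin P → ℝ) (b β : Fin Q → ℝ) (c : ℝ) : Prop :=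
  (∀ j : Fin Q, (j : ℕ) < m → ∀ k : ℕ, -(b j + k) / β j < c) ∧
  (∀ i : Fin P, (i : ℕ) < n → ∀ k : ℕ, c < (1 - a i + k) / α i)

/-- `(1 / (2πi)) ∫ f(s) ds` along the loop that comes from `-∞ - i` to `c - i`, goes up to `c + i`,
and returns to `-∞ + i`. -/
def leftLoopIntegral (f : ℂ → ℂ) (c : ℝ) : ℂ :=
  (2 * (Real.pi : ℂ) * Complex.I)⁻¹ *
    ((∫ x in Iic c, f ((x : ℂ) - Complex.I))
      + Complex.I * (∫ y in (-1 : ℝ)..1, f ((c : ℂ) + (y : ℂ) * Complex.I))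
      - ∫ x in Iic c, f ((x : ℂ) + Complex.I))

open Classical in
/-- Fox's H-function `H^{m,n}_{P,Q}[z | (a, α); (b, β)]` (real parameters, `α, β > 0`) as the
Mellin-Barnes integral `(1 / (2πi)) ∫ foxDensity(s) z^{-s} ds` along a loop around the poles of the
factors `Γ(b_j + β_j s)` which leaves those of the factors `Γ(1 - a_i - α_i s)` outside. This is
the contour which is admissible for every `z ≠ 0` when `∑ β_j > ∑ α_i`. (All poles are real; the
value does not depend on the separating abscissa.) -/
def foxH {P Q : ℕ} (m n : ℕ) (a α : Fin P → ℝ) (b β : Fin Q → ℝ) (z : ℂ) : ℂ :=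
  if h : ∃ c : ℝ, FoxSeparates m n a α b β c then
    leftLoopIntegral (fun s => foxDensity m n a α b β s * z ^ (-s)) h.choose
  else 0

/-! ### Other special functions -/

/-- The Bessel function of the first kind of real order `ν`, for `x > 0`. -/
def besselJ (ν x : ℝ) : ℝ :=
  ∑' k : ℕ, (-1) ^ k / (k.factorial * Real.Gamma (k + ν + 1)) * (x / 2) ^ (2 * (k : ℝ) + ν)

/-- Kummer's function `₁F₁(a; c; x)`, from the regularized hypergeometric function. -/
def kummer (a c x : ℝ) : ℂ :=
  Complex.Gamma (c : ℂ) * Complex.regularizedHGFun {(a : ℂ)} {(c : ℂ)} (x : ℂ)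

/-! ### The kernel -/

/-- The H-function expression of the kernel `C_q(u)`. -/
def kernelH (A q u : ℝ) : ℂ :=
  if 0 < q then
    ((u⁻¹ / (q * Real.Gamma A) : ℝ) : ℂ) *
      foxH 1 1 ![1] ![1 / q] ![A, 1] ![1 / q, 1] (u : ℂ)
  else
    ((1 / (|q| * Real.Gamma A) : ℝ) : ℂ) *
      foxH 1 1 ![1 - A] ![1 / |q|] ![0, 0] ![1 / |q|, 1] (u : ℂ)

/-- The kernel `C_q(u)` as a real number. -/
def kernelC (A q u : ℝ) : ℝ := (kernelH A q u).re

/-! ### Effective capacity of an `L_p`-norm diversity receiver -/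

/-- `∑_ℓ r_ℓ ^ p`. -/
def powerSum {L : ℕ} (p : ℝ) (r : Fin L → ℝ) : ℝ := ∑ l, r l ^ p

/-- The output SNR `K (E_s / N_0) (∑_ℓ r_ℓ ^ p) ^ q`. -/
def endSNR {L : ℕ} (K Es N0 p q : ℝ) (r : Fin L → ℝ) : ℝ :=
  K * (Es / N0) * powerSum p r ^ q

/-- The normalized QoS exponent `A = θ T B / ln 2`. -/
def qosExponent (θ T B : ℝ) : ℝ := θ * T * B / Real.log 2

/-- Service rate `B T log₂ (1 + γ)` under optimal rate adaptation. -/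
def oraServiceRate (T B γ : ℝ) : ℝ := B * T * Real.logb 2 (1 + γ)

/-- `c` is the effective capacity `-lim_N (1 / (N θ T B)) ln E[exp(-θ ∑_{n < N} S[n])]` of the
service process `S`. -/
def IsEffectiveCapacity {Ω : Type*} [MeasurableSpace Ω] (μ : Measure Ω) (θ T B : ℝ)
    (S : ℕ → Ω → ℝ) (c : ℝ) : Prop :=
  Tendsto (fun N : ℕ => -(1 / (N * θ * T * B)) *
    Real.log (∫ ω, Real.exp (-θ * ∑ n ∈ Finset.range N, S n ω) ∂μ)) atTop (𝓝 c)

/-- The effective capacity `-(1 / (θ T B)) ln E[(1 + γ) ^ (-A)]` under optimal rate adaptation, in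
terms of the SNR `γ` of one block. -/
def oraEffectiveCapacity {Ω : Type*} [MeasurableSpace Ω] (μ : Measure Ω) (θ T B : ℝ)
    (γ : Ω → ℝ) : ℝ :=
  -(1 / (θ * T * B)) * Real.log (∫ ω, (1 + γ ω) ^ (-qosExponent θ T B) ∂μ)

/-- The joint MGF `E[exp(-u ∑_ℓ R_ℓ ^ p)]`. -/
def jointMGF {Ω : Type*} [MeasurableSpace Ω] (μ : Measure Ω) {L : ℕ} (p : ℝ)
    (R : Fin L → Ω → ℝ) (u : ℝ) : ℝ :=
  ∫ ω, Real.exp (-u * powerSum p (fun l => R l ω)) ∂μ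

/-- The integrand `C_q(u) M(κ u)` if `q > 0`, and `-C_q(u) ∂/∂u M(κ u)` if `q < 0`. -/
def capacityIntegrand (A q κ : ℝ) (M : ℝ → ℝ) (u : ℝ) : ℝ :=
  if 0 < q then kernelC A q u * M (κ * u)
  else -(kernelC A q u * deriv (fun v => M (κ * v)) u)

/-- `∫_0^∞ f` converges, as an improper integral at infinity, with value `I`. -/
def HasImproperIntegral (f : ℝ → ℝ) (I : ℝ) : Prop :=
  (∀ N : ℝ, 0 < N → IntervalIntegrable f volume 0 N) ∧
    Tendsto (fun N : ℝ => ∫ u in (0 : ℝ)..N, f u) atTop (𝓝 I)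

end

/-!
Expanding the Fox H-function at the poles of `Γ(b₁ + β₁ s)` shows that the kernel is a Prabhakar
(three-parameter Mittag-Leffler) function
`P(u) = ∑ (-1)^k Γ(A + k) / (Γ(A) k!) u^(b - 1 + ρ k) / Γ(b + ρ k)`, with `b = ρ A` for `q > 0` and
`b = 1` for `q < 0`, where `ρ = |q|` (`kernelC_eq_prabhakar`). The integrand of the H-function
decays like `exp (re s)` to the left, because `1 / Γ(γ - s)` beats the exponential growth of the
other two Gamma factors, so the loop integral is the sum of its residues. Reality of the kernel and
the special cases `q = 1, 2, -1` can be read off from the series.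

Integrated termwise, the series gives the Laplace transform `L(x) = x^(-b) (1 + x^(-ρ))^(-A)` for
`x > 1` (`laplace_prabhakar`). Put `Y = κ X`, and let `W = 1` for `q > 0` and `W = Y` for `q < 0`.
Then `W L(Y) = (1 + Y^q)^(-A) = (1 + γ_end)^(-A)`, while the integrand of the proposition is
`P(u) E[W exp(-u Y)]`. Formally, Fubini's theorem finishes the proof, but the integral may converge
only conditionally, and `L` is the transform of `P`, in general, only on `x > 1`. Therefore a
factor `exp(-x u)` is inserted. For `x > 1` Fubini applies and gives `E[W L(x + Y)]`. Both sides
continue holomorphically to a narrow sector around the positive half-line on which `x^(-ρ)` has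
positive real part, so that `|W L(x + Y)| ≤ 1`; they agree there by the identity theorem, and
`x → 0` gives the claim, by Abel's theorem on the left and dominated convergence on the right
(`eq_integral_of_hasImproperIntegral`, `eq_integral_one_add_rpow`). The Laplace transform of the
kernel itself is the case of a constant `Y`.

Absolute convergence needs the size of `P` at infinity when `ρ ≤ 2`, where `1 + x^(-ρ)` has no zero
on `re x > 0` and `L` is holomorphic there. The second derivative of `L` is the transform of
`u² P(u)` and is integrable on vertical lines; Bromwich inversion on the line `re x = 1 / u` shows
for `ρ < 2` that `P` is bounded if `b = 1`, and `O(u^(-1 - δ))` at infinity for some `δ > 0` if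
`b = ρ A`. For `ρ = 2` the zeros `±i` lie on the imaginary axis, and inversion on `re x = σ` yields
only `P(u) = O(exp(σ u))` for every `σ > 0`.
-/

/-! ### Loop integrals and the residue of a simple pole -/

/-- The integral of `f` along the boundary of `[a, c] × [-1, 1]`, counterclockwise. -/
noncomputable def rectIntegral (f : ℂ → ℂ) (a c : ℝ) : ℂ :=
  (∫ x in a..c, f ((x : ℂ) - Complex.I)) - (∫ x in a..c, f ((x : ℂ) + Complex.I))
    + Complex.I * (∫ y in (-1 : ℝ)..1, f ((c : ℂ) + (y : ℂ) * Complex.I))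
    - Complex.I * (∫ y in (-1 : ℝ)..1, f ((a : ℂ) + (y : ℂ) * Complex.I))

lemma rectIntegral_eq_zero {f : ℂ → ℂ} {a c : ℝ} (hac : a ≤ c)
    (hf : DifferentiableOn ℂ f (Icc a c ×ℂ Icc (-1) 1)) : rectIntegral f a c = 0 := by
  have h := Complex.integral_boundary_rect_eq_zero_of_differentiableOn f
    ((a : ℂ) - Complex.I) ((c : ℂ) + Complex.I) (by simpa [uIcc_of_le hac] using hf)
  simpa [rectIntegral, ← sub_eq_add_neg] using h

lemma leftLoopIntegral_sub {f : ℂ → ℂ} {a c : ℝ}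
    (h₁ : IntegrableOn (fun x : ℝ => f ((x : ℂ) - Complex.I)) (Iic c))
    (h₂ : IntegrableOn (fun x : ℝ => f ((x : ℂ) + Complex.I)) (Iic c)) (hac : a ≤ c) :
    leftLoopIntegral f c - leftLoopIntegral f a
      = (2 * (Real.pi : ℂ) * Complex.I)⁻¹ * rectIntegral f a c := by
  have e₁ := intervalIntegral.integral_Iic_sub_Iic (h₁.mono_set (Iic_subset_Iic.2 hac)) h₁
  have e₂ := intervalIntegral.integral_Iic_sub_Iic (h₂.mono_set (Iic_subset_Iic.2 hac)) h₂
  rw [leftLoopIntegral, leftLoopIntegral, rectIntegral, ← e₁, ← e₂]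
  ring

lemma Complex.log_sub_log_neg_of_im_pos {z : ℂ} (hz : 0 < z.im) :
    Complex.log z - Complex.log (-z) = Real.pi * Complex.I := by
  rw [Complex.log, Complex.log, norm_neg, Complex.arg_neg_eq_arg_sub_pi_of_im_pos hz]
  push_cast; ring

lemma Complex.log_sub_log_neg_of_im_neg {z : ℂ} (hz : z.im < 0) :
    Complex.log z - Complex.log (-z) = -(Real.pi * Complex.I) := by
  rw [Complex.log, Complex.log, norm_neg, Complex.arg_neg_eq_arg_add_pi_of_im_neg hz]
  push_cast; ring

/-- The fundamental theorem of calculus for `1 / φ` along an affine path `φ` that avoids the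
negative real axis. -/
lemma integral_inv_affine (z d : ℂ) (a c : ℝ)
    (h : ∀ t : ℝ, z + t * d ∈ Complex.slitPlane) :
    d * (∫ t in a..c, (z + t * d)⁻¹) = Complex.log (z + c * d) - Complex.log (z + a * d) := by
  have hd : ∀ t : ℝ, HasDerivAt (fun t : ℝ => Complex.log (z + t * d)) (d / (z + t * d)) t := by
    intro t
    refine HasDerivAt.clog_real ?_ (h t)
    simpa using ((Complex.ofRealCLM.hasDerivAt (x := t)).mul_const d).const_add z
  have hne : ∀ t : ℝ, z + t * d ≠ 0 := fun t => Complex.slitPlane_ne_zero (h t)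
  have hc : Continuous fun t : ℝ => d / (z + t * d) :=
    continuous_const.div (by fun_prop) hne
  rw [← intervalIntegral.integral_eq_sub_of_hasDerivAt (fun t _ => hd t)
    (hc.intervalIntegrable a c), ← intervalIntegral.integral_const_mul]
  rfl

lemma rectIntegral_inv_sub {a s₀ c : ℝ} (ha : a < s₀) (hc : s₀ < c) :
    rectIntegral (fun s => (s - s₀)⁻¹) a c = 2 * Real.pi * Complex.I := by
  have h1 := integral_inv_affine (-(s₀ : ℂ) - Complex.I) 1 a c
    (fun t => Or.inr (by simp))
  have h2 := integral_inv_affine (-(s₀ : ℂ) + Complex.I) 1 a c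
    (fun t => Or.inr (by simp))
  have h3 := integral_inv_affine ((c : ℂ) - s₀) Complex.I (-1) 1
    (fun t => Or.inl (by simpa using hc))
  have h4 := integral_inv_affine (-((a : ℂ) - s₀)) (-Complex.I) (-1) 1
    (fun t => Or.inl (by simpa using ha))
  have e1 : (∫ t in a..c, (-(s₀ : ℂ) - Complex.I + (t : ℂ) * 1)⁻¹)
      = ∫ x in a..c, ((x : ℂ) - Complex.I - s₀)⁻¹ := by
    congr 1; ext t; congr 1; ring
  have e2 : (∫ t in a..c, (-(s₀ : ℂ) + Complex.I + (t : ℂ) * 1)⁻¹)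
      = ∫ x in a..c, ((x : ℂ) + Complex.I - s₀)⁻¹ := by
    congr 1; ext t; congr 1; ring
  have e3 : (∫ t in (-1:ℝ)..1, ((c : ℂ) - s₀ + (t : ℂ) * Complex.I)⁻¹)
      = ∫ y in (-1:ℝ)..1, ((c : ℂ) + y * Complex.I - s₀)⁻¹ := by
    congr 1; ext t; congr 1; ring
  have e4 : (∫ t in (-1:ℝ)..1, (-((a : ℂ) - s₀) + (t : ℂ) * -Complex.I)⁻¹)
      = -∫ y in (-1:ℝ)..1, ((a : ℂ) + y * Complex.I - s₀)⁻¹ := by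
    rw [← intervalIntegral.integral_neg]
    congr 1; ext t; rw [← inv_neg]; congr 1; ring
  rw [e1] at h1; rw [e2] at h2; rw [e3] at h3; rw [e4] at h4
  have l1 := Complex.log_sub_log_neg_of_im_pos (z := (a : ℂ) - s₀ + Complex.I) (by simp)
  have l2 := Complex.log_sub_log_neg_of_im_neg (z := (a : ℂ) - s₀ - Complex.I) (by simp)
  have a1 : -(s₀ : ℂ) - Complex.I + c * 1 = c - s₀ + (-1 : ℝ) * Complex.I := by push_cast; ring
  have a2 : -(s₀ : ℂ) + Complex.I + c * 1 = c - s₀ + (1 : ℝ) * Complex.I := by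
    push_cast; ring
  have a3 : -(s₀ : ℂ) - Complex.I + a * 1 = a - s₀ - Complex.I := by ring
  have a4 : -(s₀ : ℂ) + Complex.I + a * 1 = a - s₀ + Complex.I := by ring
  have a5 : -((a : ℂ) - s₀) + (1 : ℝ) * -Complex.I = -(a - s₀ + Complex.I) := by
    rw [Complex.ofReal_one]; ring
  have a6 : -((a : ℂ) - s₀) + (-1 : ℝ) * -Complex.I = -(a - s₀ - Complex.I) := by
    push_cast; ring
  rw [a1, a3] at h1; rw [a2, a4] at h2; rw [a5, a6] at h4
  rw [rectIntegral]
  linear_combination h1 - h2 + h3 - h4 + l1 - l2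

/-- The residue theorem for a rectangle and one simple pole. -/
lemma rectIntegral_div_sub {g : ℂ → ℂ} {U : Set ℂ} (hU : IsOpen U) (hg : DifferentiableOn ℂ g U)
    {a s₀ c : ℝ} (ha : a < s₀) (hc : s₀ < c) (hsub : Icc a c ×ℂ Icc (-1) 1 ⊆ U) :
    rectIntegral (fun s => g s / (s - s₀)) a c = 2 * Real.pi * Complex.I * g s₀ := by
  have hs₀ : (s₀ : ℂ) ∈ U := hsub ⟨⟨by simpa using ha.le, by simpa using hc.le⟩, by simp⟩
  have hd : DifferentiableOn ℂ (dslope g s₀) U :=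
    (Complex.differentiableOn_dslope (hU.mem_nhds hs₀)).2 hg
  have h0 := rectIntegral_eq_zero (ha.trans hc).le (hd.mono hsub)
  -- Off `s₀`, `g s / (s - s₀) = dslope g s₀ s + g s₀ / (s - s₀)`.
  have key : ∀ s : ℂ, s ≠ s₀ → g s / (s - s₀) = dslope g s₀ s + g s₀ * (s - s₀)⁻¹ := by
    intro s hs
    have : s - s₀ ≠ 0 := sub_ne_zero.2 hs
    rw [dslope_of_ne _ hs, slope_def_field]
    field_simp; ring
  have im_ne : ∀ {s : ℂ}, s.im ≠ 0 → s ≠ s₀ := by rintro s hs rfl; simp at hs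
  have re_ne : ∀ {s : ℂ}, s.re ≠ s₀ → s ≠ s₀ := by rintro s hs rfl; simp at hs
  have hcd : ContinuousOn (dslope g s₀) (Icc a c ×ℂ Icc (-1) 1) := (hd.mono hsub).continuousOn
  have hac := (ha.trans hc).le
  have split : ∀ (φ : ℝ → ℂ) (p r : ℝ), p ≤ r → Continuous φ →
      (∀ t ∈ Icc p r, φ t ∈ Icc a c ×ℂ Icc (-1) 1) → (∀ t ∈ Icc p r, φ t ≠ s₀) →
      ∫ t in p..r, g (φ t) / (φ t - s₀)
        = (∫ t in p..r, dslope g s₀ (φ t)) + g s₀ * ∫ t in p..r, (φ t - s₀)⁻¹ := by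
    intro φ p r hpr hφ hin hne
    rw [← intervalIntegral.integral_const_mul, ← intervalIntegral.integral_add]
    · apply intervalIntegral.integral_congr
      intro t ht
      rw [uIcc_of_le hpr] at ht
      exact key _ (hne t ht)
    · apply ContinuousOn.intervalIntegrable
      rw [uIcc_of_le hpr]
      exact hcd.comp hφ.continuousOn hin
    · apply ContinuousOn.intervalIntegrable
      rw [uIcc_of_le hpr]
      exact continuousOn_const.mul ((hφ.continuousOn.sub continuousOn_const).inv₀
        fun t ht => sub_ne_zero.2 (hne t ht))
  have hr := rectIntegral_inv_sub ha hc
  rw [rectIntegral] at h0 hr ⊢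
  have i₁ := split (fun x => x - Complex.I) a c hac (by fun_prop)
    (fun t ht => by rw [Complex.mem_reProdIm]; simpa using ht) (fun t _ => im_ne (by simp))
  have i₂ := split (fun x => x + Complex.I) a c hac (by fun_prop)
    (fun t ht => by rw [Complex.mem_reProdIm]; simpa using ht) (fun t _ => im_ne (by simp))
  have i₃ := split (fun y => c + y * Complex.I) (-1) 1 (by norm_num) (by fun_prop)
    (fun t ht => by rw [Complex.mem_reProdIm]; simpa [hac] using ht)
    (fun t _ => re_ne (by simpa using hc.ne'))
  have i₄ := split (fun y => a + y * Complex.I) (-1) 1 (by norm_num) (by fun_prop)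
    (fun t ht => by rw [Complex.mem_reProdIm]; simpa [hac] using ht)
    (fun t _ => re_ne (by simpa using ha.ne))
  rw [i₁, i₂, i₃, i₄]
  linear_combination h0 + g s₀ * hr

lemma rectIntegral_congr {f g : ℂ → ℂ} {a c : ℝ} (hac : a ≤ c)
    (h : ∀ s ∈ Icc a c ×ℂ Icc (-1) 1, f s = g s) : rectIntegral f a c = rectIntegral g a c := by
  have key : ∀ (φ : ℝ → ℂ) (p r : ℝ), p ≤ r → (∀ t ∈ Icc p r, φ t ∈ Icc a c ×ℂ Icc (-1) 1) →
      ∫ t in p..r, f (φ t) = ∫ t in p..r, g (φ t) := by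
    intro φ p r hpr hin
    apply intervalIntegral.integral_congr
    intro t ht
    rw [uIcc_of_le hpr] at ht
    exact h _ (hin t ht)
  have i₁ := key (fun x => x - Complex.I) a c hac
    (fun t ht => by rw [Complex.mem_reProdIm]; simpa using ht)
  have i₂ := key (fun x => x + Complex.I) a c hac
    (fun t ht => by rw [Complex.mem_reProdIm]; simpa using ht)
  have i₃ := key (fun y => c + y * Complex.I) (-1) 1 (by norm_num)
    (fun t ht => by rw [Complex.mem_reProdIm]; simpa [hac] using ht)
  have i₄ := key (fun y => a + y * Complex.I) (-1) 1 (by norm_num)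
    (fun t ht => by rw [Complex.mem_reProdIm]; simpa [hac] using ht)
  rw [rectIntegral, rectIntegral, i₁, i₂, i₃, i₄]

/-! ### The Mellin-Barnes integrand -/

/-- The integrand `Γ(β + s/ρ) Γ(α - s/ρ) / Γ(γ - s) u^{-s}`, which covers both kernels:
`(α, β, γ) = (0, A, 0)` for `q = ρ > 0` and `(α, β, γ) = (A, 0, 1)` for `q = -ρ < 0`. -/
noncomputable def mellinBarnes (α β γ ρ u : ℝ) (s : ℂ) : ℂ :=
  Complex.Gamma (β + s / ρ) * Complex.Gamma (α - s / ρ) * (Complex.Gamma (γ - s))⁻¹ *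
    (u : ℂ) ^ (-s)

/-- A function that does not increase under `z ↦ z + 1` is bounded on `R ≤ re z` by its bound on
`R ≤ re z ≤ R + 1`. -/
lemma le_of_shift_le {S : Set ℂ} {φ : ℂ → ℝ} {R M : ℝ} (hS : ∀ z ∈ S, z - 1 ∈ S)
    (hstep : ∀ z ∈ S, R ≤ z.re → φ (z + 1) ≤ φ z)
    (hbase : ∀ z ∈ S, R ≤ z.re → z.re ≤ R + 1 → φ z ≤ M) :
    ∀ z ∈ S, R ≤ z.re → φ z ≤ M := by
  have key : ∀ n : ℕ, ∀ z ∈ S, R ≤ z.re → z.re ≤ R + 1 + n → φ z ≤ M := by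
    intro n
    induction n with
    | zero => intro z hz h1 h2; exact hbase z hz h1 (by simpa using h2)
    | succ n ih =>
      intro z hz h1 h2
      by_cases h : z.re ≤ R + 1
      · exact hbase z hz h1 h
      · push Not at h
        push_cast at h2
        have h3 := hstep (z - 1) (hS z hz) (by simp; linarith)
        rw [sub_add_cancel] at h3
        exact h3.trans (ih _ (hS z hz) (by simp; linarith) (by simp; linarith))
  intro z hz h1
  obtain ⟨n, hn⟩ := exists_nat_ge (z.re - R)
  exact key n z hz h1 (by linarith)

lemma isCompact_of_isClosed_of_re_im {K : Set ℂ} (hK : IsClosed K) (a b c d : ℝ)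
    (h : ∀ z ∈ K, (a ≤ z.re ∧ z.re ≤ b) ∧ c ≤ z.im ∧ z.im ≤ d) : IsCompact K :=
  (isCompact_Icc.reProdIm isCompact_Icc).of_isClosed_subset (s := Icc a b ×ℂ Icc c d) hK
    fun z hz => h z hz

/-- `1 / Γ` decays in a right half-strip faster than any exponential. -/
lemma exists_norm_inv_Gamma_le (B r : ℝ) : ∃ C : ℝ, 0 ≤ C ∧ ∀ z : ℂ, r ≤ z.re → |z.im| ≤ 1 →
    ‖(Complex.Gamma z)⁻¹‖ ≤ C * Real.exp (-B * z.re) := by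
  set R := max r (Real.exp B)
  set φ : ℂ → ℝ := fun z => Real.exp (B * z.re) * ‖(Complex.Gamma z)⁻¹‖ with hφ
  have hcont : Continuous φ := by
    have : Continuous fun z : ℂ => (Complex.Gamma z)⁻¹ :=
      Complex.differentiable_one_div_Gamma.continuous
    have h2 := Complex.continuous_re
    fun_prop
  have hK : IsCompact {z : ℂ | (r ≤ z.re ∧ z.re ≤ R + 1) ∧ |z.im| ≤ 1} := by
    refine isCompact_of_isClosed_of_re_im ?_ r (R + 1) (-1) 1 (fun z hz => ⟨hz.1, abs_le.1 hz.2⟩)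
    exact ((isClosed_le continuous_const Complex.continuous_re).inter
      (isClosed_le Complex.continuous_re continuous_const)).inter
      (isClosed_le (continuous_abs.comp Complex.continuous_im) continuous_const)
  obtain ⟨C, hC⟩ := hK.bddAbove_image hcont.continuousOn
  have hC' : ∀ z : ℂ, r ≤ z.re → z.re ≤ R + 1 → |z.im| ≤ 1 → φ z ≤ C := fun z h1 h2 h3 =>
    hC ⟨z, ⟨⟨h1, h2⟩, h3⟩, rfl⟩
  have hall : ∀ z ∈ {z : ℂ | |z.im| ≤ 1}, R ≤ z.re → φ z ≤ C := by
    apply le_of_shift_le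
    · intro z hz; simpa using hz
    · intro z _ hR
      have hzre : Real.exp B ≤ z.re := (le_max_right _ _).trans hR
      have hz0 : z ≠ 0 := by
        rintro rfl
        exact absurd hzre (by simpa using Real.exp_pos B)
      have hzn : Real.exp B ≤ ‖z‖ := hzre.trans (Complex.re_le_norm z)
      rw [hφ]
      simp only [Complex.add_re, Complex.one_re, Complex.Gamma_add_one z hz0, mul_inv, norm_mul,
        norm_inv]
      rw [mul_add, Real.exp_add, mul_one, mul_assoc]
      gcongr
      rw [← mul_assoc]
      refine mul_le_of_le_one_left (by positivity) ?_
      rw [← div_eq_mul_inv]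
      exact (div_le_one ((Real.exp_pos B).trans_le hzn)).2 hzn
    · intro z hz h1 h2
      exact hC' z ((le_max_left _ _).trans h1) h2 hz
  refine ⟨max C 0, le_max_right _ _, fun z h1 h3 => ?_⟩
  have : φ z ≤ C := by
    by_cases h : z.re ≤ R + 1
    · exact hC' z h1 h h3
    · exact hall z h3 (by linarith)
  rw [neg_mul, Real.exp_neg, ← div_eq_mul_inv, le_div_iff₀ (Real.exp_pos _), mul_comm]
  exact this.trans (le_max_left _ _)

/-- Away from the poles, `Γ(β + w) Γ(α - w)` grows at most exponentially as `re w → -∞`, because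
`w ↦ w - 1` multiplies it by the bounded factor `(α - w) / (β + w - 1)`. -/
lemma exists_norm_Gamma_mul_Gamma_le {α β η h c : ℝ} (hη : 0 < η) (hc : c < α) :
    ∃ C l : ℝ, 0 ≤ C ∧ ∀ w : ℂ, w.re ≤ c → |w.im| ≤ h → (∀ j : ℤ, η ≤ ‖(β : ℂ) + w + j‖) →
      ‖Complex.Gamma (β + w) * Complex.Gamma (α - w)‖ ≤ C * Real.exp (-l * w.re) := by
  set D := 1 + |α + β - 1| / η with hD
  have hD0 : 0 < D := by positivity
  set S : Set ℂ := {z : ℂ | |z.im| ≤ h ∧ ∀ j : ℤ, η ≤ ‖(β : ℂ) - z + j‖}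
  set φ : ℂ → ℝ := fun z => Real.exp (-Real.log D * z.re) *
    ‖Complex.Gamma (β - z) * Complex.Gamma (α + z)‖ with hφ
  have hK : IsCompact {z : ℂ | (-c ≤ z.re ∧ z.re ≤ -c + 1) ∧ z ∈ S} := by
    refine isCompact_of_isClosed_of_re_im ?_ (-c) (-c + 1) (-h) h
      (fun z hz => ⟨hz.1, abs_le.1 hz.2.1⟩)
    refine ((isClosed_le continuous_const Complex.continuous_re).inter
      (isClosed_le Complex.continuous_re continuous_const)).inter
      ((isClosed_le (continuous_abs.comp Complex.continuous_im) continuous_const).inter ?_)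
    have e : {z : ℂ | ∀ j : ℤ, η ≤ ‖(β : ℂ) - z + j‖}
        = ⋂ j : ℤ, {z : ℂ | η ≤ ‖(β : ℂ) - z + j‖} := by ext z; simp
    change IsClosed {z : ℂ | ∀ j : ℤ, η ≤ ‖(β : ℂ) - z + j‖}
    rw [e]
    exact isClosed_iInter fun j => isClosed_le continuous_const (by fun_prop)
  have hcont : ContinuousOn φ {z : ℂ | (-c ≤ z.re ∧ z.re ≤ -c + 1) ∧ z ∈ S} := by
    intro z hz
    have h1 : ContinuousAt Complex.Gamma (β - z) := by
      refine (Complex.differentiableAt_Gamma _ fun m hm => ?_).continuousAt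
      have := hz.2.2 m
      rw [hm] at this
      simp at this
      linarith
    have h2 : ContinuousAt Complex.Gamma (α + z) := by
      refine (Complex.differentiableAt_Gamma _ fun m hm => ?_).continuousAt
      have h3 := congrArg Complex.re hm
      simp at h3
      have : (0 : ℝ) ≤ m := m.cast_nonneg
      linarith [hz.1.1]
    have h1' : ContinuousAt (fun z : ℂ => Complex.Gamma (β - z)) z :=
      ContinuousAt.comp (f := fun z : ℂ => (β : ℂ) - z) h1 (by fun_prop)
    have h2' : ContinuousAt (fun z : ℂ => Complex.Gamma (α + z)) z :=
      ContinuousAt.comp (f := fun z : ℂ => (α : ℂ) + z) h2 (by fun_prop)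
    have h3 : ContinuousAt (fun z : ℂ => Real.exp (-Real.log D * z.re)) z :=
      (Real.continuous_exp.comp (continuous_const.mul Complex.continuous_re)).continuousAt
    exact (h3.mul (h1'.mul h2').norm).continuousWithinAt
  obtain ⟨C, hC⟩ := hK.bddAbove_image hcont
  have hall : ∀ z ∈ S, -c ≤ z.re → φ z ≤ C := by
    apply le_of_shift_le
    · intro z hz
      refine ⟨by simpa using hz.1, fun j => ?_⟩
      have := hz.2 (j + 1)
      convert this using 2
      push_cast; ring
    · intro z hz hzc
      have hne : (β : ℂ) - z - 1 ≠ 0 := by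
        intro h0
        have := hz.2 (-1)
        rw [Int.cast_neg, Int.cast_one, ← sub_eq_add_neg, h0, norm_zero] at this
        linarith
      have hne2 : (α : ℂ) + z ≠ 0 := by
        intro h0
        have := congrArg Complex.re h0
        simp at this
        linarith
      have hη1 : η ≤ ‖(β : ℂ) - z - 1‖ := by
        have := hz.2 (-1)
        rwa [Int.cast_neg, Int.cast_one, ← sub_eq_add_neg] at this
      have hratio : ‖(α : ℂ) + z‖ ≤ D * ‖(β : ℂ) - z - 1‖ := by
        have e : (α : ℂ) + z = ((α + β - 1 : ℝ) : ℂ) - (β - z - 1) := by push_cast; ring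
        rw [e]
        refine (norm_sub_le _ _).trans ?_
        rw [Complex.norm_real, Real.norm_eq_abs, hD, add_mul, one_mul, add_comm]
        gcongr
        rw [div_mul_eq_mul_div, le_div_iff₀ hη]
        gcongr
      have g1 := Complex.Gamma_add_one _ hne
      have g2 := Complex.Gamma_add_one _ hne2
      rw [sub_add_cancel] at g1
      have e1 : (β : ℂ) - (z + 1) = β - z - 1 := by ring
      have e2 : (α : ℂ) + (z + 1) = α + z + 1 := by ring
      rw [hφ]
      simp only [e1, e2, g2, g1, norm_mul, Complex.add_re, Complex.one_re]
      rw [mul_add, Real.exp_add, mul_one, Real.exp_neg (Real.log D), Real.exp_log hD0, mul_assoc]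
      refine mul_le_mul_of_nonneg_left ?_ (Real.exp_pos _).le
      rw [inv_mul_le_iff₀ hD0]
      calc _ = ‖(α : ℂ) + z‖ *
            (‖Complex.Gamma (β - z - 1)‖ * ‖Complex.Gamma (α + z)‖) := by ring
        _ ≤ (D * ‖(β : ℂ) - z - 1‖) *
            (‖Complex.Gamma (β - z - 1)‖ * ‖Complex.Gamma (α + z)‖) := by gcongr
        _ = _ := by ring
    · intro z hz h1 h2
      exact hC ⟨z, ⟨⟨h1, h2⟩, hz⟩, rfl⟩
  refine ⟨max C 0, Real.log D, le_max_right _ _, fun w h1 h2 h3 => ?_⟩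
  have := hall (-w) ⟨by simpa using h2, fun j => by simpa using h3 j⟩ (by simpa using h1)
  rw [hφ] at this
  simp only [sub_neg_eq_add, Complex.neg_re, mul_neg, neg_mul, neg_neg,
    ← sub_eq_add_neg] at this
  rw [neg_mul, Real.exp_neg, ← div_eq_mul_inv, le_div_iff₀ (Real.exp_pos _), mul_comm]
  exact this.trans (le_max_left _ _)

/-- On a left half-strip and away from the poles, the integrand is `O(exp (re s))`, because the
decay of `1 / Γ(γ - s)` beats the exponential growth of the other factors. -/
lemma exists_norm_mellinBarnes_le {α β γ ρ u η c : ℝ} (hρ : 0 < ρ) (hu : 0 < u) (hη : 0 < η)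
    (hc : c < ρ * α) :
    ∃ C : ℝ, 0 ≤ C ∧ ∀ s : ℂ, s.re ≤ c → |s.im| ≤ 1 → (∀ j : ℤ, η ≤ ‖(β : ℂ) + s / ρ + j‖) →
      ‖mellinBarnes α β γ ρ u s‖ ≤ C * Real.exp s.re := by
  have hc' : c / ρ < α := (div_lt_iff₀' hρ).2 hc
  obtain ⟨C₁, l, hC₁, h₁⟩ := exists_norm_Gamma_mul_Gamma_le (β := β) (h := 1 / ρ) hη hc'
  obtain ⟨C₂, hC₂, h₂⟩ := exists_norm_inv_Gamma_le (l / ρ + Real.log u + 1) (γ - c)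
  refine ⟨C₁ * (C₂ * Real.exp (-(l / ρ + Real.log u + 1) * γ)), by positivity,
    fun s hs1 hs2 hs3 => ?_⟩
  have e1 := h₁ (s / ρ) (by rw [Complex.div_ofReal_re]; gcongr)
    (by rw [Complex.div_ofReal_im, abs_div, abs_of_pos hρ]; gcongr) hs3
  have e2 := h₂ (γ - s) (by simp; linarith) (by simpa using hs2)
  rw [mellinBarnes, norm_mul, norm_mul, Complex.norm_cpow_eq_rpow_re_of_pos hu]
  calc _ ≤ (C₁ * Real.exp (-l * (s / ρ).re)) *
        (C₂ * Real.exp (-(l / ρ + Real.log u + 1) * ((γ : ℂ) - s).re)) * u ^ (-s).re := by gcongr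
    _ = C₁ * C₂ * Real.exp (-l * (s / ρ).re + -(l / ρ + Real.log u + 1) * ((γ : ℂ) - s).re +
          Real.log u * (-s).re) := by
        rw [Real.rpow_def_of_pos hu, Real.exp_add, Real.exp_add]; ring
    _ = C₁ * C₂ * Real.exp (-(l / ρ + Real.log u + 1) * γ + s.re) := by
        congr 2
        rw [Complex.div_ofReal_re]
        simp
        field_simp
        ring
    _ = _ := by rw [Real.exp_add]; ring

lemma differentiableAt_mellinBarnes {α β γ ρ u : ℝ} (hu : 0 < u) {s : ℂ}
    (h₁ : ∀ m : ℕ, (β : ℂ) + s / ρ ≠ -m) (h₂ : ∀ m : ℕ, (α : ℂ) - s / ρ ≠ -m) :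
    DifferentiableAt ℂ (mellinBarnes α β γ ρ u) s := by
  have d1 : DifferentiableAt ℂ (fun s : ℂ => Complex.Gamma (β + s / ρ)) s :=
    (Complex.differentiableAt_Gamma _ h₁).comp s (f := fun s : ℂ => (β : ℂ) + s / ρ) (by fun_prop)
  have d2 : DifferentiableAt ℂ (fun s : ℂ => Complex.Gamma (α - s / ρ)) s :=
    (Complex.differentiableAt_Gamma _ h₂).comp s (f := fun s : ℂ => (α : ℂ) - s / ρ) (by fun_prop)
  have d3 : DifferentiableAt ℂ (fun s : ℂ => (Complex.Gamma (γ - s))⁻¹) s :=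
    (Complex.differentiable_one_div_Gamma _).comp s (f := fun s : ℂ => (γ : ℂ) - s) (by fun_prop)
  have d4 : DifferentiableAt ℂ (fun s : ℂ => (u : ℂ) ^ (-s)) s :=
    (differentiableAt_id.neg).const_cpow (Or.inl (by exact_mod_cast hu.ne'))
  exact ((d1.mul d2).mul d3).mul d4

lemma integrableOn_mellinBarnes_horizontal {α β γ ρ u c τ : ℝ} (hρ : 0 < ρ) (hu : 0 < u)
    (hc : c < ρ * α) (hτ : |τ| = 1) :
    IntegrableOn (fun x : ℝ => mellinBarnes α β γ ρ u (x + τ * Complex.I)) (Iic c) := by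
  have hτ0 : τ ≠ 0 := by rintro rfl; simp at hτ
  obtain ⟨C, -, h⟩ := exists_norm_mellinBarnes_le (β := β) (γ := γ) hρ hu
    (η := 1 / ρ) (by positivity) hc
  have hb : IntegrableOn (fun x : ℝ => C * Real.exp x) (Iic c) :=
    (integrableOn_exp_Iic c).const_mul C
  refine Integrable.mono' hb ?_ ?_
  · refine (Continuous.aestronglyMeasurable ?_)
    rw [continuous_iff_continuousAt]
    intro x
    refine ContinuousAt.comp (f := fun x : ℝ => (x : ℂ) + τ * Complex.I)
      (g := mellinBarnes α β γ ρ u)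
      (differentiableAt_mellinBarnes hu (fun m hm => ?_) (fun m hm => ?_)).continuousAt
      (by fun_prop)
    all_goals
      have := congrArg Complex.im hm
      simp [Complex.div_ofReal_im, hρ.ne', hτ0] at this
  · refine (ae_restrict_mem measurableSet_Iic).mono fun x hx => ?_
    have := h ((x : ℂ) + τ * Complex.I) (by simpa using hx) (by simp [hτ]) (fun j => ?_)
    · simpa using this
    · refine le_trans (le_of_eq ?_) (Complex.abs_im_le_norm _)
      simp [Complex.div_ofReal_im, abs_div, hτ, abs_of_pos hρ]

lemma Complex.Gamma_add_nat_eq_prod (n : ℕ) (z : ℂ) (hz : ∀ j < n, z + j ≠ 0) :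
    Complex.Gamma (z + n) = Complex.Gamma z * ∏ j ∈ Finset.range n, (z + j) := by
  induction n with
  | zero => simp
  | succ n ih =>
    rw [Finset.prod_range_succ, ← mul_assoc, ← ih fun j hj => hz j (by omega), mul_comm,
      ← Complex.Gamma_add_one _ (hz n (by omega))]
    push_cast; ring_nf

/-- The residue of the integrand at `s = -ρ (β + k)`. -/
noncomputable def mellinBarnesResidue (α β γ ρ u : ℝ) (k : ℕ) : ℝ :=
  ρ * ((-1) ^ k / k.factorial * Real.Gamma (α + β + k) * (Real.Gamma (γ + ρ * (β + k)))⁻¹ *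
    u ^ (ρ * (β + k)))

lemma prod_range_neg_add (k : ℕ) :
    ∏ j ∈ Finset.range k, (-(k : ℂ) + j) = (-1) ^ k * k.factorial := by
  rw [← Finset.prod_range_add_one_eq_factorial, ← Finset.prod_range_reflect]
  push_cast
  rw [← Finset.card_range k, ← Finset.prod_const, Finset.card_range, ← Finset.prod_mul_distrib]
  refine Finset.prod_congr rfl fun j hj => ?_
  have hj' := Finset.mem_range.1 hj
  rw [Nat.sub_sub, Nat.cast_sub (by omega)]
  push_cast; ring

/-- A rectangle around the single pole `-ρ (β + k)`. The bound `M` separates it from the poles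
further to the right. -/
lemma rectIntegral_mellinBarnes {α β γ ρ u a c M : ℝ} (hρ : 0 < ρ) (hu : 0 < u) (k : ℕ)
    (ha' : -ρ * (β + k + 1) < a) (ha : a < -ρ * (β + k)) (hc : -ρ * (β + k) < c) (hcM : c < M)
    (hM : M ≤ ρ * α) (hMj : ∀ j < k, M ≤ -ρ * (β + j)) :
    rectIntegral (mellinBarnes α β γ ρ u) a c
      = 2 * Real.pi * Complex.I * mellinBarnesResidue α β γ ρ u k := by
  set U : Set ℂ := {s : ℂ | -ρ * (β + k + 1) < s.re ∧ s.re < M} with hUdef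
  have hU : IsOpen U := (isOpen_lt continuous_const Complex.continuous_re).inter
    (isOpen_lt Complex.continuous_re continuous_const)
  have hρ' : (ρ : ℂ) ≠ 0 := by exact_mod_cast hρ.ne'
  -- `g s = mellinBarnes s * (s + ρ (β + k))`, with the pole of `Γ(β + s/ρ)` removed by the
  -- functional equation
  set g : ℂ → ℂ := fun s => ρ * Complex.Gamma (β + s / ρ + (k + 1 : ℕ)) /
    (∏ j ∈ Finset.range k, ((β : ℂ) + s / ρ + j)) * Complex.Gamma (α - s / ρ) *
    (Complex.Gamma (γ - s))⁻¹ * (u : ℂ) ^ (-s) with hg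
  have hne : ∀ s ∈ U, ∀ j < k, (β : ℂ) + s / ρ + j ≠ 0 := by
    intro s hs j hj h0
    have h1 := congrArg Complex.re h0
    simp [Complex.div_ofReal_re] at h1
    have h2 := hs.2.trans_le (hMj j hj)
    have h3 : s.re / ρ < -(β + j) := by rw [div_lt_iff₀ hρ]; linarith
    linarith
  have hpos1 : ∀ s ∈ U, 0 < ((β : ℂ) + s / ρ + (k + 1 : ℕ)).re := by
    intro s hs
    simp [Complex.div_ofReal_re]
    have h3 : -(β + k + 1) < s.re / ρ := by rw [lt_div_iff₀ hρ]; linarith [hs.1]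
    linarith
  have hpos2 : ∀ s ∈ U, 0 < ((α : ℂ) - s / ρ).re := by
    intro s hs
    simp [Complex.div_ofReal_re]
    rw [div_lt_iff₀ hρ]; linarith [hs.2]
  have hgd : DifferentiableOn ℂ g U := by
    intro s hs
    have ne_of_re : ∀ z : ℂ, 0 < z.re → ∀ m : ℕ, z ≠ -m := by
      rintro z hz m rfl
      simp at hz
      exact absurd hz (not_lt.2 m.cast_nonneg)
    have d1 : DifferentiableAt ℂ (fun s : ℂ => Complex.Gamma (β + s / ρ + (k + 1 : ℕ))) s :=
      (Complex.differentiableAt_Gamma _ (ne_of_re _ (hpos1 s hs))).comp s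
        (f := fun s : ℂ => (β : ℂ) + s / ρ + (k + 1 : ℕ)) (by fun_prop)
    have d2 : DifferentiableAt ℂ (fun s : ℂ => Complex.Gamma (α - s / ρ)) s :=
      (Complex.differentiableAt_Gamma _ (ne_of_re _ (hpos2 s hs))).comp s
        (f := fun s : ℂ => (α : ℂ) - s / ρ) (by fun_prop)
    have d3 : DifferentiableAt ℂ (fun s : ℂ => (Complex.Gamma (γ - s))⁻¹) s :=
      (Complex.differentiable_one_div_Gamma _).comp s (f := fun s : ℂ => (γ : ℂ) - s)
        (by fun_prop)
    have d4 : DifferentiableAt ℂ (fun s : ℂ => (u : ℂ) ^ (-s)) s :=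
      (differentiableAt_id.neg).const_cpow (Or.inl (by exact_mod_cast hu.ne'))
    have d5 : DifferentiableAt ℂ (fun s : ℂ => ∏ j ∈ Finset.range k, ((β : ℂ) + s / ρ + j)) s := by
      fun_prop
    refine DifferentiableAt.differentiableWithinAt ?_
    refine ((((d1.const_mul (ρ : ℂ)).div d5 ?_).mul d2).mul d3).mul d4
    exact Finset.prod_ne_zero_iff.2 fun j hj => hne s hs j (Finset.mem_range.1 hj)
  have hsub : Icc a c ×ℂ Icc (-1) 1 ⊆ U := fun s hs =>
    ⟨ha'.trans_le hs.1.1, hs.1.2.trans_lt hcM⟩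
  have hfg : ∀ s ∈ U, mellinBarnes α β γ ρ u s = g s / (s - (-ρ * (β + k) : ℝ)) := by
    intro s hs
    by_cases h0 : s = (-ρ * (β + k) : ℝ)
    · -- both sides take the junk value `0` at the pole
      have : (β : ℂ) + s / ρ = -k := by
        rw [h0]; push_cast; field_simp; ring
      rw [h0, sub_self, div_zero, ← h0, mellinBarnes, this, Complex.Gamma_neg_nat_eq_zero]
      simp
    · have hk : (β : ℂ) + s / ρ + k ≠ 0 := by
        intro h1
        apply h0
        push_cast
        field_simp at h1
        linear_combination h1
      have hpr := Complex.Gamma_add_nat_eq_prod (k + 1) ((β : ℂ) + s / ρ) (by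
        intro j hj
        rcases Nat.lt_succ_iff_lt_or_eq.1 hj with h | rfl
        · exact hne s hs j h
        · exact hk)
      have hprod : (∏ j ∈ Finset.range k, ((β : ℂ) + s / ρ + j)) ≠ 0 :=
        Finset.prod_ne_zero_iff.2 fun j hj => hne s hs j (Finset.mem_range.1 hj)
      have hs0 : s - (-ρ * (β + k) : ℝ) ≠ 0 := sub_ne_zero.2 h0
      have hks : (ρ : ℂ) * ((β : ℂ) + s / ρ + k) = s - (-ρ * (β + k) : ℝ) := by
        push_cast; field_simp; ring
      rw [hg, mellinBarnes]
      simp only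
      rw [hpr, Finset.prod_range_succ, eq_div_iff hs0, ← hks]
      generalize (∏ j ∈ Finset.range k, ((β : ℂ) + s / ρ + j)) = Q at hprod ⊢
      generalize (β : ℂ) + s / ρ + k = V
      field_simp
  rw [rectIntegral_congr (ha.trans hc).le (fun s hs => hfg s (hsub hs)),
    rectIntegral_div_sub hU hgd ha hc hsub]
  congr 1
  have e1 : (β : ℂ) + ((-ρ * (β + k) : ℝ) : ℂ) / ρ = -k := by
    push_cast; field_simp; ring
  have e2 : (α : ℂ) - ((-ρ * (β + k) : ℝ) : ℂ) / ρ = ((α + β + k : ℝ) : ℂ) := by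
    push_cast; field_simp; ring
  have e3 : (γ : ℂ) - ((-ρ * (β + k) : ℝ) : ℂ) = ((γ + ρ * (β + k) : ℝ) : ℂ) := by
    push_cast; ring
  have e4 : -((-ρ * (β + k) : ℝ) : ℂ) = ((ρ * (β + k) : ℝ) : ℂ) := by push_cast; ring
  rw [hg]
  simp only
  rw [e1, e2, e3, e4, prod_range_neg_add, mellinBarnesResidue, Complex.Gamma_ofReal,
    Complex.Gamma_ofReal, ← Complex.ofReal_cpow hu.le]
  have e5 : -(k : ℂ) + ((k + 1 : ℕ) : ℂ) = 1 := by push_cast; ring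
  rw [e5, Complex.Gamma_one]
  have hf : (k.factorial : ℂ) ≠ 0 := by exact_mod_cast k.factorial_ne_zero
  have h1 : ((-1 : ℂ) ^ k) * (-1) ^ k = 1 := by rw [← mul_pow]; simp
  have h2 : (ρ : ℂ) * 1 / ((-1) ^ k * k.factorial) = ρ * ((-1) ^ k / k.factorial) := by
    rw [div_eq_iff (mul_ne_zero (pow_ne_zero _ (by norm_num)) hf)]
    field_simp
    linear_combination -h1
  rw [h2]
  push_cast
  ring

lemma norm_leftLoopIntegral_le {f : ℂ → ℂ} {a C : ℝ}
    (h₁ : ∀ x ≤ a, ‖f ((x : ℂ) - Complex.I)‖ ≤ C * Real.exp x)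
    (h₂ : ∀ x ≤ a, ‖f ((x : ℂ) + Complex.I)‖ ≤ C * Real.exp x)
    (h₃ : ∀ y ∈ Icc (-1 : ℝ) 1, ‖f ((a : ℂ) + y * Complex.I)‖ ≤ C * Real.exp a) :
    ‖leftLoopIntegral f a‖ ≤ 4 * C * Real.exp a := by
  have hor : ∀ g : ℝ → ℂ, (∀ x ≤ a, ‖g x‖ ≤ C * Real.exp x) →
      ‖∫ x in Iic a, g x‖ ≤ C * Real.exp a := by
    intro g hg
    refine (norm_integral_le_of_norm_le ((integrableOn_exp_Iic a).const_mul C)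
      ((ae_restrict_mem measurableSet_Iic).mono fun x hx => hg x hx)).trans (le_of_eq ?_)
    rw [integral_const_mul, integral_exp_Iic]
  have b₁ := hor _ h₁
  have b₂ := hor _ h₂
  have b₃ : ‖∫ y in (-1 : ℝ)..1, f ((a : ℂ) + y * Complex.I)‖ ≤ 2 * (C * Real.exp a) := by
    refine (intervalIntegral.norm_integral_le_of_norm_le_const (C := C * Real.exp a)
      fun y hy => ?_).trans (le_of_eq ?_)
    · rw [uIoc_of_le (by norm_num)] at hy
      exact h₃ y ⟨hy.1.le, hy.2⟩
    · norm_num; ring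
  have hpi : ‖(2 * (Real.pi : ℂ) * Complex.I)⁻¹‖ ≤ 1 := by
    rw [norm_inv]
    apply inv_le_one_of_one_le₀
    simp [abs_of_pos Real.pi_pos]
    linarith [Real.pi_gt_three]
  rw [leftLoopIntegral, norm_mul]
  refine (mul_le_of_le_one_left (norm_nonneg _) hpi).trans ?_
  refine (norm_sub_le _ _).trans ((add_le_add (norm_add_le _ _) le_rfl).trans ?_)
  rw [norm_mul, Complex.norm_I, one_mul]
  linarith

/-- The loop integral is the sum of the residues at the poles of `Γ(β + s/ρ)`. -/
lemma tendsto_sum_mellinBarnesResidue {α β γ ρ u c : ℝ} (hρ : 0 < ρ) (hu : 0 < u)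
    (h₁ : -ρ * β < c) (h₂ : c < ρ * α) :
    Tendsto (fun n => ∑ k ∈ Finset.range n, (mellinBarnesResidue α β γ ρ u k : ℂ)) atTop
      (𝓝 (leftLoopIntegral (mellinBarnes α β γ ρ u) c)) := by
  set f := mellinBarnes α β γ ρ u with hf
  -- Abscissae half-way between consecutive poles, except that the first is `c`.
  set a : ℕ → ℝ := fun n => if n = 0 then c else -ρ * (β + n - 1 / 2) with ha
  have hβα : -β < α := by
    have : ρ * (-β) < ρ * α := by linarith
    exact lt_of_mul_lt_mul_left this hρ.le
  have ha0 : a 0 = c := rfl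
  have ha1 : ∀ n, a (n + 1) = -ρ * (β + n + 1 / 2) := by
    intro n
    simp only [ha, Nat.succ_ne_zero, if_false]
    push_cast; ring
  have hpos : ∀ n, a (n + 1) < -ρ * (β + n) := by
    intro n; rw [ha1]; nlinarith
  have hac : ∀ n, a n ≤ c := by
    intro n
    rcases n with _ | n
    · exact le_rfl
    · have : 0 ≤ ρ * n := by positivity
      linarith [hpos n]
  have hanti : ∀ n, -ρ * (β + n) < a n := by
    intro n
    rcases n with _ | n
    · simpa [ha0] using h₁
    · rw [ha1]; push_cast; nlinarith
  have hint : ∀ τ : ℝ, |τ| = 1 → ∀ n, IntegrableOn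
      (fun x : ℝ => f (x + τ * Complex.I)) (Iic (a n)) := fun τ hτ n =>
    (integrableOn_mellinBarnes_horizontal hρ hu h₂ hτ).mono_set (Iic_subset_Iic.2 (hac n))
  have hstep : ∀ n, leftLoopIntegral f (a n) - leftLoopIntegral f (a (n + 1))
      = mellinBarnesResidue α β γ ρ u n := by
    intro n
    rw [leftLoopIntegral_sub (by simpa [sub_eq_add_neg] using hint (-1) (by simp) n)
      (by simpa using hint 1 (by simp) n) ((hpos n).trans (hanti n)).le]
    have hlow : -ρ * (β + n + 1) < a (n + 1) := by rw [ha1]; nlinarith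
    have hrect : rectIntegral f (a (n + 1)) (a n)
        = 2 * Real.pi * Complex.I * mellinBarnesResidue α β γ ρ u n := by
      rcases n with _ | n
      · exact rectIntegral_mellinBarnes hρ hu 0 hlow (hpos 0) (hanti 0) h₂ le_rfl (by simp)
      · refine rectIntegral_mellinBarnes hρ hu (n + 1) hlow (hpos _) (hanti _)
          (M := -ρ * (β + n)) (hpos n) ?_ ?_
        · have : 0 ≤ ρ * n := by positivity
          nlinarith
        · intro j hj
          have : (j : ℝ) ≤ n := by exact_mod_cast Nat.lt_succ_iff.1 hj
          nlinarith
    rw [hrect, inv_mul_cancel_left₀]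
    simp [Real.pi_ne_zero]
  have hsum : ∀ n, ∑ k ∈ Finset.range n, (mellinBarnesResidue α β γ ρ u k : ℂ)
      = leftLoopIntegral f c - leftLoopIntegral f (a n) := by
    intro n
    rw [← Finset.sum_congr rfl fun k _ => hstep k, Finset.sum_range_sub', ha0]
  obtain ⟨C, -, hC⟩ := exists_norm_mellinBarnes_le (β := β) (γ := γ) hρ hu
    (η := min (1 / ρ) (1 / 2)) (by positivity) h₂
  have hbound : ∀ n, ‖leftLoopIntegral f (a (n + 1))‖ ≤ 4 * C * Real.exp (a (n + 1)) := by
    intro n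
    have him : ∀ (z : ℂ) (j : ℤ), |z.im| = 1 → min (1 / ρ) (1 / 2) ≤ ‖(β : ℂ) + z / ρ + j‖ := by
      intro z j hz
      refine (min_le_left _ _).trans (le_trans (le_of_eq ?_) (Complex.abs_im_le_norm _))
      simp [Complex.div_ofReal_im, abs_div, hz, abs_of_pos hρ]
    refine norm_leftLoopIntegral_le (fun x hx => ?_) (fun x hx => ?_) (fun y hy => ?_)
    · simpa using hC ((x : ℂ) - Complex.I) (by simpa using hx.trans (hac _)) (by simp)
        (fun j => him _ j (by simp))
    · simpa using hC ((x : ℂ) + Complex.I) (by simpa using hx.trans (hac _)) (by simp)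
        (fun j => him _ j (by simp))
    · have := hC ((a (n + 1) : ℂ) + y * Complex.I) (by simpa using hac _)
        (by simpa [abs_le] using hy) (fun j => ?_)
      · simpa using this
      · refine (min_le_right _ _).trans (le_trans ?_ (Complex.abs_re_le_norm _))
        -- a half-integer is at distance at least `1 / 2` from `0`
        have e : ((β : ℂ) + ((a (n + 1) : ℂ) + y * Complex.I) / ρ + j).re
            = ((j - n : ℤ) : ℝ) - 1 / 2 := by
          simp only [Complex.add_re, Complex.ofReal_re, Complex.div_ofReal_re,
            Complex.re_ofReal_mul,
            Complex.I_re, Complex.intCast_re, ha1]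
          push_cast
          field_simp
          ring
        rw [e]
        rcases le_or_gt (j - n) 0 with h | h
        · have : ((j - n : ℤ) : ℝ) ≤ 0 := by exact_mod_cast h
          rw [abs_of_neg (by linarith)]; linarith
        · have : (1 : ℝ) ≤ ((j - n : ℤ) : ℝ) := by exact_mod_cast h
          rw [abs_of_pos (by linarith)]; linarith
  have hlim : Tendsto (fun n => a (n + 1)) atTop atBot := by
    have : (fun n => a (n + 1)) = fun n : ℕ => (-ρ) * (n : ℝ) + -ρ * (β + 1 / 2) := by
      ext n; rw [ha1]; ring
    rw [this]
    exact (tendsto_natCast_atTop_atTop.const_mul_atTop_of_neg (by linarith)).atBot_add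
      tendsto_const_nhds
  have hzero : Tendsto (fun n => leftLoopIntegral f (a n)) atTop (𝓝 0) := by
    rw [← tendsto_add_atTop_iff_nat 1]
    refine squeeze_zero_norm hbound ?_
    simpa using (Real.tendsto_exp_atBot.comp hlim).const_mul (4 * C)
  simp_rw [hsum]
  simpa using tendsto_const_nhds.sub hzero

/-! ### The kernel as a Prabhakar function -/

/-- The coefficient `Γ(A + k) / (Γ(A) k!)` of `(-y) ^ k` in `(1 + y) ^ (-A)`. -/
noncomputable def negBinom (A : ℝ) (k : ℕ) : ℝ := Real.Gamma (A + k) / (Real.Gamma A * k.factorial)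

lemma negBinom_nonneg {A : ℝ} (hA : 0 < A) (k : ℕ) : 0 ≤ negBinom A k := by
  have := Real.Gamma_pos_of_pos hA
  have := Real.Gamma_pos_of_pos (s := A + k) (by positivity)
  rw [negBinom]; positivity

lemma negBinom_eq_choose {A : ℝ} (hA : 0 < A) (k : ℕ) :
    (negBinom A k : ℂ) = Ring.choose ((A : ℂ) + k - 1) k := by
  have h1 : (k.factorial : ℂ) * Ring.choose ((A : ℂ) + k - 1) k
      = Complex.Gamma (A + k) / Complex.Gamma A := by
    rw [Complex.Gamma_add_nat_div_Gamma_eq _ (by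
      intro m hm
      have := congrArg Complex.re hm
      simp at this
      have : (0 : ℝ) ≤ m := m.cast_nonneg
      linarith), ← Polynomial.ascPochhammer_smeval_eq_eval,
      ← Ring.factorial_nsmul_multichoose_eq_ascPochhammer, nsmul_eq_mul]
    congr 2
    rw [Ring.choose]
    congr 1; ring
  have hf : (k.factorial : ℂ) ≠ 0 := by exact_mod_cast k.factorial_ne_zero
  rw [← mul_right_inj' hf, h1, negBinom, ← Complex.ofReal_natCast k, ← Complex.ofReal_add,
    Complex.Gamma_ofReal, Complex.Gamma_ofReal]
  have : (Real.Gamma A : ℂ) ≠ 0 := by exact_mod_cast (Real.Gamma_pos_of_pos hA).ne'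
  push_cast
  field_simp

lemma hasSum_negBinom {A : ℝ} (hA : 0 < A) {y : ℂ} (hy : ‖y‖ < 1) :
    HasSum (fun k => (negBinom A k : ℂ) * (-y) ^ k) ((1 + y) ^ (-A : ℂ)) := by
  have h := (Complex.one_div_one_sub_cpow_hasFPowerSeriesOnBall_zero (A : ℂ)).hasSum
    (y := -y) (by
      rw [← ENNReal.ofReal_one, Metric.eball_ofReal]
      simpa using hy)
  simpa [negBinom_eq_choose hA, Complex.cpow_neg, FormalMultilinearSeries.ofScalars_apply_eq,
    mul_comm] using h

lemma summable_negBinom {A : ℝ} (hA : 0 < A) {y : ℝ} (hy0 : 0 ≤ y) (hy : y < 1) :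
    Summable (fun k => negBinom A k * y ^ k) := by
  have h := (hasSum_negBinom hA (y := -(y : ℂ)) (by simpa [abs_of_nonneg hy0] using hy)).summable
  have h2 : (fun k => (negBinom A k : ℂ) * (- -(y : ℂ)) ^ k)
      = fun k => ((negBinom A k * y ^ k : ℝ) : ℂ) := by ext k; push_cast; simp
  rw [h2] at h
  exact Complex.summable_ofReal.1 h

/-- The function `u^{b-1} E^A_{ρ,b}(-u^ρ)`, where `E^A_{ρ,b}` is Prabhakar's three-parameter
Mittag-Leffler function. -/
noncomputable def prabhakar (A ρ b u : ℝ) : ℝ :=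
  ∑' k : ℕ, (-1) ^ k * negBinom A k * (u ^ (b - 1 + ρ * k) / Real.Gamma (b + ρ * k))

/-- Summability of the Prabhakar series, with a bound that is uniform for `v ≤ V`. -/
lemma summable_negBinom_div_Gamma {A ρ b : ℝ} (hA : 0 < A) (hρ : 0 < ρ) (hb : 0 < b) {V : ℝ}
    (hV : 0 ≤ V) : Summable (fun k : ℕ => negBinom A k * (V ^ k / Real.Gamma (b + ρ * k))) := by
  obtain ⟨C, hC0, hC⟩ := exists_norm_inv_Gamma_le (Real.log (2 * (V + 1)) / ρ) 0
  refine Summable.of_nonneg_of_le (f := fun k : ℕ => C * Real.exp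
    (-(Real.log (2 * (V + 1)) / ρ) * b) * (negBinom A k * (1 / 2) ^ k)) ?_ ?_
    ((summable_negBinom hA (by norm_num) (by norm_num)).mul_left _)
  · intro k
    have := negBinom_nonneg hA k
    have := Real.Gamma_pos_of_pos (s := b + ρ * k) (by positivity)
    positivity
  · intro k
    have h := hC ((b + ρ * k : ℝ) : ℂ) (by rw [Complex.ofReal_re]; positivity) (by simp)
    rw [Complex.Gamma_ofReal, norm_inv, Complex.norm_real, Real.norm_of_nonneg
      (Real.Gamma_pos_of_pos (s := b + ρ * k) (by positivity)).le, Complex.ofReal_re] at h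
    have e : Real.exp (-(Real.log (2 * (V + 1)) / ρ) * (b + ρ * k))
        = Real.exp (-(Real.log (2 * (V + 1)) / ρ) * b) * ((2 * (V + 1))⁻¹) ^ k := by
      rw [mul_add, Real.exp_add]
      congr 1
      have : -(Real.log (2 * (V + 1)) / ρ) * (ρ * k) = k * -Real.log (2 * (V + 1)) := by
        field_simp
      rw [this, Real.exp_nat_mul, Real.exp_neg, Real.exp_log (by positivity)]
    rw [e] at h
    have hn := negBinom_nonneg hA k
    calc negBinom A k * (V ^ k / Real.Gamma (b + ρ * k))
        = negBinom A k * (V ^ k * (Real.Gamma (b + ρ * k))⁻¹) := by rw [div_eq_mul_inv]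
      _ ≤ negBinom A k * (V ^ k * (C * (Real.exp (-(Real.log (2 * (V + 1)) / ρ) * b) *
            ((2 * (V + 1))⁻¹) ^ k))) := by gcongr
      _ = C * Real.exp (-(Real.log (2 * (V + 1)) / ρ) * b) *
            (negBinom A k * (V * (2 * (V + 1))⁻¹) ^ k) := by rw [mul_pow]; ring
      _ ≤ _ := by
        gcongr
        rw [mul_inv_le_iff₀ (by positivity)]
        linarith

lemma rpow_add_mul_nat {u : ℝ} (hu : 0 < u) (r ρ : ℝ) (k : ℕ) :
    u ^ (r + ρ * k) = u ^ r * (u ^ ρ) ^ k := by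
  rw [Real.rpow_add hu, Real.rpow_mul hu.le, Real.rpow_natCast]

lemma summable_prabhakar {A ρ b u : ℝ} (hA : 0 < A) (hρ : 0 < ρ) (hb : 0 < b) (hu : 0 < u) :
    Summable (fun k : ℕ => (-1) ^ k * negBinom A k *
      (u ^ (b - 1 + ρ * k) / Real.Gamma (b + ρ * k))) := by
  refine Summable.of_norm_bounded (g := fun k : ℕ => u ^ (b - 1) *
    (negBinom A k * ((u ^ ρ) ^ k / Real.Gamma (b + ρ * k))))
    ((summable_negBinom_div_Gamma hA hρ hb (by positivity)).mul_left _) fun k => le_of_eq ?_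
  have := Real.Gamma_pos_of_pos (s := b + ρ * k) (by positivity)
  rw [norm_mul, norm_mul, norm_pow, norm_neg, norm_one, one_pow, one_mul, norm_div,
    Real.norm_of_nonneg (negBinom_nonneg hA k), Real.norm_of_nonneg (by positivity),
    Real.norm_of_nonneg this.le, rpow_add_mul_nat hu]
  ring

/-- The loop integral is, up to a factor, the Prabhakar function. -/
lemma leftLoopIntegral_mellinBarnes {α β γ ρ u c : ℝ} (hρ : 0 < ρ) (hu : 0 < u)
    (h₁ : -ρ * β < c) (h₂ : c < ρ * α) (hb : 0 < γ + ρ * β) :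
    leftLoopIntegral (mellinBarnes α β γ ρ u) c
      = ((ρ * Real.Gamma (α + β) * u ^ (1 - γ) *
          prabhakar (α + β) ρ (γ + ρ * β) u : ℝ) : ℂ) := by
  have hA : 0 < α + β := by
    have : ρ * (-β) < ρ * α := by linarith
    linarith [lt_of_mul_lt_mul_left this hρ.le]
  have hG := Real.Gamma_pos_of_pos hA
  have h := (summable_prabhakar (b := γ + ρ * β) hA hρ hb hu).hasSum.mul_left
    (ρ * Real.Gamma (α + β) * u ^ (1 - γ))
  have h' := (Complex.hasSum_ofReal.2 h).tendsto_sum_nat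
  refine tendsto_nhds_unique (tendsto_sum_mellinBarnesResidue hρ hu h₁ h₂) ?_
  refine h'.congr fun n => Finset.sum_congr rfl fun k _ => ?_
  congr 1
  rw [mellinBarnesResidue, negBinom]
  have e : u ^ (ρ * (β + k)) = u ^ (1 - γ) * u ^ (γ + ρ * β - 1 + ρ * k) := by
    rw [← Real.rpow_add hu]; congr 1; ring
  rw [e, show γ + ρ * (β + k) = γ + ρ * β + ρ * k by ring]
  field_simp

/-- The second parameter of the Prabhakar function that gives the kernel. -/
noncomputable def kernelShift (A q : ℝ) : ℝ := if 0 < q then |q| * A else 1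

lemma kernelShift_pos {A q : ℝ} (hA : 0 < A) : 0 < kernelShift A q := by
  rw [kernelShift]; split_ifs <;> positivity

theorem kernelH_eq_prabhakar {A q u : ℝ} (hA : 0 < A) (hq : q ≠ 0) (hu : 0 < u) :
    kernelH A q u = (prabhakar A |q| (kernelShift A q) u : ℂ) := by
  have hG := Real.Gamma_pos_of_pos hA
  rcases hq.lt_or_gt with hq | hq
  · have hρ : 0 < |q| := abs_pos.2 hq.ne
    have hsep : ∀ c : ℝ, FoxSeparates 1 1 ![1 - A] ![1 / |q|] ![0, 0] ![1 / |q|, 1] c ↔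
        -|q| * 0 < c ∧ c < |q| * A := by
      intro c
      simp only [FoxSeparates, Fin.forall_fin_two, Fin.forall_fin_one]
      simp
      refine and_congr ⟨fun h => by simpa using h 0, fun h k => ?_⟩
        ⟨fun h => by simpa [mul_comm] using h 0, fun h k => h.trans_le ?_⟩
      · exact lt_of_le_of_lt (neg_nonpos.2 (by positivity)) h
      · rw [mul_comm]; gcongr; simp
    have hex : ∃ c, FoxSeparates 1 1 ![1 - A] ![1 / |q|] ![0, 0] ![1 / |q|, 1] c :=
      ⟨|q| * A / 2, (hsep _).2 ⟨by simp; positivity, by linarith [mul_pos hρ hA]⟩⟩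
    have hc := (hsep _).1 hex.choose_spec
    have hdens : (fun s => foxDensity 1 1 ![1 - A] ![1 / |q|] ![0, 0] ![1 / |q|, 1] s *
        (u : ℂ) ^ (-s)) = mellinBarnes A 0 1 |q| u := by
      ext s
      simp [foxDensity, mellinBarnes, Fin.prod_univ_two]
      exact Or.inl (by ring_nf)
    have hl := leftLoopIntegral_mellinBarnes (γ := 1) hρ hu hc.1 hc.2 (by simp)
    rw [kernelH, if_neg (not_lt.2 hq.le), foxH, dif_pos hex, hdens, hl, ← Complex.ofReal_mul,
      kernelShift, if_neg (not_lt.2 hq.le)]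
    congr 1
    simp
    field_simp
  · have hq' : |q| = q := abs_of_pos hq
    have hsep : ∀ c : ℝ, FoxSeparates 1 1 ![1] ![1 / q] ![A, 1] ![1 / q, 1] c ↔
        -q * A < c ∧ c < q * 0 := by
      intro c
      simp only [FoxSeparates, Fin.forall_fin_two, Fin.forall_fin_one]
      simp
      refine and_congr ⟨fun h => by simpa [mul_comm] using h 0, fun h k => lt_of_le_of_lt ?_ h⟩
        ⟨fun h => by simpa using h 0, fun h k => h.trans_le (by positivity)⟩
      have : 0 ≤ q * k := by positivity
      nlinarith
    have hex : ∃ c, FoxSeparates 1 1 ![1] ![1 / q] ![A, 1] ![1 / q, 1] c :=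
      ⟨-(q * A / 2), (hsep _).2 ⟨by linarith [mul_pos hq hA], by linarith [mul_pos hq hA]⟩⟩
    have hc := (hsep _).1 hex.choose_spec
    have hdens : (fun s => foxDensity 1 1 ![1] ![1 / q] ![A, 1] ![1 / q, 1] s *
        (u : ℂ) ^ (-s)) = mellinBarnes 0 A 0 q u := by
      ext s
      simp [foxDensity, mellinBarnes, Fin.prod_univ_two]
      exact Or.inl (by ring_nf)
    have hl := leftLoopIntegral_mellinBarnes (γ := 0) hq hu hc.1 hc.2 (by simp; positivity)
    rw [kernelH, if_pos hq, foxH, dif_pos hex, hdens, hl, ← Complex.ofReal_mul,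
      kernelShift, if_pos hq, hq']
    congr 1
    simp
    field_simp

theorem kernelC_eq_prabhakar {A q u : ℝ} (hA : 0 < A) (hq : q ≠ 0) (hu : 0 < u) :
    kernelC A q u = prabhakar A |q| (kernelShift A q) u := by
  rw [kernelC, kernelH_eq_prabhakar hA hq hu, Complex.ofReal_re]

/-! ### Holomorphic parameter integrals -/

/-- A parameter integral of holomorphic functions is holomorphic if the integrand is locally
dominated. -/
lemma differentiableOn_integral_of_dominated {α : Type*} [MeasurableSpace α] {μ : Measure α}
    {U : Set ℂ} (hU : IsOpen U) {F : ℂ → α → ℂ}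
    (hF : ∀ z ∈ U, AEStronglyMeasurable (F z) μ)
    (hd : ∀ᵐ a ∂μ, DifferentiableOn ℂ (fun z => F z a) U)
    (hb : ∀ z ∈ U, ∃ r > 0, ∃ g : α → ℝ, Integrable g μ ∧
      ∀ᵐ a ∂μ, ∀ w ∈ Metric.ball z r ∩ U, ‖F w a‖ ≤ g a) :
    DifferentiableOn ℂ (fun z => ∫ a, F z a ∂μ) U := by
  intro z hz
  obtain ⟨r₁, hr₁, g, hg, hle⟩ := hb z hz
  obtain ⟨r₂, hr₂, hsub⟩ := Metric.isOpen_iff.1 hU z hz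
  set r := min r₁ r₂ with hrdef
  have hr : 0 < r := lt_min hr₁ hr₂
  have hrU : Metric.ball z r ⊆ U := (Metric.ball_subset_ball (min_le_right _ _)).trans hsub
  have hle' : ∀ᵐ a ∂μ, ∀ w ∈ Metric.ball z r, ‖F w a‖ ≤ g a := hle.mono fun a ha w hw =>
    ha w ⟨Metric.ball_subset_ball (min_le_left _ _) hw, hrU hw⟩
  have hzr : z ∈ Metric.ball z r := Metric.mem_ball_self hr
  have hder : ∀ᵐ a ∂μ, ∀ x ∈ Metric.ball z r, HasDerivAt (fun w => F w a)
      (deriv (fun w => F w a) x) x := hd.mono fun a ha x hx =>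
    (ha.differentiableAt (hU.mem_nhds (hrU hx))).hasDerivAt
  have hmeas' : AEStronglyMeasurable (fun a => deriv (fun w => F w a) z) μ := by
    -- the derivative is a limit of difference quotients
    set h : ℕ → ℂ := fun n => ((r / 2 * (1 / ((n : ℝ) + 1)) : ℝ) : ℂ) with hh
    have hpos : ∀ n : ℕ, 0 < r / 2 * (1 / ((n : ℝ) + 1)) := fun n => by positivity
    have hmem : ∀ n, z + h n ∈ Metric.ball z r := by
      intro n
      have : 1 / ((n : ℝ) + 1) ≤ 1 := by
        rw [div_le_one (by positivity)]; linarith [(n.cast_nonneg : (0 : ℝ) ≤ n)]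
      rw [Metric.mem_ball, dist_self_add_left, hh, Complex.norm_real,
        Real.norm_of_nonneg (hpos n).le]
      nlinarith
    have htend : Tendsto (fun n => z + h n) atTop (𝓝[≠] z) := by
      refine tendsto_nhdsWithin_iff.2 ⟨?_, Eventually.of_forall fun n => ?_⟩
      · have := (tendsto_one_div_add_atTop_nhds_zero_nat (𝕜 := ℝ)).const_mul (r / 2)
        have h2 := (Complex.continuous_ofReal.tendsto _).comp this
        simpa [hh, Function.comp_def] using h2.const_add z
      · simpa using fun h0 : h n = 0 => (hpos n).ne' (Complex.ofReal_eq_zero.1 h0)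
    refine aestronglyMeasurable_of_tendsto_ae atTop
      (f := fun (n : ℕ) a => slope (fun w => F w a) z (z + h n)) (fun n => ?_) ?_
    · change AEStronglyMeasurable (fun a => (z + h n - z)⁻¹ • (F (z + h n) a - F z a)) μ
      exact ((hF _ (hrU (hmem n))).sub (hF z hz)).const_smul (z + h n - z : ℂ)⁻¹
    · exact hder.mono fun a ha => (hasDerivAt_iff_tendsto_slope.1 (ha z hzr)).comp htend
  have hbound : ∀ᵐ a ∂μ, ∀ x ∈ Metric.ball z (r / 2),
      ‖deriv (fun w => F w a) x‖ ≤ g a / (r / 4) := by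
    filter_upwards [hle', hd] with a ha hda x hx
    have hsub' : Metric.closedBall x (r / 4) ⊆ Metric.ball z r := by
      intro w hw
      rw [Metric.mem_ball] at hx ⊢
      rw [Metric.mem_closedBall] at hw
      linarith [dist_triangle w x z]
    refine Complex.norm_deriv_le_of_forall_mem_sphere_norm_le (by positivity) ?_
      fun w hw => ha w (hsub' (Metric.sphere_subset_closedBall hw))
    exact (hda.mono (hsub'.trans hrU)).diffContOnCl_ball (subset_refl _)
  refine (hasDerivAt_integral_of_dominated_loc_of_deriv_le (F := F)
    (F' := fun x a => deriv (fun w => F w a) x) (bound := fun a => g a / (r / 4))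
    (Metric.ball_mem_nhds z (half_pos hr)) ?_ ?_ hmeas' hbound (hg.div_const _)
    ?_).2.differentiableAt.differentiableWithinAt
  · exact (hU.mem_nhds hz |> fun h => Filter.mem_of_superset h fun w hw => hF w hw)
  · exact hg.mono' (hF z hz) (hle'.mono fun a ha => ha z hzr)
  · exact hder.mono fun a ha x hx => ha x (Metric.ball_subset_ball (by linarith) hx)

lemma isOpen_re_pos : IsOpen {z : ℂ | 0 < z.re} := isOpen_lt continuous_const Complex.continuous_re

/-- A Laplace transform is holomorphic in the half-plane of absolute convergence. -/
lemma differentiableOn_laplace {f : ℝ → ℂ}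
    (hf : ∀ σ : ℝ, 0 < σ → IntegrableOn (fun u : ℝ => (Real.exp (-(σ * u)) : ℂ) * f u) (Ioi 0)) :
    DifferentiableOn ℂ (fun z : ℂ => ∫ u in Ioi (0 : ℝ), Complex.exp (-(z * u)) * f u)
      {z | 0 < z.re} := by
  have hfm : AEStronglyMeasurable f (volume.restrict (Ioi 0)) := by
    have h1 : AEStronglyMeasurable (fun u : ℝ => (Real.exp (1 * u) : ℂ) *
        ((Real.exp (-(1 * u)) : ℂ) * f u)) (volume.restrict (Ioi 0)) :=
      (Continuous.aestronglyMeasurable (by fun_prop)).mul (hf 1 one_pos).1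
    convert h1 using 2 with u
    rw [← mul_assoc, ← Complex.ofReal_mul, ← Real.exp_add]
    simp
  refine differentiableOn_integral_of_dominated isOpen_re_pos (fun z _ => ?_) ?_ (fun z hz => ?_)
  · exact (Continuous.aestronglyMeasurable (by fun_prop)).mul hfm
  · exact Eventually.of_forall fun u => by fun_prop
  · have hz' : 0 < z.re := hz
    refine ⟨z.re / 2, by positivity, _, (hf (z.re / 2) (by positivity)).norm, ?_⟩
    refine (ae_restrict_mem measurableSet_Ioi).mono fun u hu w hw => ?_
    have hu' : 0 < u := hu
    rw [norm_mul, norm_mul, Complex.norm_exp, Complex.norm_real,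
      Real.norm_of_nonneg (Real.exp_pos _).le]
    gcongr
    have h1 : |(w - z).re| < z.re / 2 :=
      (Complex.abs_re_le_norm _).trans_lt (by simpa [dist_eq_norm] using hw.1)
    have h2 := (abs_lt.1 h1).1
    simp at h2 ⊢
    nlinarith

/-- The identity theorem for two holomorphic functions that agree on a real half-line. -/
lemma eqOn_of_eq_on_real {U : Set ℂ} (hU : IsOpen U) (hc : IsPreconnected U) {f g : ℂ → ℂ}
    (hf : DifferentiableOn ℂ f U) (hg : DifferentiableOn ℂ g U) {x₀ : ℝ} (hx₀ : (x₀ : ℂ) ∈ U)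
    (h : ∀ x : ℝ, x₀ < x → f x = g x) : EqOn f g U := by
  refine AnalyticOnNhd.eqOn_of_preconnected_of_frequently_eq (hf.analyticOnNhd hU)
    (hg.analyticOnNhd hU) hc hx₀ ?_
  have ht : Tendsto (fun x : ℝ => (x : ℂ)) (𝓝[>] x₀) (𝓝[≠] (x₀ : ℂ)) := by
    refine tendsto_nhdsWithin_iff.2 ⟨(Complex.continuous_ofReal.tendsto x₀).mono_left
      nhdsWithin_le_nhds, ?_⟩
    filter_upwards [self_mem_nhdsWithin] with x hx
    have : x ≠ x₀ := ne_of_gt hx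
    simpa using this
  refine ht.frequently (Eventually.frequently ?_)
  filter_upwards [self_mem_nhdsWithin] with x hx using h x hx

lemma isPreconnected_re_pos : IsPreconnected {z : ℂ | 0 < z.re} :=
  (convex_halfSpace_re_gt 0).isPreconnected

lemma Complex.inv_cpow_of_re_pos {x : ℂ} (hx : 0 < x.re) (a : ℂ) : (1 / x) ^ a = x ^ (-a) := by
  rw [one_div, Complex.inv_cpow, Complex.cpow_neg]
  exact (Complex.mem_slitPlane_iff_arg.1 (Or.inl hx)).1

/-- Euler's integral for `Γ` with a complex scale. -/
lemma integral_rpow_mul_cexp_neg_mul_Ioi {a : ℝ} {z : ℂ} (ha : 0 < a) (hz : 0 < z.re) :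
    ∫ t : ℝ in Ioi 0, Complex.exp (-(z * t)) * ((t ^ (a - 1) : ℝ) : ℂ)
      = z ^ (-a : ℂ) * Real.Gamma a := by
  have h1 : DifferentiableOn ℂ (fun z : ℂ => ∫ t : ℝ in Ioi 0,
      Complex.exp (-(z * t)) * ((t ^ (a - 1) : ℝ) : ℂ)) {z | 0 < z.re} := by
    refine differentiableOn_laplace fun σ hσ => ?_
    have := integrableOn_rpow_mul_exp_neg_mul_rpow (p := 1) (s := a - 1) (by linarith) one_pos hσ
    have h2 : IntegrableOn (fun u : ℝ => u ^ (a - 1) * Real.exp (-(σ * u))) (Ioi 0) := by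
      simpa using this
    refine (h2.ofReal (𝕜 := ℂ)).congr (Eventually.of_forall fun u => ?_)
    simp [mul_comm]
  have h2 : DifferentiableOn ℂ (fun z : ℂ => z ^ (-a : ℂ) * Real.Gamma a) {z | 0 < z.re} := by
    intro z hz
    exact ((differentiableAt_id.cpow_const (Or.inl hz)).mul_const _).differentiableWithinAt
  refine eqOn_of_eq_on_real isOpen_re_pos isPreconnected_re_pos h1 h2 (x₀ := 1) (by simp)
    (fun x hx => ?_) hz
  have hx0 : 0 < x := by linarith
  have e : ∀ t ∈ Ioi (0 : ℝ), Complex.exp (-(x * t)) * ((t ^ (a - 1) : ℝ) : ℂ)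
      = ((t ^ (a - 1) * Real.exp (-(x * t)) : ℝ) : ℂ) := by
    intro t _; push_cast; ring
  rw [setIntegral_congr_fun measurableSet_Ioi e, integral_complex_ofReal,
    Real.integral_rpow_mul_exp_neg_mul_Ioi ha hx0]
  rw [Complex.ofReal_mul, Complex.ofReal_cpow (by positivity)]
  push_cast
  rw [Complex.inv_cpow_of_re_pos (by simpa using hx0)]

/-! ### The Laplace transform of the Prabhakar function -/

/-- Termwise integration of a series, with the integrability of the sum. -/
lemma integrable_of_hasSum {α E : Type*} [MeasurableSpace α] {μ : Measure α} [NormedAddCommGroup E]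
    [NormedSpace ℝ E] [CompleteSpace E] {F : ℕ → α → E} {f : α → E}
    (hF : ∀ i, Integrable (F i) μ) (hF' : Summable fun i => ∫ a, ‖F i a‖ ∂μ)
    (hf : AEStronglyMeasurable f μ) (h : ∀ᵐ a ∂μ, HasSum (fun i => F i a) (f a)) :
    Integrable f μ ∧ HasSum (fun i => ∫ a, F i a ∂μ) (∫ a, f a ∂μ) ∧
      ∫ a, ‖f a‖ ∂μ ≤ ∑' i, ∫ a, ‖F i a‖ ∂μ := by
  have hle : ∫⁻ a, ‖f a‖ₑ ∂μ ≤ ENNReal.ofReal (∑' i, ∫ a, ‖F i a‖ ∂μ) := by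
    calc ∫⁻ a, ‖f a‖ₑ ∂μ ≤ ∫⁻ a, ∑' i, ‖F i a‖ₑ ∂μ := by
          refine lintegral_mono_ae (h.mono fun a ha => ?_)
          refine le_of_tendsto (ha.tendsto_sum_nat.enorm) (Eventually.of_forall fun n => ?_)
          exact (enorm_sum_le _ _).trans (ENNReal.sum_le_tsum _)
      _ = ∑' i, ∫⁻ a, ‖F i a‖ₑ ∂μ := lintegral_tsum fun i => (hF i).1.enorm
      _ = ∑' i, ENNReal.ofReal (∫ a, ‖F i a‖ ∂μ) := by
          congr 1; ext i
          rw [ofReal_integral_norm_eq_lintegral_enorm (hF i)]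
      _ = _ := (ENNReal.ofReal_tsum_of_nonneg (fun i => integral_nonneg fun a => norm_nonneg _)
          hF').symm
  have hint : Integrable f μ := ⟨hf, hle.trans_lt ENNReal.ofReal_lt_top⟩
  refine ⟨hint, ?_, ?_⟩
  · have := hasSum_integral_of_summable_integral_norm hF hF'
    rwa [integral_congr_ae (h.mono fun a ha => ha.tsum_eq)] at this
  · rw [← ofReal_integral_norm_eq_lintegral_enorm hint] at hle
    exact (ENNReal.ofReal_le_ofReal_iff
      (tsum_nonneg fun i => integral_nonneg fun a => norm_nonneg _)).1 hle

/-- The entire function `∑ (-1)^k c_k v^k / Γ(b + ρ k)` on the half-line. -/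
noncomputable def prabhakarSeries (A ρ b v : ℝ) : ℝ :=
  ∑' k : ℕ, (-1) ^ k * negBinom A k * (v ^ k / Real.Gamma (b + ρ * k))

lemma prabhakar_eq {A ρ b u : ℝ} (hu : 0 < u) :
    prabhakar A ρ b u = u ^ (b - 1) * prabhakarSeries A ρ b (u ^ ρ) := by
  rw [prabhakar, prabhakarSeries, ← tsum_mul_left]
  congr 1; ext k
  rw [rpow_add_mul_nat hu]; ring

lemma norm_prabhakarSeries_term_le {A ρ b V v : ℝ} (hA : 0 < A) (hρ : 0 < ρ) (hb : 0 < b)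
    (hv : 0 ≤ v) (hvV : v ≤ V) (k : ℕ) :
    ‖(-1) ^ k * negBinom A k * (v ^ k / Real.Gamma (b + ρ * k))‖
      ≤ negBinom A k * (V ^ k / Real.Gamma (b + ρ * k)) := by
  have h1 := Real.Gamma_pos_of_pos (s := b + ρ * k) (by positivity)
  have h2 := negBinom_nonneg hA k
  rw [norm_mul, norm_mul, norm_pow, norm_neg, norm_one, one_pow, one_mul, norm_div,
    Real.norm_of_nonneg h2, Real.norm_of_nonneg (by positivity), Real.norm_of_nonneg h1.le]
  gcongr

lemma continuousOn_prabhakarSeries {A ρ b : ℝ} (hA : 0 < A) (hρ : 0 < ρ) (hb : 0 < b) :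
    ContinuousOn (prabhakarSeries A ρ b) (Ici 0) := by
  intro v hv
  have hv' : 0 ≤ v := hv
  have h : ContinuousOn (prabhakarSeries A ρ b) (Icc 0 (v + 1)) := by
    refine continuousOn_tsum (u := fun k : ℕ => negBinom A k *
      ((v + 1) ^ k / Real.Gamma (b + ρ * k))) (fun k => by fun_prop)
      (summable_negBinom_div_Gamma hA hρ hb (by linarith)) fun k w hw => ?_
    exact norm_prabhakarSeries_term_le hA hρ hb hw.1 hw.2 k
  refine (h v ⟨hv', by linarith⟩).mono_of_mem_nhdsWithin ?_
  rw [← Ici_inter_Iic]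
  exact inter_mem_nhdsWithin _ (Iic_mem_nhds (by linarith))

lemma continuousOn_prabhakarSeries_rpow {A ρ b : ℝ} (hA : 0 < A) (hρ : 0 < ρ) (hb : 0 < b) :
    ContinuousOn (fun u => prabhakarSeries A ρ b (u ^ ρ)) (Ici 0) :=
  (continuousOn_prabhakarSeries hA hρ hb).comp
    (fun u _ => (Real.continuousAt_rpow_const u ρ (Or.inr hρ.le)).continuousWithinAt)
    fun u (hu : 0 ≤ u) => Real.rpow_nonneg hu ρ

lemma continuousOn_prabhakar {A ρ b : ℝ} (hA : 0 < A) (hρ : 0 < ρ) (hb : 0 < b) :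
    ContinuousOn (prabhakar A ρ b) (Ioi 0) := by
  have h : ContinuousOn (fun u => u ^ (b - 1) * prabhakarSeries A ρ b (u ^ ρ)) (Ioi 0) :=
    ContinuousOn.mul
      (fun u (hu : 0 < u) => (Real.continuousAt_rpow_const u _ (Or.inl hu.ne')).continuousWithinAt)
      ((continuousOn_prabhakarSeries_rpow hA hρ hb).mono Ioi_subset_Ici_self)
  exact h.congr fun u hu => prabhakar_eq hu

lemma exists_abs_prabhakar_le {A ρ b : ℝ} (hA : 0 < A) (hρ : 0 < ρ) (hb : 0 < b) (U : ℝ) :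
    ∃ C : ℝ, 0 ≤ C ∧ ∀ u, 0 < u → u ≤ U → |prabhakar A ρ b u| ≤ C * u ^ (b - 1) := by
  obtain ⟨C, hC⟩ := isCompact_Icc.exists_bound_of_continuousOn
    ((continuousOn_prabhakarSeries_rpow hA hρ hb).mono (fun u hu => hu.1 : Icc 0 U ⊆ Ici 0))
  refine ⟨max C 0, le_max_right _ _, fun u hu huU => ?_⟩
  rw [prabhakar_eq hu, abs_mul, abs_of_pos (Real.rpow_pos_of_pos hu _), mul_comm]
  gcongr
  exact (hC u ⟨hu.le, huU⟩).trans (le_max_left _ _)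

/-- Termwise Laplace transform of `u^j` times the Prabhakar function. -/
lemma laplace_prabhakar_series {A ρ b : ℝ} (hA : 0 < A) (hρ : 0 < ρ) (hb : 0 < b) (j : ℕ) {x : ℂ}
    (hx : 0 < x.re)
    (hs : Summable fun k : ℕ => negBinom A k *
      (Real.Gamma (b + j + ρ * k) / Real.Gamma (b + ρ * k)) * (x.re ^ (-ρ)) ^ k) :
    IntegrableOn (fun u : ℝ => Complex.exp (-(x * u)) * ((u ^ j * prabhakar A ρ b u : ℝ) : ℂ))
      (Ioi 0) ∧
    HasSum (fun k : ℕ => x ^ (-(b + j) : ℂ) * (((negBinom A k *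
      (Real.Gamma (b + j + ρ * k) / Real.Gamma (b + ρ * k)) : ℝ) : ℂ) * (-x ^ (-ρ : ℂ)) ^ k))
      (∫ u in Ioi (0 : ℝ), Complex.exp (-(x * u)) * ((u ^ j * prabhakar A ρ b u : ℝ) : ℂ)) ∧
    ∫ u in Ioi (0 : ℝ), ‖Complex.exp (-(x * u)) * ((u ^ j * prabhakar A ρ b u : ℝ) : ℂ)‖ ≤
      x.re ^ (-(b + j)) * ∑' k : ℕ, negBinom A k *
        (Real.Gamma (b + j + ρ * k) / Real.Gamma (b + ρ * k)) * (x.re ^ (-ρ)) ^ k := by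
  have hx0 : x ≠ 0 := by rintro rfl; simp at hx
  set F : ℕ → ℝ → ℂ := fun k u => Complex.exp (-(x * u)) *
    ((u ^ j * ((-1) ^ k * negBinom A k * (u ^ (b - 1 + ρ * k) / Real.Gamma (b + ρ * k))) : ℝ) : ℂ)
    with hF
  have hG : ∀ k : ℕ, 0 < Real.Gamma (b + ρ * k) := fun k =>
    Real.Gamma_pos_of_pos (by positivity)
  have hbk : ∀ k : ℕ, 0 < b + j + ρ * k := fun k => by positivity
  have hFeq : ∀ k, ∀ u ∈ Ioi (0 : ℝ), F k u =
      (((-1) ^ k * negBinom A k / Real.Gamma (b + ρ * k) : ℝ) : ℂ) *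
        (Complex.exp (-(x * u)) * ((u ^ (b + j + ρ * k - 1) : ℝ) : ℂ)) := by
    intro k u hu
    have hu' : 0 < u := hu
    have e : u ^ (b + j + ρ * k - 1) = u ^ j * u ^ (b - 1 + ρ * k) := by
      rw [← Real.rpow_natCast u j, ← Real.rpow_add hu']
      congr 1; ring
    rw [hF, e]
    push_cast; ring
  have hnorm : ∀ k, ∀ u ∈ Ioi (0 : ℝ), ‖F k u‖ =
      (negBinom A k / Real.Gamma (b + ρ * k)) *
        (u ^ (b + j + ρ * k - 1) * Real.exp (-(x.re * u))) := by
    intro k u hu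
    have hu' : 0 < u := hu
    have hu2 : 0 < u ^ (b + j + ρ * k - 1) := Real.rpow_pos_of_pos hu' _
    rw [hFeq k u hu, norm_mul, norm_mul, Complex.norm_real, norm_div, norm_mul, norm_pow, norm_neg,
      norm_one, one_pow, one_mul, Real.norm_of_nonneg (negBinom_nonneg hA k),
      Real.norm_of_nonneg (hG k).le, Complex.norm_real, Real.norm_of_nonneg hu2.le,
      Complex.norm_exp,
      mul_comm (Real.exp _)]
    simp
  have hint_real : ∀ k : ℕ, IntegrableOn
      (fun u : ℝ => u ^ (b + j + ρ * k - 1) * Real.exp (-(x.re * u))) (Ioi 0) := by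
    intro k
    have := integrableOn_rpow_mul_exp_neg_mul_rpow (p := 1) (s := b + j + ρ * k - 1)
      (by linarith [hbk k]) one_pos hx
    simpa using this
  have hFm : ∀ k, AEStronglyMeasurable (F k) (volume.restrict (Ioi 0)) := by
    intro k
    refine ContinuousOn.aestronglyMeasurable ?_ measurableSet_Ioi
    refine ContinuousOn.mul (by fun_prop) (Complex.continuous_ofReal.comp_continuousOn ?_)
    refine ContinuousOn.mul (by fun_prop) (ContinuousOn.mul (by fun_prop)
      (ContinuousOn.div_const ?_ _))
    exact fun u (hu : 0 < u) =>
      (Real.continuousAt_rpow_const u _ (Or.inl hu.ne')).continuousWithinAt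
  have hFint : ∀ k, IntegrableOn (F k) (Ioi 0) := by
    intro k
    refine Integrable.mono' ((hint_real k).const_mul (negBinom A k / Real.Gamma (b + ρ * k)))
      (hFm k) ?_
    exact (ae_restrict_mem measurableSet_Ioi).mono fun u hu => (hnorm k u hu).le
  have hInorm : ∀ k : ℕ, ∫ u in Ioi (0 : ℝ), ‖F k u‖ = x.re ^ (-(b + j)) * (negBinom A k *
      (Real.Gamma (b + j + ρ * k) / Real.Gamma (b + ρ * k)) * (x.re ^ (-ρ)) ^ k) := by
    intro k
    rw [setIntegral_congr_fun measurableSet_Ioi (hnorm k), integral_const_mul,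
      Real.integral_rpow_mul_exp_neg_mul_Ioi (hbk k) hx, one_div, Real.inv_rpow hx.le,
      ← Real.rpow_neg hx.le, neg_add, show -(ρ * (k : ℝ)) = -ρ * k by ring,
      rpow_add_mul_nat hx]
    ring
  have hI : ∀ k : ℕ, ∫ u in Ioi (0 : ℝ), F k u = x ^ (-(b + j) : ℂ) * (((negBinom A k *
      (Real.Gamma (b + j + ρ * k) / Real.Gamma (b + ρ * k)) : ℝ) : ℂ) *
      (-x ^ (-ρ : ℂ)) ^ k) := by
    intro k
    rw [setIntegral_congr_fun measurableSet_Ioi (hFeq k), integral_const_mul,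
      integral_rpow_mul_cexp_neg_mul_Ioi (hbk k) hx]
    have e : x ^ (-((b + j + ρ * k : ℝ) : ℂ)) = x ^ (-(b + j) : ℂ) * (x ^ (-ρ : ℂ)) ^ k := by
      rw [← Complex.cpow_mul_nat, ← Complex.cpow_add _ _ hx0]
      congr 1; push_cast; ring
    rw [e, neg_pow]
    push_cast; ring
  have hsum : ∀ᵐ u ∂(volume.restrict (Ioi (0 : ℝ))), HasSum (fun k => F k u)
      (Complex.exp (-(x * u)) * ((u ^ j * prabhakar A ρ b u : ℝ) : ℂ)) := by
    refine (ae_restrict_mem measurableSet_Ioi).mono fun u hu => ?_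
    exact (Complex.hasSum_ofReal.2
      ((summable_prabhakar hA hρ hb hu).hasSum.mul_left (u ^ j))).mul_left _
  have hmeas : AEStronglyMeasurable
      (fun u : ℝ => Complex.exp (-(x * u)) * ((u ^ j * prabhakar A ρ b u : ℝ) : ℂ))
      (volume.restrict (Ioi 0)) := by
    refine ContinuousOn.aestronglyMeasurable ?_ measurableSet_Ioi
    refine ContinuousOn.mul (by fun_prop) (Complex.continuous_ofReal.comp_continuousOn ?_)
    exact ContinuousOn.mul (by fun_prop) (continuousOn_prabhakar hA hρ hb)
  obtain ⟨r1, r2, r3⟩ := integrable_of_hasSum hFint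
    (by simp_rw [hInorm]; exact hs.mul_left _) hmeas hsum
  refine ⟨r1, ?_, ?_⟩
  · simpa only [hI] using r2
  · simpa only [hInorm, tsum_mul_left] using r3

lemma negBinom_succ {A : ℝ} (hA : 0 < A) (k : ℕ) :
    ((k + 1 : ℕ) : ℝ) * negBinom A (k + 1) = A * negBinom (A + 1) k := by
  have h1 := (Real.Gamma_pos_of_pos hA).ne'
  rw [negBinom, negBinom, Real.Gamma_add_one hA.ne', Nat.factorial_succ,
    show A + ((k + 1 : ℕ) : ℝ) = A + 1 + k by push_cast; ring]
  have : (k.factorial : ℝ) ≠ 0 := by exact_mod_cast k.factorial_ne_zero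
  push_cast
  have : (k : ℝ) + 1 ≠ 0 := by positivity
  field_simp

lemma HasSum.congr_eq {ι α : Type*} [AddCommMonoid α] [TopologicalSpace α] {f g : ι → α} {a b : α}
    (h : HasSum f a) (hfg : ∀ i, g i = f i) (hab : b = a) : HasSum g b := by
  rw [hab, show g = f from funext hfg]; exact h

lemma hasSum_nat_mul_negBinom {A : ℝ} (hA : 0 < A) {y : ℂ} (hy : ‖y‖ < 1) :
    HasSum (fun k : ℕ => (k : ℂ) * ((negBinom A k : ℂ) * (-y) ^ k))
      (-A * y * (1 + y) ^ (-(A + 1) : ℂ)) := by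
  have h := (hasSum_negBinom (A := A + 1) (by positivity) hy).mul_left (-A * y : ℂ)
  rw [← hasSum_nat_add_iff' 1]
  push_cast at h
  refine h.congr_eq (fun k => ?_) (by simp)
  have := congrArg (fun r : ℝ => (r : ℂ)) (negBinom_succ hA k)
  push_cast at this ⊢
  rw [← mul_assoc, this, pow_succ]
  ring

/-- The negative binomial series with the weights `Γ(b + 2 + ρ k) / Γ(b + ρ k)`, which come from the
Laplace transform of `u ^ 2` times the Prabhakar function. -/
lemma hasSum_quadratic_negBinom {A : ℝ} (hA : 0 < A) (b ρ : ℝ) {y : ℂ} (hy : ‖y‖ < 1) :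
    HasSum (fun k : ℕ => (((b + ρ * k) * (b + 1 + ρ * k) : ℝ) : ℂ) *
      ((negBinom A k : ℂ) * (-y) ^ k))
      (b * (b + 1) * (1 + y) ^ (-A : ℂ) - A * ρ * (2 * b + 1 + ρ) * y * (1 + y) ^ (-(A + 1) : ℂ)
        + A * (A + 1) * ρ ^ 2 * y ^ 2 * (1 + y) ^ (-(A + 2) : ℂ)) := by
  have h0 := hasSum_negBinom hA hy
  have h1 := hasSum_nat_mul_negBinom hA hy
  have h2 : HasSum (fun k : ℕ => (k : ℂ) * (k - 1) * ((negBinom A k : ℂ) * (-y) ^ k))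
      (A * (A + 1) * y ^ 2 * (1 + y) ^ (-(A + 2) : ℂ)) := by
    have h := (hasSum_nat_mul_negBinom (A := A + 1) (by positivity) hy).mul_left (-A * y : ℂ)
    rw [← hasSum_nat_add_iff' 1]
    refine h.congr_eq (fun k => ?_) ?_
    · have := congrArg (fun r : ℝ => (r : ℂ)) (negBinom_succ hA k)
      push_cast at this ⊢
      rw [pow_succ]
      linear_combination (k * (-y) ^ k * (-y)) * this
    · rw [show (A : ℂ) + 2 = A + 1 + 1 by ring]
      push_cast [Finset.range_one, Finset.sum_singleton]
      ring
  refine (((h0.mul_left ((b : ℂ) * (b + 1))).add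
    (h1.mul_left ((ρ : ℂ) * (2 * b + 1 + ρ)))).add (h2.mul_left ((ρ : ℂ) ^ 2))).congr_eq
    (fun k => ?_) ?_
  · push_cast; ring
  · ring

/-- The Laplace transform of the Prabhakar function on `re x > 1`, and its continuation, in terms of
principal powers. -/
noncomputable def laplacePrabhakar (A ρ b : ℝ) (x : ℂ) : ℂ :=
  x ^ (-b : ℂ) * (1 + x ^ (-ρ : ℂ)) ^ (-A : ℂ)

/-- The second derivative of `laplacePrabhakar`, the Laplace transform of `u ^ 2` times the
Prabhakar function. Its decay at infinity makes the inversion integral converge absolutely for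
every `b > 0`. -/
noncomputable def laplacePrabhakar₂ (A ρ b : ℝ) (x : ℂ) : ℂ :=
  x ^ (-(b + 2) : ℂ) * (b * (b + 1) * (1 + x ^ (-ρ : ℂ)) ^ (-A : ℂ)
    - A * ρ * (2 * b + 1 + ρ) * x ^ (-ρ : ℂ) * (1 + x ^ (-ρ : ℂ)) ^ (-(A + 1) : ℂ)
    + A * (A + 1) * ρ ^ 2 * (x ^ (-ρ : ℂ)) ^ 2 * (1 + x ^ (-ρ : ℂ)) ^ (-(A + 2) : ℂ))

lemma norm_cpow_neg_of_re_pos {x : ℂ} (hx : 0 < x.re) (r : ℝ) :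
    ‖x ^ (-r : ℂ)‖ = ‖x‖ ^ (-r) := by
  have hx0 : x ≠ 0 := by rintro rfl; simp at hx
  rw [← Complex.ofReal_neg, Complex.norm_cpow_real]

lemma norm_cpow_neg_lt_one {x : ℂ} (hx : 1 < x.re) {ρ : ℝ} (hρ : 0 < ρ) :
    ‖x ^ (-ρ : ℂ)‖ < 1 := by
  rw [norm_cpow_neg_of_re_pos (by linarith)]
  exact Real.rpow_lt_one_of_one_lt_of_neg (hx.trans_le (Complex.re_le_norm x)) (by linarith)

lemma laplace_prabhakar {A ρ b : ℝ} (hA : 0 < A) (hρ : 0 < ρ) (hb : 0 < b) {x : ℝ} (hx : 1 < x) :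
    IntegrableOn (fun u : ℝ => Real.exp (-(x * u)) * prabhakar A ρ b u) (Ioi 0) ∧
    ((∫ u in Ioi (0 : ℝ), Real.exp (-(x * u)) * prabhakar A ρ b u : ℝ) : ℂ)
      = laplacePrabhakar A ρ b x ∧
    ∫ u in Ioi (0 : ℝ), |Real.exp (-(x * u)) * prabhakar A ρ b u| ≤
      x ^ (-b) * ∑' k : ℕ, negBinom A k * (x ^ (-ρ)) ^ k := by
  have hx0 : 0 < x := by linarith
  have hG : ∀ k : ℕ, Real.Gamma (b + ρ * k) / Real.Gamma (b + ρ * k) = 1 := fun k =>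
    div_self (Real.Gamma_pos_of_pos (by positivity)).ne'
  have hs := summable_negBinom hA (y := x ^ (-ρ)) (by positivity)
    (Real.rpow_lt_one_of_one_lt_of_neg hx (by linarith))
  obtain ⟨h1, h2, h3⟩ := laplace_prabhakar_series hA hρ hb 0 (x := x) (by simpa using hx0)
    (by simpa [hG] using hs)
  have e : ∀ u : ℝ, Complex.exp (-(x * u)) * ((u ^ 0 * prabhakar A ρ b u : ℝ) : ℂ)
      = ((Real.exp (-(x * u)) * prabhakar A ρ b u : ℝ) : ℂ) := by
    intro u; push_cast; simp
  simp only [e] at h1 h2 h3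
  have h1' := h1.re
  simp only [RCLike.re_eq_complex_re, Complex.ofReal_re] at h1'
  refine ⟨h1', ?_, ?_⟩
  · rw [← integral_complex_ofReal]
    refine h2.unique ?_
    simp only [Nat.cast_zero, add_zero, hG, mul_one]
    exact (hasSum_negBinom hA (norm_cpow_neg_lt_one (by simpa using hx) hρ)).mul_left _
  · simpa only [Nat.cast_zero, add_zero, hG, mul_one, Complex.norm_real, Complex.ofReal_re,
      Real.norm_eq_abs] using h3

lemma Gamma_add_two_div {s : ℝ} (hs : 0 < s) :
    Real.Gamma (s + 2) / Real.Gamma s = s * (s + 1) := by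
  have := (Real.Gamma_pos_of_pos hs).ne'
  rw [show s + 2 = s + 1 + 1 by ring, Real.Gamma_add_one (by positivity),
    Real.Gamma_add_one hs.ne']
  field_simp

lemma laplace_sq_mul_prabhakar {A ρ b : ℝ} (hA : 0 < A) (hρ : 0 < ρ) (hb : 0 < b) {x : ℂ}
    (hx : 1 < x.re) :
    IntegrableOn (fun u : ℝ => Complex.exp (-(x * u)) * ((u ^ 2 * prabhakar A ρ b u : ℝ) : ℂ))
      (Ioi 0) ∧
    ∫ u in Ioi (0 : ℝ), Complex.exp (-(x * u)) * ((u ^ 2 * prabhakar A ρ b u : ℝ) : ℂ)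
      = laplacePrabhakar₂ A ρ b x := by
  have hx0 : 0 < x.re := by linarith
  have hG : ∀ k : ℕ, Real.Gamma (b + (2 : ℕ) + ρ * k) / Real.Gamma (b + ρ * k)
      = (b + ρ * k) * (b + 1 + ρ * k) := by
    intro k
    rw [show b + (2 : ℕ) + ρ * k = b + ρ * k + 2 by push_cast; ring,
      Gamma_add_two_div (by positivity)]
    ring
  have hlt := Real.rpow_lt_one_of_one_lt_of_neg hx (by linarith : -ρ < 0)
  have hs := (hasSum_quadratic_negBinom hA b ρ (y := -((x.re ^ (-ρ) : ℝ) : ℂ))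
    (by rwa [norm_neg, Complex.norm_real, Real.norm_of_nonneg (by positivity)])).summable
  have hs' : Summable fun k : ℕ => negBinom A k *
      ((b + ρ * k) * (b + 1 + ρ * k)) * (x.re ^ (-ρ)) ^ k := by
    rw [← Complex.summable_ofReal]
    convert hs using 1
    ext k; push_cast; rw [neg_neg]; ring
  obtain ⟨h1, h2, -⟩ := laplace_prabhakar_series hA hρ hb 2 hx0 (by simpa only [hG] using hs')
  refine ⟨h1, h2.unique ?_⟩
  simp only [hG]
  refine ((hasSum_quadratic_negBinom hA b ρ (norm_cpow_neg_lt_one hx hρ)).mul_left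
    (x ^ (-(b + 2) : ℂ))).congr_eq (fun k => ?_) rfl
  push_cast; ring

/-! ### Bromwich inversion -/

open scoped FourierTransform in
/-- The Bromwich inversion formula for a continuous function on the half-line that vanishes
at `0`. -/
lemma laplace_inversion {g : ℝ → ℂ} (hg : Continuous g) (hg0 : ∀ v ≤ 0, g v = 0) {τ : ℝ}
    (hint : IntegrableOn (fun v : ℝ => Complex.exp (-(τ * v)) * g v) (Ioi 0)) {G : ℂ → ℂ}
    (hG : ∀ t : ℝ, ∫ v in Ioi (0 : ℝ), Complex.exp (-((τ + t * Complex.I) * v)) * g v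
      = G (τ + t * Complex.I))
    (hGi : Integrable fun t : ℝ => G (τ + t * Complex.I)) (u : ℝ) :
    g u = ((2 * Real.pi)⁻¹ : ℝ) * ∫ t : ℝ, Complex.exp ((τ + t * Complex.I) * u) *
      G (τ + t * Complex.I) := by
  set f : ℝ → ℂ := fun v => Complex.exp (-(τ * v)) * g v with hf
  have h2pi : (2 * Real.pi) ≠ 0 := by positivity
  have hsupp : ∀ v ∉ Ioi (0 : ℝ), g v = 0 := fun v hv => hg0 v (not_lt.1 hv)
  have hfi : Integrable f := by
    refine (integrableOn_iff_integrable_of_support_subset fun v hv => ?_).1 hint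
    by_contra h
    exact hv (by simp [hf, hsupp v h])
  have hfc : Continuous f := by fun_prop
  have hF : ∀ w : ℝ, 𝓕 f w = G (τ + (2 * Real.pi * w : ℝ) * Complex.I) := by
    intro w
    rw [Real.fourier_real_eq_integral_exp_smul, ← hG,
      ← setIntegral_eq_integral_of_forall_compl_eq_zero (s := Ioi 0)]
    · congr 1; ext v
      rw [hf, smul_eq_mul, ← mul_assoc, ← Complex.exp_add]
      congr 2; push_cast; ring
    · intro v hv
      simp [hf, hsupp v hv]
  have hFi : Integrable (𝓕 f) := by
    rw [funext hF]
    exact hGi.comp_mul_left' h2pi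
  have hinv := congrFun (hfc.fourierInv_fourier_eq hfi hFi) u
  rw [Real.fourierInv_eq'] at hinv
  have hsub := Measure.integral_comp_mul_left (fun t : ℝ => Complex.exp ((τ + t * Complex.I) * u) *
      G (τ + t * Complex.I)) (2 * Real.pi)
  have he : Complex.exp (τ * u) * f u = g u := by
    rw [hf, ← mul_assoc, ← Complex.exp_add]; simp
  rw [abs_of_pos (by positivity), Complex.real_smul] at hsub
  rw [← he, ← hinv, ← integral_const_mul, ← hsub]
  congr 1; ext w
  rw [hF, smul_eq_mul, ← mul_assoc, ← Complex.exp_add]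
  congr 2
  simp
  ring

/-- On `σ ≤ re x`, the norm dominates `1 + |im x|`. -/
lemma mul_one_add_abs_le_norm {σ : ℝ} {x : ℂ} (hx : σ ≤ x.re) :
    min σ 1 / 2 * (1 + |x.im|) ≤ ‖x‖ := by
  have h1 := (le_abs_self _).trans (Complex.abs_re_le_norm x)
  have h2 := Complex.abs_im_le_norm x
  have h3 := min_le_left σ 1
  have h4 := min_le_right σ 1
  nlinarith [abs_nonneg x.im]

lemma norm_rpow_neg_le {σ s : ℝ} (hσ : 0 < σ) (hs : 0 ≤ s) {x : ℂ} (hx : σ ≤ x.re) :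
    ‖x‖ ^ (-s) ≤ (min σ 1 / 2) ^ (-s) * (1 + |x.im|) ^ (-s) := by
  rw [← Real.mul_rpow (by positivity) (by positivity)]
  exact Real.rpow_le_rpow_of_nonpos (by positivity) (mul_one_add_abs_le_norm hx) (by linarith)

lemma integrable_const_mul_one_add_abs {s : ℝ} (hs : 1 < s) (C : ℝ) :
    Integrable fun t : ℝ => C * (1 + |t|) ^ (-s) :=
  (integrable_one_add_norm (by simpa using hs)).const_mul C

lemma integrable_norm_rpow_vertical {σ s : ℝ} (hσ : 0 < σ) (hs : 1 < s) :
    Integrable fun t : ℝ => ‖(σ : ℂ) + t * Complex.I‖ ^ (-s) := by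
  refine (integrable_const_mul_one_add_abs hs ((min σ 1 / 2) ^ (-s))).mono' ?_
    (Eventually.of_forall fun t => ?_)
  · refine Measurable.aestronglyMeasurable ?_
    fun_prop
  · rw [Real.norm_of_nonneg (by positivity)]
    simpa using norm_rpow_neg_le hσ (by linarith) (x := (σ : ℂ) + t * Complex.I) (by simp)

lemma integral_norm_rpow_vertical {σ s : ℝ} (hσ : 0 < σ) :
    ∫ t : ℝ, ‖(σ : ℂ) + t * Complex.I‖ ^ (-s)
      = σ ^ (1 - s) * ∫ t : ℝ, ‖(1 : ℂ) + t * Complex.I‖ ^ (-s) := by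
  have h := Measure.integral_comp_mul_left
    (fun t : ℝ => ‖(σ : ℂ) + t * Complex.I‖ ^ (-s)) σ
  have e : ∀ t : ℝ, ‖(σ : ℂ) + (σ * t : ℝ) * Complex.I‖ ^ (-s)
      = σ ^ (-s) * ‖(1 : ℂ) + t * Complex.I‖ ^ (-s) := by
    intro t
    rw [show (σ : ℂ) + (σ * t : ℝ) * Complex.I = σ * (1 + t * Complex.I) by push_cast; ring,
      norm_mul, Complex.norm_real, Real.norm_of_nonneg hσ.le,
      Real.mul_rpow hσ.le (norm_nonneg _)]
  simp only [e] at h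
  rw [integral_const_mul, abs_of_pos (inv_pos.2 hσ), smul_eq_mul, eq_inv_mul_iff_mul_eq₀ hσ.ne']
    at h
  rw [← h, ← mul_assoc, sub_eq_add_neg, Real.rpow_add hσ, Real.rpow_one]

/-- Cauchy's theorem for the strip between two vertical lines. -/
lemma integral_vertical_eq {h : ℂ → ℂ} {σ τ s K : ℝ} (hσ : 0 < σ) (hστ : σ ≤ τ) (hs : 1 < s)
    (hd : DifferentiableOn ℂ h {x | 0 < x.re})
    (hb : ∀ x : ℂ, σ ≤ x.re → x.re ≤ τ → ‖h x‖ ≤ K * ‖x‖ ^ (-s)) :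
    ∫ t : ℝ, h (σ + t * Complex.I) = ∫ t : ℝ, h (τ + t * Complex.I) := by
  have hK : 0 ≤ K := by
    have h1 := hb σ (by simp) (by simpa using hστ)
    have h2 : 0 < ‖(σ : ℂ)‖ ^ (-s) :=
      Real.rpow_pos_of_pos (norm_pos_iff.2 (by exact_mod_cast hσ.ne')) _
    exact nonneg_of_mul_nonneg_left ((norm_nonneg _).trans h1) h2
  set K' := K * (min σ 1 / 2) ^ (-s)
  have hb' : ∀ x : ℂ, σ ≤ x.re → x.re ≤ τ → ‖h x‖ ≤ K' * (1 + |x.im|) ^ (-s) := by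
    intro x h1 h2
    refine (hb x h1 h2).trans ?_
    rw [mul_assoc]
    exact mul_le_mul_of_nonneg_left (norm_rpow_neg_le hσ (by linarith) h1) hK
  have hint : ∀ a : ℝ, σ ≤ a → a ≤ τ → Integrable fun t : ℝ => h (a + t * Complex.I) := by
    intro a h1 h2
    refine (integrable_const_mul_one_add_abs hs K').mono' ?_ (Eventually.of_forall fun t => ?_)
    · refine (hd.continuousOn.comp_continuous (by fun_prop) fun t => ?_).aestronglyMeasurable
      simpa using hσ.trans_le h1
    · simpa using hb' (a + t * Complex.I) (by simpa using h1) (by simpa using h2)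
  -- the horizontal sides of the rectangle tend to zero
  have hhor : ∀ ε : ℝ, |ε| = 1 → Tendsto (fun T : ℝ => ∫ x in σ..τ, h (x + (ε * T : ℝ) * Complex.I))
      atTop (𝓝 0) := by
    intro ε hε
    have hlim : Tendsto (fun T : ℝ => K' * (1 + |ε * T|) ^ (-s) * |τ - σ|) atTop (𝓝 0) := by
      have h1 : Tendsto (fun T : ℝ => 1 + |ε * T|) atTop atTop := by
        simp only [abs_mul, hε, one_mul]
        exact tendsto_const_nhds.add_atTop tendsto_abs_atTop_atTop
      have h2 := (tendsto_rpow_neg_atTop (by linarith : 0 < s)).comp h1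
      simpa using (h2.const_mul K').mul_const |τ - σ|
    refine squeeze_zero_norm (fun T => ?_) hlim
    refine intervalIntegral.norm_integral_le_of_norm_le_const fun x hx => ?_
    rw [uIoc_of_le hστ] at hx
    simpa using hb' (x + (ε * T : ℝ) * Complex.I) (by simpa using hx.1.le) (by simpa using hx.2)
  have hver : ∀ a : ℝ, σ ≤ a → a ≤ τ → Tendsto (fun T : ℝ => ∫ t in (-T)..T,
      h (a + t * Complex.I)) atTop (𝓝 (∫ t : ℝ, h (a + t * Complex.I))) := fun a h1 h2 =>
    intervalIntegral_tendsto_integral (hint a h1 h2) tendsto_neg_atTop_atBot tendsto_id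
  have hrect : ∀ T : ℝ, (∫ x in σ..τ, h (x + (-1 * T : ℝ) * Complex.I))
      - (∫ x in σ..τ, h (x + (1 * T : ℝ) * Complex.I))
      + Complex.I * (∫ t in (-T)..T, h (τ + t * Complex.I))
      - Complex.I * (∫ t in (-T)..T, h (σ + t * Complex.I)) = 0 := by
    intro T
    have := Complex.integral_boundary_rect_eq_zero_of_differentiableOn h
      (σ + (-T : ℝ) * Complex.I) (τ + (T : ℝ) * Complex.I) (hd.mono fun x hx => by
        have h1 := hx.1
        simp [uIcc_of_le hστ] at h1
        exact hσ.trans_le h1.1)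
    simpa using this
  have hlim := (((hhor (-1) (by simp)).sub (hhor 1 (by simp))).add
    ((hver τ hστ le_rfl).const_mul Complex.I)).sub ((hver σ le_rfl hστ).const_mul Complex.I)
  have h0 := tendsto_nhds_unique (hlim.congr hrect) tendsto_const_nhds
  have h1 : Complex.I * ((∫ t : ℝ, h (τ + t * Complex.I)) - ∫ t : ℝ, h (σ + t * Complex.I))
      = 0 := by
    linear_combination h0
  exact (sub_eq_zero.1 ((mul_eq_zero.1 h1).resolve_left Complex.I_ne_zero)).symm

lemma one_add_mem_slitPlane {z : ℂ} (hz : z ∈ Complex.slitPlane) : 1 + z ∈ Complex.slitPlane := by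
  rcases hz with h | h
  · exact Or.inl (by simp; linarith)
  · exact Or.inr (by simpa using h)

lemma cpow_neg_mem_slitPlane {ρ : ℝ} {x : ℂ} (hx : x ≠ 0) (h : |ρ * x.arg| < Real.pi) :
    x ^ (-ρ : ℂ) ∈ Complex.slitPlane := by
  rw [← Complex.ofReal_neg, Complex.cpow_ofReal, Complex.mem_slitPlane_iff]
  have hr : 0 < ‖x‖ ^ (-ρ) := Real.rpow_pos_of_pos (norm_pos_iff.2 hx) _
  by_cases hs : Real.sin (x.arg * -ρ) = 0
  · left
    have h2 := abs_lt.1 h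
    have h0 := (Real.sin_eq_zero_iff_of_lt_of_lt (by linarith [h2.2]) (by linarith [h2.1])).1 hs
    rw [h0]
    simpa using hr
  · right
    simp only [Complex.mul_im, Complex.ofReal_re, Complex.ofReal_im, Complex.add_im,
      Complex.I_im, Complex.I_re]
    simpa using ⟨hr.ne', by simpa using hs⟩

lemma abs_mul_arg_lt_pi {ρ : ℝ} (hρ : 0 < ρ) (hρ2 : ρ ≤ 2) {x : ℂ} (hx : 0 < x.re) :
    |ρ * x.arg| < Real.pi := by
  have h := Complex.abs_arg_lt_pi_div_two_iff.2 (Or.inl hx)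
  rw [abs_mul, abs_of_pos hρ]
  nlinarith [abs_nonneg x.arg]

lemma differentiableOn_laplacePrabhakar₂ {A ρ b : ℝ} (hρ : 0 < ρ) (hρ2 : ρ ≤ 2) :
    DifferentiableOn ℂ (laplacePrabhakar₂ A ρ b) {x | 0 < x.re} := by
  intro x hx
  have hx' : x ∈ Complex.slitPlane := Or.inl hx
  have hx0 : x ≠ 0 := Complex.slitPlane_ne_zero hx'
  have h1 : 1 + x ^ (-ρ : ℂ) ∈ Complex.slitPlane :=
    one_add_mem_slitPlane (cpow_neg_mem_slitPlane hx0 (abs_mul_arg_lt_pi hρ hρ2 hx))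
  have d0 : ∀ c : ℂ, DifferentiableAt ℂ (fun x : ℂ => x ^ c) x := fun c =>
    differentiableAt_id.cpow_const hx'
  have d1 : ∀ c : ℂ, DifferentiableAt ℂ (fun x : ℂ => (1 + x ^ (-ρ : ℂ)) ^ c) x := fun c =>
    ((d0 _).const_add 1).cpow_const h1
  refine DifferentiableAt.differentiableWithinAt ?_
  exact (d0 _).mul ((((d1 _).const_mul _).sub (((d0 _).const_mul _).mul (d1 _))).add
    ((((d0 _).pow 2).const_mul _).mul (d1 _)))

/-- `u ^ 2` times the Prabhakar function, extended by zero to a continuous function. -/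
lemma continuous_sq_mul_prabhakar {A ρ b : ℝ} (hA : 0 < A) (hρ : 0 < ρ) (hb : 0 < b) :
    Continuous fun u : ℝ => if 0 < u then u ^ 2 * prabhakar A ρ b u else 0 := by
  have h : Continuous fun u : ℝ =>
      (max u 0) ^ (b + 1) * prabhakarSeries A ρ b ((max u 0) ^ ρ) := by
    refine ((Real.continuous_rpow_const (by positivity)).comp (by fun_prop)).mul ?_
    exact (continuousOn_prabhakarSeries_rpow hA hρ hb).comp_continuous (by fun_prop)
      fun u => le_max_right u 0
  convert h using 2 with u
  split_ifs with hu
  · rw [max_eq_left hu.le, prabhakar_eq hu, ← mul_assoc, ← Real.rpow_natCast, ← Real.rpow_add hu]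
    congr 2; push_cast; ring
  · rw [max_eq_right (not_lt.1 hu), Real.zero_rpow (by positivity), zero_mul]

/-- A bound for the second derivative of the Laplace transform gives a bound for the function. -/
lemma sq_mul_abs_prabhakar_le {A ρ b : ℝ} (hA : 0 < A) (hρ : 0 < ρ) (hρ2 : ρ ≤ 2) (hb : 0 < b)
    {σ s K : ℝ} (hσ : 0 < σ) (hs : 1 < s)
    (hK : ∀ x : ℂ, σ ≤ x.re → ‖laplacePrabhakar₂ A ρ b x‖ ≤ K * ‖x‖ ^ (-s)) {u : ℝ} (hu : 0 < u) :
    u ^ 2 * |prabhakar A ρ b u| ≤ Real.exp (σ * u) * (K * (σ ^ (1 - s) *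
      ∫ t : ℝ, ‖(1 : ℂ) + t * Complex.I‖ ^ (-s))) := by
  set g : ℝ → ℂ := fun u => ((if 0 < u then u ^ 2 * prabhakar A ρ b u else 0 : ℝ) : ℂ) with hgdef
  set G := laplacePrabhakar₂ A ρ b
  have hg : Continuous g := Complex.continuous_ofReal.comp (continuous_sq_mul_prabhakar hA hρ hb)
  have hgpos : ∀ v ∈ Ioi (0 : ℝ), g v = ((v ^ 2 * prabhakar A ρ b v : ℝ) : ℂ) := by
    intro v hv
    simp only [hgdef, if_pos (show 0 < v from hv)]
  have hre : ∀ t : ℝ, (((σ + 2 : ℝ) : ℂ) + t * Complex.I).re = σ + 2 := fun t => by simp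
  have hdiff : DifferentiableOn ℂ G {x | 0 < x.re} := differentiableOn_laplacePrabhakar₂ hρ hρ2
  have hGi : Integrable fun t : ℝ => G ((σ + 2 : ℝ) + t * Complex.I) := by
    refine ((integrable_norm_rpow_vertical (σ := σ + 2) (by linarith) hs).const_mul K).mono'
      (hdiff.continuousOn.comp_continuous (by fun_prop) fun t => ?_).aestronglyMeasurable
      (Eventually.of_forall fun t => hK _ ?_)
    · simp; linarith
    · simp
  have hinv := laplace_inversion hg (fun v hv => by simp [hgdef, not_lt.2 hv]) (τ := σ + 2)
    (G := G) ?_ (fun t => ?_) hGi u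
  rotate_left
  · refine (laplace_sq_mul_prabhakar hA hρ hb (x := ((σ + 2 : ℝ) : ℂ))
      (by simp; linarith)).1.congr_fun (fun v hv => ?_) measurableSet_Ioi
    simp only [hgpos v hv]
  · refine Eq.trans ?_ (laplace_sq_mul_prabhakar hA hρ hb
      (x := ((σ + 2 : ℝ) : ℂ) + t * Complex.I) (by rw [hre]; linarith)).2
    refine setIntegral_congr_fun measurableSet_Ioi fun v hv => ?_
    simp only [hgpos v hv]
  have hK0 : 0 ≤ K := by
    have h1 := hK σ (by simp)
    have h2 : 0 < ‖(σ : ℂ)‖ ^ (-s) :=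
      Real.rpow_pos_of_pos (norm_pos_iff.2 (by exact_mod_cast hσ.ne')) _
    exact nonneg_of_mul_nonneg_left ((norm_nonneg _).trans h1) h2
  have hexp : ∀ x : ℂ, ‖Complex.exp (x * u) * G x‖ = Real.exp (x.re * u) * ‖G x‖ := by
    intro x; rw [norm_mul, Complex.norm_exp]; simp
  have hshift := integral_vertical_eq (h := fun x => Complex.exp (x * u) * G x) (σ := σ)
    (τ := σ + 2) (s := s) (K := Real.exp ((σ + 2) * u) * K) hσ (by linarith) hs
    (DifferentiableOn.mul (by fun_prop) hdiff) (fun x h1 h2 => by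
      rw [hexp, mul_assoc]
      exact mul_le_mul (Real.exp_le_exp.2 (by nlinarith)) (hK x h1) (norm_nonneg _)
        (Real.exp_pos _).le)
  rw [← hshift, hgpos u hu] at hinv
  have hnorm := congrArg norm hinv
  rw [Complex.norm_real, norm_mul, norm_mul, Real.norm_of_nonneg (sq_nonneg u), Complex.norm_real,
    Real.norm_eq_abs] at hnorm
  rw [hnorm]
  have hpi : ‖(2 * Real.pi)⁻¹‖ ≤ 1 := by
    rw [norm_inv]
    apply inv_le_one_of_one_le₀
    rw [Real.norm_of_nonneg (by positivity)]
    linarith [Real.pi_gt_three]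
  refine (mul_le_of_le_one_left (norm_nonneg _) hpi).trans ?_
  rw [← integral_norm_rpow_vertical hσ, ← integral_const_mul, ← integral_const_mul]
  refine norm_integral_le_of_norm_le
    (((integrable_norm_rpow_vertical hσ hs).const_mul K).const_mul _)
    (Eventually.of_forall fun t => ?_)
  rw [hexp]
  have hre' : ((σ : ℂ) + t * Complex.I).re = σ := by simp
  rw [hre']
  exact mul_le_mul_of_nonneg_left (hK _ hre'.ge) (Real.exp_pos _).le

/-! ### The Prabhakar function at infinity -/

/-- For `ρ < 2` the point `x ^ (-ρ)` stays in a sector that avoids the negative axis. -/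
lemma exists_mul_le_norm_one_add_cpow {ρ : ℝ} (hρ : 0 < ρ) (hρ2 : ρ < 2) :
    ∃ c : ℝ, 0 < c ∧ ∀ x : ℂ, 0 < x.re → c * (1 + ‖x‖ ^ (-ρ)) ≤ ‖1 + x ^ (-ρ : ℂ)‖ := by
  set m := Real.cos (ρ * (Real.pi / 2)) with hm
  have hpi := Real.pi_pos
  have hm1 : -1 < m := by
    rw [hm, ← Real.cos_pi]
    exact Real.cos_lt_cos_of_nonneg_of_le_pi (by positivity) le_rfl (by nlinarith)
  have hm2 : m ≤ 1 := Real.cos_le_one _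
  refine ⟨(1 + m) / 2, by linarith, fun x hx => ?_⟩
  set r := ‖x‖ ^ (-ρ) with hr
  have hr0 : 0 ≤ r := by positivity
  set θ := x.arg * -ρ with hθ
  have hcos : m ≤ Real.cos θ := by
    have h := Complex.abs_arg_lt_pi_div_two_iff.2 (Or.inl hx)
    rw [← Real.cos_abs θ, hθ, abs_mul, abs_neg, abs_of_pos hρ]
    exact Real.cos_le_cos_of_nonneg_of_le_pi (by positivity) (by nlinarith) (by nlinarith)
  have hsq : ‖1 + x ^ (-ρ : ℂ)‖ ^ 2 = 1 + 2 * r * Real.cos θ + r ^ 2 := by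
    rw [← Complex.ofReal_neg, Complex.cpow_ofReal, ← hr, ← hθ, ← Complex.normSq_eq_norm_sq,
      Complex.normSq_apply]
    simp only [Complex.add_re, Complex.add_im, Complex.mul_re, Complex.mul_im, Complex.ofReal_re,
      Complex.ofReal_im, Complex.I_re, Complex.I_im, Complex.one_re, Complex.one_im]
    linear_combination r ^ 2 * Real.sin_sq_add_cos_sq θ
  refine abs_le_of_sq_le_sq' ?_ (norm_nonneg _) |>.2
  rw [hsq, mul_pow]
  have h1 : ((1 + m) / 2) ^ 2 ≤ (1 + m) / 2 := by nlinarith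
  calc ((1 + m) / 2) ^ 2 * (1 + r) ^ 2 ≤ (1 + m) / 2 * (1 + r) ^ 2 := by gcongr
    _ ≤ 1 + 2 * r * m + r ^ 2 := by nlinarith [sq_nonneg (1 - r)]
    _ ≤ _ := by gcongr

/-- For `ρ = 2` the points `±i`, where `1 + x ^ (-2)` vanishes, are avoided on `σ ≤ re x`. -/
lemma exists_mul_le_norm_one_add_cpow_of_le_re {ρ : ℝ} (hρ : 0 < ρ) (hρ2 : ρ ≤ 2) {σ : ℝ}
    (hσ : 0 < σ) :
    ∃ c : ℝ, 0 < c ∧ ∀ x : ℂ, σ ≤ x.re → c * (1 + ‖x‖ ^ (-ρ)) ≤ ‖1 + x ^ (-ρ : ℂ)‖ := by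
  rcases hρ2.lt_or_eq with h | rfl
  · obtain ⟨c, hc, h⟩ := exists_mul_le_norm_one_add_cpow hρ h
    exact ⟨c, hc, fun x hx => h x (hσ.trans_le hx)⟩
  refine ⟨min 1 σ / 2, by positivity, fun x hx => ?_⟩
  have hx0 : x ≠ 0 := by rintro rfl; simp at hx; linarith
  have hn : 0 < ‖x‖ := norm_pos_iff.2 hx0
  have e1 : x ^ (-(2 : ℝ) : ℂ) = (x ^ 2)⁻¹ := by
    rw [Complex.cpow_neg, Complex.ofReal_ofNat, Complex.cpow_ofNat]
  have e2 : ‖x‖ ^ (-(2 : ℝ)) = (‖x‖ ^ 2)⁻¹ := by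
    rw [Real.rpow_neg hn.le]; norm_cast
  have e3 : 1 + (x ^ 2)⁻¹ = (x ^ 2 + 1) / x ^ 2 := by field_simp
  have e4 : 1 + (‖x‖ ^ 2)⁻¹ = (‖x‖ ^ 2 + 1) / ‖x‖ ^ 2 := by field_simp
  rw [e1, e2, e3, e4, norm_div, norm_pow, ← mul_div_assoc]
  gcongr
  refine abs_le_of_sq_le_sq' ?_ (norm_nonneg _) |>.2
  have hsq : ‖x ^ 2 + 1‖ ^ 2 = (‖x‖ ^ 2 - 1) ^ 2 + 4 * x.re ^ 2 := by
    rw [← Complex.normSq_eq_norm_sq, ← Complex.normSq_eq_norm_sq, Complex.normSq_apply,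
      Complex.normSq_apply]
    simp [pow_two]
    ring
  rw [hsq, mul_pow]
  have h1 : min 1 σ / 2 ≤ 1 / 2 := by linarith [min_le_left 1 σ]
  have h2 : min 1 σ / 2 ≤ x.re / 2 := by linarith [min_le_right 1 σ]
  have h0 : 0 < min 1 σ / 2 := by positivity
  have h3 : (min 1 σ / 2) ^ 2 ≤ (1 / 2) ^ 2 := by gcongr
  have h4 : (min 1 σ / 2) ^ 2 ≤ (x.re / 2) ^ 2 := by gcongr
  nlinarith [sq_nonneg (‖x‖ ^ 2 - 3), sq_nonneg (‖x‖ ^ 2 - 1)]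

lemma norm_one_add_cpow_neg_le {A ρ c : ℝ} (hA : 0 < A) (hc : 0 < c) {x : ℂ}
    (h : c * (1 + ‖x‖ ^ (-ρ)) ≤ ‖1 + x ^ (-ρ : ℂ)‖) :
    ‖(1 + x ^ (-ρ : ℂ)) ^ (-A : ℂ)‖ ≤ c ^ (-A) * (1 + ‖x‖ ^ (-ρ)) ^ (-A) := by
  have hpos : 0 < 1 + ‖x‖ ^ (-ρ) := by positivity
  rw [← Complex.ofReal_neg A, Complex.norm_cpow_real, ← Real.mul_rpow hc.le hpos.le]
  exact Real.rpow_le_rpow_of_nonpos (by positivity) h (by linarith)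

lemma laplacePrabhakar₂_eq (A ρ b : ℝ) {x : ℂ} (h : 1 + x ^ (-ρ : ℂ) ≠ 0) :
    laplacePrabhakar₂ A ρ b x = x ^ (-(b + 2) : ℂ) * (1 + x ^ (-ρ : ℂ)) ^ (-A : ℂ) *
      (b * (b + 1) - A * ρ * (2 * b + 1 + ρ) * (1 - (1 + x ^ (-ρ : ℂ))⁻¹)
        + A * (A + 1) * ρ ^ 2 * (1 - (1 + x ^ (-ρ : ℂ))⁻¹) ^ 2) := by
  rw [laplacePrabhakar₂]
  generalize hw : 1 + x ^ (-ρ : ℂ) = w at h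
  have hy : x ^ (-ρ : ℂ) = w - 1 := by rw [← hw]; ring
  have e1 : w ^ (-(A + 1) : ℂ) = w ^ (-A : ℂ) * w⁻¹ := by
    rw [neg_add, Complex.cpow_add _ _ h, Complex.cpow_neg_one]
  have e2 : w ^ (-(A + 2) : ℂ) = w ^ (-A : ℂ) * w⁻¹ * w⁻¹ := by
    rw [show (-(A + 2) : ℂ) = -A + -1 + -1 by ring, Complex.cpow_add _ _ h, Complex.cpow_add _ _ h,
      Complex.cpow_neg_one]
  rw [hy, e1, e2]
  field_simp

/-- The second derivative of the Laplace transform, bounded in terms of a lower bound for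
`1 + x ^ (-ρ)`. -/
lemma norm_laplacePrabhakar₂_le {A ρ b : ℝ} (hA : 0 < A) (hρ : 0 < ρ) (hb : 0 < b) {c : ℝ}
    (hc : 0 < c) : ∃ K : ℝ, 0 ≤ K ∧ ∀ x : ℂ, 0 < x.re →
      c * (1 + ‖x‖ ^ (-ρ)) ≤ ‖1 + x ^ (-ρ : ℂ)‖ →
      ‖laplacePrabhakar₂ A ρ b x‖ ≤ K * ‖x‖ ^ (-(b + 2)) := by
  refine ⟨c ^ (-A) * (b * (b + 1) + A * ρ * (2 * b + 1 + ρ) * (1 + c⁻¹)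
    + A * (A + 1) * ρ ^ 2 * (1 + c⁻¹) ^ 2), by positivity, fun x hx h => ?_⟩
  have hr : 0 ≤ ‖x‖ ^ (-ρ) := by positivity
  have hpos : 0 < ‖1 + x ^ (-ρ : ℂ)‖ := lt_of_lt_of_le (by positivity) h
  have hne : 1 + x ^ (-ρ : ℂ) ≠ 0 := norm_pos_iff.1 hpos
  have hV : ‖1 - (1 + x ^ (-ρ : ℂ))⁻¹‖ ≤ 1 + c⁻¹ := by
    refine (norm_sub_le _ _).trans ?_
    rw [norm_one, norm_inv]
    gcongr
    nlinarith
  have hpow := norm_one_add_cpow_neg_le hA hc h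
  have hle1 : (1 + ‖x‖ ^ (-ρ)) ^ (-A) ≤ 1 :=
    Real.rpow_le_one_of_one_le_of_nonpos (by linarith) (by linarith)
  have hx2 : ‖x ^ (-(b + 2) : ℂ)‖ = ‖x‖ ^ (-(b + 2)) := by
    have := norm_cpow_neg_of_re_pos hx (b + 2)
    push_cast at this
    exact this
  rw [laplacePrabhakar₂_eq _ _ _ hne, norm_mul, norm_mul, hx2]
  have hQ : ‖(b * (b + 1) - A * ρ * (2 * b + 1 + ρ) * (1 - (1 + x ^ (-ρ : ℂ))⁻¹)
        + A * (A + 1) * ρ ^ 2 * (1 - (1 + x ^ (-ρ : ℂ))⁻¹) ^ 2 : ℂ)‖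
      ≤ b * (b + 1) + A * ρ * (2 * b + 1 + ρ) * (1 + c⁻¹)
        + A * (A + 1) * ρ ^ 2 * (1 + c⁻¹) ^ 2 := by
    refine (norm_add_le _ _).trans (add_le_add ((norm_sub_le _ _).trans (add_le_add ?_ ?_)) ?_)
    · rw [← Complex.ofReal_one, ← Complex.ofReal_add, ← Complex.ofReal_mul, Complex.norm_real,
        Real.norm_of_nonneg (by positivity)]
    · have e : (A * ρ * (2 * b + 1 + ρ) : ℂ) = ((A * ρ * (2 * b + 1 + ρ) : ℝ) : ℂ) := by
        push_cast; rfl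
      rw [norm_mul, e, Complex.norm_real, Real.norm_of_nonneg (by positivity)]
      gcongr
    · have e : (A * (A + 1) * ρ ^ 2 : ℂ) = ((A * (A + 1) * ρ ^ 2 : ℝ) : ℂ) := by push_cast; rfl
      rw [norm_mul, e, Complex.norm_real, Real.norm_of_nonneg (by positivity), norm_pow]
      gcongr
  calc _ ≤ ‖x‖ ^ (-(b + 2)) * (c ^ (-A) * 1) * (b * (b + 1) + A * ρ * (2 * b + 1 + ρ) * (1 + c⁻¹)
        + A * (A + 1) * ρ ^ 2 * (1 + c⁻¹) ^ 2) := by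
        gcongr
        exact hpow.trans (by gcongr)
    _ = _ := by ring

/-- If `b = ρ A`, the polynomial in `(1 + x ^ (-ρ))⁻¹` in the second derivative has no constant
term. This gains a factor `‖x‖ ^ ρ` near `0`, of which `‖x‖ ^ (ρ ε)` is kept. -/
lemma norm_laplacePrabhakar₂_mul_le {A ρ : ℝ} (hA : 0 < A) (hρ : 0 < ρ) {c : ℝ}
    (hc : 0 < c) {ε : ℝ} (hε : 0 ≤ ε) (hε1 : ε ≤ 1) : ∃ K : ℝ, 0 ≤ K ∧ ∀ x : ℂ, 0 < x.re →
      c * (1 + ‖x‖ ^ (-ρ)) ≤ ‖1 + x ^ (-ρ : ℂ)‖ →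
      ‖laplacePrabhakar₂ A ρ (ρ * A) x‖ ≤ K * ‖x‖ ^ (-(2 - ρ * ε)) := by
  set b := ρ * A with hb
  have hb0 : 0 < b := by positivity
  refine ⟨c ^ (-A) * (b * (1 + b * c⁻¹ + ρ * (1 + c⁻¹)) * c⁻¹), by positivity, fun x hx h => ?_⟩
  have hx0 : 0 < ‖x‖ := norm_pos_iff.2 (by rintro rfl; simp at hx)
  set r := ‖x‖ ^ (-ρ) with hrdef
  have hr : 0 < r := Real.rpow_pos_of_pos hx0 _
  have hpos : 0 < ‖1 + x ^ (-ρ : ℂ)‖ := lt_of_lt_of_le (by positivity) h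
  have hne : 1 + x ^ (-ρ : ℂ) ≠ 0 := norm_pos_iff.1 hpos
  have hV1 : ‖(1 + x ^ (-ρ : ℂ))⁻¹‖ ≤ c⁻¹ * (1 + r)⁻¹ := by
    rw [norm_inv, ← mul_inv]
    gcongr
  have hV2 : ‖(1 + x ^ (-ρ : ℂ))⁻¹‖ ≤ c⁻¹ := hV1.trans
    (mul_le_of_le_one_right (by positivity) (inv_le_one_of_one_le₀ (by linarith)))
  have hpow := norm_one_add_cpow_neg_le hA hc h
  have hx2 : ‖x ^ (-(b + 2) : ℂ)‖ = ‖x‖ ^ (-(b + 2)) := by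
    have := norm_cpow_neg_of_re_pos hx (b + 2)
    push_cast at this
    exact this
  have hQeq : (b * (b + 1) - A * ρ * (2 * b + 1 + ρ) * (1 - (1 + x ^ (-ρ : ℂ))⁻¹)
        + A * (A + 1) * ρ ^ 2 * (1 - (1 + x ^ (-ρ : ℂ))⁻¹) ^ 2 : ℂ)
      = b * (1 + b * (1 + x ^ (-ρ : ℂ))⁻¹ - ρ * (1 - (1 + x ^ (-ρ : ℂ))⁻¹)) *
        (1 + x ^ (-ρ : ℂ))⁻¹ := by
    rw [hb]; push_cast; ring
  have hQ : ‖(b * (1 + b * (1 + x ^ (-ρ : ℂ))⁻¹ - ρ * (1 - (1 + x ^ (-ρ : ℂ))⁻¹)) *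
        (1 + x ^ (-ρ : ℂ))⁻¹ : ℂ)‖
      ≤ b * (1 + b * c⁻¹ + ρ * (1 + c⁻¹)) * (c⁻¹ * (1 + r)⁻¹) := by
    rw [norm_mul, norm_mul, Complex.norm_real, Real.norm_of_nonneg hb0.le]
    gcongr
    refine (norm_sub_le _ _).trans (add_le_add ((norm_add_le _ _).trans ?_) ?_)
    · rw [norm_one, norm_mul, Complex.norm_real, Real.norm_of_nonneg hb0.le]
      gcongr
    · rw [norm_mul, Complex.norm_real, Real.norm_of_nonneg hρ.le]
      gcongr
      exact (norm_sub_le _ _).trans (by rw [norm_one]; gcongr)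
  have hfin : ‖x‖ ^ (-(b + 2)) * ((1 + r) ^ (-A) * (1 + r)⁻¹) ≤ ‖x‖ ^ (-(2 - ρ * ε)) := by
    have h1 : (1 + r) ^ (-A) * (1 + r)⁻¹ = (1 + r) ^ (-(A + 1)) := by
      rw [← Real.rpow_neg_one, ← Real.rpow_add (by positivity), neg_add]
    have h2 : (1 + r) ^ (-(A + 1)) ≤ (1 + r) ^ (-(A + ε)) :=
      Real.rpow_le_rpow_of_exponent_le (by linarith) (by linarith)
    have h3 : (1 + r) ^ (-(A + ε)) ≤ r ^ (-(A + ε)) :=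
      Real.rpow_le_rpow_of_nonpos hr (by linarith) (by linarith)
    have h4 : r ^ (-(A + ε)) = ‖x‖ ^ (b + ρ * ε) := by
      rw [hrdef, ← Real.rpow_mul hx0.le]; congr 1; rw [hb]; ring
    rw [h1]
    calc _ ≤ ‖x‖ ^ (-(b + 2)) * ‖x‖ ^ (b + ρ * ε) := by
          rw [← h4]; gcongr; exact h2.trans h3
      _ = _ := by rw [← Real.rpow_add hx0]; congr 1; ring
  rw [laplacePrabhakar₂_eq _ _ _ hne, norm_mul, norm_mul, hx2, hQeq]
  calc _ ≤ ‖x‖ ^ (-(b + 2)) * (c ^ (-A) * (1 + r) ^ (-A)) *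
        (b * (1 + b * c⁻¹ + ρ * (1 + c⁻¹)) * (c⁻¹ * (1 + r)⁻¹)) := by gcongr
    _ = c ^ (-A) * (b * (1 + b * c⁻¹ + ρ * (1 + c⁻¹)) * c⁻¹) *
        (‖x‖ ^ (-(b + 2)) * ((1 + r) ^ (-A) * (1 + r)⁻¹)) := by ring
    _ ≤ _ := by gcongr

lemma integrableOn_prabhakar_Ioc {A ρ b : ℝ} (hA : 0 < A) (hρ : 0 < ρ) (hb : 0 < b) (N : ℝ) :
    IntegrableOn (prabhakar A ρ b) (Ioc 0 N) := by
  rcases le_or_gt N 0 with hN | hN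
  · simp [Ioc_eq_empty_of_le hN]
  obtain ⟨C, -, hC⟩ := exists_abs_prabhakar_le hA hρ hb N
  have h1 : IntegrableOn (fun u : ℝ => u ^ (b - 1)) (Ioc 0 N) :=
    (intervalIntegrable_iff_integrableOn_Ioc_of_le hN.le).1
      (intervalIntegral.intervalIntegrable_rpow' (by linarith))
  refine (h1.const_mul C).mono' (((continuousOn_prabhakar hA hρ hb).mono
    Ioc_subset_Ioi_self).aestronglyMeasurable measurableSet_Ioc) ?_
  exact (ae_restrict_mem measurableSet_Ioc).mono fun u hu => hC u hu.1 hu.2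

/-- For `ρ ≤ 2` the Prabhakar function grows more slowly than any exponential. -/
lemma integrableOn_exp_mul_prabhakar {A ρ b : ℝ} (hA : 0 < A) (hρ : 0 < ρ) (hρ2 : ρ ≤ 2)
    (hb : 0 < b) {x : ℝ} (hx : 0 < x) :
    IntegrableOn (fun u => Real.exp (-(x * u)) * prabhakar A ρ b u) (Ioi 0) := by
  obtain ⟨c, hc, h1⟩ := exists_mul_le_norm_one_add_cpow_of_le_re hρ hρ2 (half_pos hx)
  obtain ⟨K, -, h2⟩ := norm_laplacePrabhakar₂_le (A := A) (b := b) hA hρ hb hc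
  set C := K * ((x / 2) ^ (1 - (b + 2)) * ∫ t : ℝ, ‖(1 : ℂ) + t * Complex.I‖ ^ (-(b + 2)))
  have h3 : ∀ u, 0 < u → u ^ 2 * |prabhakar A ρ b u| ≤ Real.exp (x / 2 * u) * C := fun u hu =>
    sq_mul_abs_prabhakar_le hA hρ hρ2 hb (half_pos hx) (by linarith)
      (fun z hz => h2 z ((half_pos hx).trans_le hz) (h1 z hz)) hu
  have hcont : ContinuousOn (fun u => Real.exp (-(x * u)) * prabhakar A ρ b u) (Ioi 0) :=
    ContinuousOn.mul (by fun_prop) (continuousOn_prabhakar hA hρ hb)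
  rw [← Ioc_union_Ioi_eq_Ioi zero_le_one]
  refine IntegrableOn.union ?_ ?_
  · refine (integrableOn_prabhakar_Ioc hA hρ hb 1).norm.mono'
      ((hcont.mono Ioc_subset_Ioi_self).aestronglyMeasurable measurableSet_Ioc) ?_
    refine (ae_restrict_mem measurableSet_Ioc).mono fun u hu => ?_
    rw [norm_mul, Real.norm_of_nonneg (Real.exp_pos _).le]
    refine mul_le_of_le_one_left (norm_nonneg _) (Real.exp_le_one_iff.2 ?_)
    nlinarith [hu.1]
  · refine ((integrableOn_exp_mul_Ioi (a := -(x / 2)) (by linarith) 1).const_mul C).mono'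
      ((hcont.mono (Ioi_subset_Ioi zero_le_one)).aestronglyMeasurable measurableSet_Ioi) ?_
    refine (ae_restrict_mem measurableSet_Ioi).mono fun u hu => ?_
    have hu1 : 1 < u := hu
    rw [norm_mul, Real.norm_of_nonneg (Real.exp_pos _).le, Real.norm_eq_abs]
    have h4 : |prabhakar A ρ b u| ≤ Real.exp (x / 2 * u) * C :=
      (le_mul_of_one_le_left (abs_nonneg _) (by nlinarith)).trans (h3 u (by linarith))
    calc _ ≤ Real.exp (-(x * u)) * (Real.exp (x / 2 * u) * C) := by gcongr
      _ = C * Real.exp (-(x / 2) * u) := by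
        rw [← mul_assoc, ← Real.exp_add, mul_comm]; congr 2; ring

/-- For `ρ < 2` the Prabhakar function with `b = 1` is bounded. -/
lemma exists_abs_prabhakar_one_le {A ρ : ℝ} (hA : 0 < A) (hρ : 0 < ρ) (hρ2 : ρ < 2) :
    ∃ C : ℝ, ∀ u, 0 < u → |prabhakar A ρ 1 u| ≤ C := by
  obtain ⟨c, hc, h1⟩ := exists_mul_le_norm_one_add_cpow hρ hρ2
  obtain ⟨K, -, h2⟩ := norm_laplacePrabhakar₂_le (A := A) (b := 1) hA hρ one_pos hc
  refine ⟨Real.exp 1 * (K * ∫ t : ℝ, ‖(1 : ℂ) + t * Complex.I‖ ^ (-(3 : ℝ))), fun u hu => ?_⟩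
  -- the abscissa `1 / u` balances the two factors of the bound
  have h3 := sq_mul_abs_prabhakar_le hA hρ hρ2.le one_pos (σ := 1 / u) (s := 3) (K := K)
    (by positivity) (by norm_num) (fun z hz => by
      have hz' : 0 < z.re := lt_of_lt_of_le (by positivity) hz
      have := h2 z hz' (h1 z hz')
      norm_num at this ⊢
      exact this) hu
  rw [one_div_mul_cancel hu.ne'] at h3
  have e : (1 / u) ^ (1 - 3 : ℝ) = u ^ 2 := by
    rw [one_div, Real.inv_rpow hu.le, ← Real.rpow_neg hu.le]
    norm_num
  rw [e] at h3
  refine le_of_mul_le_mul_left (h3.trans (le_of_eq ?_)) (by positivity : 0 < u ^ 2)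
  ring

/-- For `ρ < 2` the Prabhakar function with `b = ρ A` is integrable. -/
lemma integrableOn_prabhakar_mul {A ρ : ℝ} (hA : 0 < A) (hρ : 0 < ρ) (hρ2 : ρ < 2) :
    IntegrableOn (prabhakar A ρ (ρ * A)) (Ioi 0) := by
  have hb : 0 < ρ * A := by positivity
  set ε := min 1 (1 / (2 * ρ)) with hε
  have hε0 : 0 < ε := by positivity
  have hρε : ρ * ε ≤ 1 / 2 := by
    calc ρ * ε ≤ ρ * (1 / (2 * ρ)) := by gcongr; exact min_le_right _ _
      _ = 1 / 2 := by field_simp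
  obtain ⟨c, hc, h1⟩ := exists_mul_le_norm_one_add_cpow hρ hρ2
  obtain ⟨K, -, h2⟩ := norm_laplacePrabhakar₂_mul_le (A := A) hA hρ hc hε0.le (min_le_left _ _)
  set C := Real.exp 1 * (K * ∫ t : ℝ, ‖(1 : ℂ) + t * Complex.I‖ ^ (-(2 - ρ * ε))) with hC
  have h3 : ∀ u, 0 < u → |prabhakar A ρ (ρ * A) u| ≤ C * u ^ (-1 - ρ * ε) := by
    intro u hu
    have h4 := sq_mul_abs_prabhakar_le hA hρ hρ2.le hb (σ := 1 / u) (s := 2 - ρ * ε) (K := K)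
      (by positivity) (by linarith) (fun z hz => by
        have hz' : 0 < z.re := lt_of_lt_of_le (by positivity) hz
        exact h2 z hz' (h1 z hz')) hu
    rw [one_div_mul_cancel hu.ne'] at h4
    have e : (1 / u) ^ (1 - (2 - ρ * ε)) = u ^ 2 * u ^ (-1 - ρ * ε) := by
      rw [one_div, Real.inv_rpow hu.le, ← Real.rpow_neg hu.le, ← Real.rpow_natCast u 2,
        ← Real.rpow_add hu]
      congr 1; push_cast; ring
    rw [e] at h4
    refine le_of_mul_le_mul_left (h4.trans (le_of_eq ?_)) (by positivity : 0 < u ^ 2)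
    rw [hC]; ring
  rw [← Ioc_union_Ioi_eq_Ioi zero_le_one]
  refine (integrableOn_prabhakar_Ioc hA hρ hb 1).union ?_
  have h5 : IntegrableOn (fun u : ℝ => u ^ (-1 - ρ * ε)) (Ioi 1) :=
    integrableOn_Ioi_rpow_of_lt (by nlinarith) one_pos
  refine (h5.const_mul C).mono' (((continuousOn_prabhakar hA hρ hb).mono
    (Ioi_subset_Ioi zero_le_one)).aestronglyMeasurable measurableSet_Ioi) ?_
  exact (ae_restrict_mem measurableSet_Ioi).mono fun u hu => h3 u (zero_lt_one.trans hu)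

/-! ### Abel's theorem for averaged transforms -/

/-- The transform `x ↦ x ∫ e^{-xu} Φ(u) du`, where `Φ(t) = ∫_0^t f`, continues the Laplace transform
of `f` holomorphically to the right half-plane whenever `∫_0^∞ f` converges as an improper
integral, and tends to this integral at `0` (Abel's theorem). -/
lemma exists_abel_continuation {f : ℝ → ℝ} (hfc : ContinuousOn f (Ioi 0)) {I : ℝ}
    (hI : HasImproperIntegral f I) :
    ∃ H : ℂ → ℂ, DifferentiableOn ℂ H {z | 0 < z.re} ∧
      (∀ x : ℝ, 0 < x → Tendsto
        (fun T : ℝ => ((∫ u in (0 : ℝ)..T, Real.exp (-(x * u)) * f u : ℝ) : ℂ))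
        atTop (𝓝 (H x))) ∧
      Tendsto (fun x : ℝ => H x) (𝓝[>] 0) (𝓝 I) := by
  obtain ⟨hint, hlim⟩ := hI
  set Φ : ℝ → ℝ := fun t => ∫ u in (0 : ℝ)..t, f u with hΦ
  have hΦcN : ∀ N : ℝ, 0 < N → ContinuousOn Φ (Icc 0 N) := by
    intro N hN
    have := intervalIntegral.continuousOn_primitive_interval' (hint N hN) left_mem_uIcc
    rwa [uIcc_of_le hN.le] at this
  have hΦc : ContinuousOn Φ (Ici 0) := by
    intro t ht
    have ht' : 0 ≤ t := ht
    refine (hΦcN (t + 1) (by linarith) t ⟨ht', by linarith⟩).mono_of_mem_nhdsWithin ?_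
    rw [← Ici_inter_Iic]
    exact inter_mem_nhdsWithin _ (Iic_mem_nhds (by linarith))
  obtain ⟨C, hC⟩ : ∃ C : ℝ, ∀ t, 0 ≤ t → |Φ t| ≤ C := by
    have h1 : ∀ᶠ t in atTop, |Φ t| ≤ |I| + 1 :=
      (hlim.abs.eventually_lt_const (by linarith : |I| < |I| + 1)).mono fun t h => h.le
    obtain ⟨N, hN⟩ := eventually_atTop.1 h1
    obtain ⟨C₁, hC₁⟩ := isCompact_Icc.exists_bound_of_continuousOn
      (hΦcN (max N 1) (lt_max_of_lt_right one_pos))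
    refine ⟨max C₁ (|I| + 1), fun t ht => ?_⟩
    rcases le_total t (max N 1) with h | h
    · exact (hC₁ t ⟨ht, h⟩).trans (le_max_left _ _)
    · exact (hN t ((le_max_left _ _).trans h)).trans (le_max_right _ _)
  have hΦm : AEStronglyMeasurable Φ (volume.restrict (Ioi 0)) :=
    (hΦc.mono Ioi_subset_Ici_self).aestronglyMeasurable measurableSet_Ioi
  have hexp : ∀ x : ℝ, 0 < x → IntegrableOn (fun u : ℝ => Real.exp (-(x * u))) (Ioi 0) := by
    intro x hx
    simpa using integrableOn_exp_mul_Ioi (a := -x) (by linarith) 0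
  have hΦi : ∀ x : ℝ, 0 < x → IntegrableOn (fun u => Real.exp (-(x * u)) * Φ u) (Ioi 0) := by
    intro x hx
    refine ((hexp x hx).mul_const C).mono'
      ((Continuous.aestronglyMeasurable (by fun_prop)).mul hΦm) ?_
    refine (ae_restrict_mem measurableSet_Ioi).mono fun u hu => ?_
    rw [norm_mul, Real.norm_of_nonneg (Real.exp_pos _).le]
    exact mul_le_mul_of_nonneg_left (hC u (le_of_lt hu)) (Real.exp_pos _).le
  set H : ℂ → ℂ := fun z => z * ∫ u in Ioi (0 : ℝ), Complex.exp (-(z * u)) * (Φ u : ℂ) with hH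
  have hHx : ∀ x : ℝ, H x = ((x * ∫ u in Ioi (0 : ℝ), Real.exp (-(x * u)) * Φ u : ℝ) : ℂ) := by
    intro x
    rw [hH, Complex.ofReal_mul, ← integral_complex_ofReal]
    simp
  refine ⟨H, ?_, fun x hx => ?_, ?_⟩
  · refine differentiableOn_id.mul (differentiableOn_laplace fun σ hσ => ?_)
    refine ((hΦi σ hσ).ofReal (𝕜 := ℂ)).congr (Eventually.of_forall fun u => ?_)
    simp
  · rw [hHx]
    refine (Complex.continuous_ofReal.tendsto _).comp ?_
    have hparts : ∀ T : ℝ, 0 < T → ∫ u in (0 : ℝ)..T, Real.exp (-(x * u)) * f u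
        = Real.exp (-(x * T)) * Φ T + x * ∫ u in (0 : ℝ)..T, Real.exp (-(x * u)) * Φ u := by
      intro T hT
      have h := intervalIntegral.integral_mul_deriv_eq_deriv_mul_of_hasDeriv_right
        (u := fun u => Real.exp (-(x * u))) (u' := fun u => -x * Real.exp (-(x * u))) (v := Φ)
        (v' := f) (a := 0) (b := T) (by fun_prop) (by rw [uIcc_of_le hT.le]; exact hΦcN T hT)
        (fun u _ => ?_) (fun u hu => ?_) (Continuous.intervalIntegrable (by fun_prop) _ _)
        (hint T hT)
      · rw [h]
        simp only [mul_assoc, intervalIntegral.integral_const_mul]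
        simp [hΦ]
      · have h1 : HasDerivAt (fun u : ℝ => Real.exp (-(x * u)))
            (Real.exp (-(x * u)) * -(x * 1)) u :=
          (((hasDerivAt_id u).const_mul x).neg).exp
        exact (h1.congr_deriv (by ring)).hasDerivWithinAt
      · rw [min_eq_left hT.le, max_eq_right hT.le] at hu
        have hca : ContinuousAt f u := hfc.continuousAt (Ioi_mem_nhds hu.1)
        refine (intervalIntegral.integral_hasDerivAt_right (hint u hu.1) ?_ hca).hasDerivWithinAt
        exact hfc.stronglyMeasurableAtFilter isOpen_Ioi u hu.1
    have h1 : Tendsto (fun T : ℝ => Real.exp (-(x * T)) * Φ T) atTop (𝓝 0) := by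
      have := (Real.tendsto_exp_neg_atTop_nhds_zero.comp
        (tendsto_id.const_mul_atTop hx)).mul hlim
      simpa [Function.comp_def] using this
    have h2 := (intervalIntegral_tendsto_integral_Ioi 0 (hΦi x hx) tendsto_id).const_mul x
    have h3 := h1.add h2
    rw [zero_add] at h3
    refine h3.congr' ?_
    filter_upwards [eventually_gt_atTop 0] with T hT
    exact (hparts T hT).symm
  · simp only [hHx]
    refine (Complex.continuous_ofReal.tendsto _).comp ?_
    -- rescale, so that dominated convergence applies
    have hscale : ∀ x : ℝ, 0 < x → x * ∫ u in Ioi (0 : ℝ), Real.exp (-(x * u)) * Φ u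
        = ∫ v in Ioi (0 : ℝ), Real.exp (-v) * Φ (x⁻¹ * v) := by
      intro x hx
      have := integral_comp_mul_left_Ioi' (fun v => Real.exp (-v) * Φ (x⁻¹ * v)) 0 hx
      rw [mul_zero, smul_eq_mul] at this
      rw [← this]
      simp [hx.ne']
    have hI' : ∫ v in Ioi (0 : ℝ), Real.exp (-v) * I = I := by
      rw [integral_mul_const, integral_exp_neg_Ioi_zero, one_mul]
    have hdct : Tendsto (fun x : ℝ => ∫ v in Ioi (0 : ℝ), Real.exp (-v) * Φ (x⁻¹ * v)) (𝓝[>] 0)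
        (𝓝 (∫ v in Ioi (0 : ℝ), Real.exp (-v) * I)) := by
      refine tendsto_integral_filter_of_dominated_convergence (fun v => Real.exp (-v) * C) ?_ ?_
        ?_ ?_
      · filter_upwards [self_mem_nhdsWithin] with x hx
        have hx' : 0 < x := hx
        refine ContinuousOn.aestronglyMeasurable (ContinuousOn.mul (by fun_prop)
          (hΦc.comp (by fun_prop) fun v hv => ?_)) measurableSet_Ioi
        exact (mul_pos (inv_pos.2 hx') hv).le
      · filter_upwards [self_mem_nhdsWithin] with x hx
        have hx' : 0 < x := hx
        refine (ae_restrict_mem measurableSet_Ioi).mono fun v hv => ?_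
        rw [norm_mul, Real.norm_of_nonneg (Real.exp_pos _).le]
        exact mul_le_mul_of_nonneg_left (hC _ (mul_pos (inv_pos.2 hx') hv).le) (Real.exp_pos _).le
      · simpa using (hexp 1 one_pos).mul_const C
      · refine (ae_restrict_mem measurableSet_Ioi).mono fun v hv => ?_
        exact (hlim.comp (tendsto_inv_nhdsGT_zero.atTop_mul_const hv)).const_mul _
    rw [hI'] at hdct
    refine hdct.congr' ?_
    filter_upwards [self_mem_nhdsWithin] with x hx using (hscale x hx).symm

section Transform

variable {Ω : Type*} [MeasurableSpace Ω] {μ : Measure Ω} [IsFiniteMeasure μ]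
  {P : ℝ → ℝ} {W Y : Ω → ℝ}

/-- Fubini's theorem for `∫_0^∞ e^{-xu} P(u) E[W e^{-uY}] du`. -/
lemma integral_mul_transform (hP : ContinuousOn P (Ioi 0)) (hW : AEMeasurable W μ)
    (hY : AEMeasurable Y μ) (hW0 : ∀ᵐ ω ∂μ, 0 ≤ W ω) {x C : ℝ}
    (hint : ∀ᵐ ω ∂μ, IntegrableOn (fun u => Real.exp (-((x + Y ω) * u)) * P u) (Ioi 0))
    (hC : ∀ᵐ ω ∂μ, W ω * ∫ u in Ioi (0 : ℝ), |Real.exp (-((x + Y ω) * u)) * P u| ≤ C) :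
    IntegrableOn (fun u => Real.exp (-(x * u)) *
      (P u * ∫ ω, W ω * Real.exp (-(u * Y ω)) ∂μ)) (Ioi 0) ∧
    ∫ u in Ioi (0 : ℝ), Real.exp (-(x * u)) * (P u * ∫ ω, W ω * Real.exp (-(u * Y ω)) ∂μ)
      = ∫ ω, W ω * (∫ u in Ioi (0 : ℝ), Real.exp (-((x + Y ω) * u)) * P u) ∂μ := by
  set F : Ω × ℝ → ℝ := fun p => W p.1 * (Real.exp (-((x + Y p.1) * p.2)) * P p.2) with hF
  have hPm : AEMeasurable P (volume.restrict (Ioi 0)) := hP.aemeasurable measurableSet_Ioi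
  have hFm : AEStronglyMeasurable F (μ.prod (volume.restrict (Ioi 0))) := by
    refine AEMeasurable.aestronglyMeasurable (hW.comp_fst.mul (AEMeasurable.mul ?_ hPm.comp_snd))
    exact Real.measurable_exp.comp_aemeasurable
      (((hY.comp_fst.const_add x).mul measurable_snd.aemeasurable).neg)
  have hFi : Integrable F (μ.prod (volume.restrict (Ioi 0))) := by
    refine (integrable_prod_iff hFm).2 ⟨hint.mono fun ω h => h.const_mul (W ω), ?_⟩
    refine (integrable_const C).mono' hFm.norm.integral_prod_right' ?_
    filter_upwards [hC, hW0] with ω h1 h2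
    rw [Real.norm_of_nonneg (integral_nonneg fun _ => norm_nonneg _)]
    simpa only [hF, norm_mul, Real.norm_of_nonneg h2, integral_const_mul, Real.norm_eq_abs,
      abs_mul] using h1
  have hswap : ∀ u : ℝ, ∫ ω, F (ω, u) ∂μ
      = Real.exp (-(x * u)) * (P u * ∫ ω, W ω * Real.exp (-(u * Y ω)) ∂μ) := by
    intro u
    rw [← integral_const_mul, ← integral_const_mul]
    congr 1; ext ω
    rw [hF]
    simp only
    rw [show -((x + Y ω) * u) = -(x * u) + -(u * Y ω) by ring, Real.exp_add]
    ring
  constructor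
  · have := hFi.integral_prod_right
    simp only [hswap] at this
    exact this
  · rw [← integral_congr_ae (Eventually.of_forall hswap),
      ← integral_integral_swap (f := fun ω u => F (ω, u)) hFi]
    simp only [hF, integral_const_mul]

/-- Continuity of `u ↦ E[W e^{-uY}]`. -/
lemma continuousOn_transform (hW : AEMeasurable W μ) (hY : AEMeasurable Y μ)
    (hW0 : ∀ᵐ ω ∂μ, 0 ≤ W ω) (hY0 : ∀ᵐ ω ∂μ, 0 ≤ Y ω)
    (hWY : ∀ u : ℝ, 0 < u → ∃ C : ℝ, ∀ᵐ ω ∂μ, W ω * Real.exp (-(u * Y ω)) ≤ C) :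
    ContinuousOn (fun u => ∫ ω, W ω * Real.exp (-(u * Y ω)) ∂μ) (Ioi 0) := by
  intro u hu
  have hu' : 0 < u := hu
  obtain ⟨C, hC⟩ := hWY (u / 2) (by positivity)
  have h : ContinuousOn (fun u => ∫ ω, W ω * Real.exp (-(u * Y ω)) ∂μ) (Ioi (u / 2)) := by
    refine continuousOn_of_dominated (bound := fun _ => C) (fun v _ => ?_) (fun v hv => ?_)
      (integrable_const C) (Eventually.of_forall fun ω => by fun_prop)
    · exact (hW.mul (Real.measurable_exp.comp_aemeasurable
        (hY.const_mul v).neg)).aestronglyMeasurable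
    · filter_upwards [hC, hW0, hY0] with ω h1 h2 h3
      have hv' : u / 2 < v := hv
      rw [Real.norm_of_nonneg (by positivity)]
      refine le_trans ?_ h1
      gcongr
  exact (h.continuousAt (Ioi_mem_nhds (by linarith))).continuousWithinAt

/-- If `L` is the Laplace transform of `P` on `(1, ∞)`, and continues to a domain `S` around the
positive half-line so that `W L(z + Y)` stays bounded, then the value of the improper integral
of `P(u) E[W e^{-uY}]` is `E[W L(Y)]`. -/
theorem eq_integral_of_hasImproperIntegral (hP : ContinuousOn P (Ioi 0)) (hW : AEMeasurable W μ)
    (hY : AEMeasurable Y μ) (hW0 : ∀ᵐ ω ∂μ, 0 ≤ W ω) (hY0 : ∀ᵐ ω ∂μ, 0 < Y ω)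
    (hWY : ∀ u : ℝ, 0 < u → ∃ C : ℝ, ∀ᵐ ω ∂μ, W ω * Real.exp (-(u * Y ω)) ≤ C)
    {L : ℂ → ℂ}
    (hL : ∀ x : ℝ, 1 < x → IntegrableOn (fun u => Real.exp (-(x * u)) * P u) (Ioi 0) ∧
      ((∫ u in Ioi (0 : ℝ), Real.exp (-(x * u)) * P u : ℝ) : ℂ) = L x)
    (hLC : ∀ x : ℝ, 1 < x → ∃ C : ℝ, ∀ᵐ ω ∂μ,
      W ω * ∫ u in Ioi (0 : ℝ), |Real.exp (-((x + Y ω) * u)) * P u| ≤ C)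
    {S : Set ℂ} (hS : IsOpen S) (hSc : IsPreconnected S) (hSre : ∀ z ∈ S, 0 < z.re)
    (hSpos : ∀ x : ℝ, 0 < x → (x : ℂ) ∈ S) (hSadd : ∀ z ∈ S, ∀ t : ℝ, 0 < t → z + t ∈ S)
    (hLd : DifferentiableOn ℂ L S) {K : ℝ}
    (hLb : ∀ᵐ ω ∂μ, ∀ z ∈ S, ‖(W ω : ℂ) * L (z + Y ω)‖ ≤ K)
    {f : ℝ → ℝ} (hf : ∀ u, 0 < u → f u = P u * ∫ ω, W ω * Real.exp (-(u * Y ω)) ∂μ) {I : ℝ}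
    (hI : HasImproperIntegral f I) :
    (I : ℂ) = ∫ ω, (W ω : ℂ) * L (Y ω) ∂μ := by
  have hfc : ContinuousOn f (Ioi 0) :=
    (hP.mul (continuousOn_transform hW hY hW0 (hY0.mono fun _ h => h.le) hWY)).congr
      fun u hu => hf u hu
  obtain ⟨H, hHd, hHt, hH0⟩ := exists_abel_continuation hfc hI
  set g : ℂ → ℂ := fun z => ∫ ω, (W ω : ℂ) * L (z + Y ω) ∂μ with hg
  have hLc : ContinuousOn L S := hLd.continuousOn
  have hmeas : ∀ z ∈ S, AEStronglyMeasurable (fun ω => (W ω : ℂ) * L (z + Y ω)) μ := by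
    intro z hz
    refine (Complex.measurable_ofReal.comp_aemeasurable hW).aestronglyMeasurable.mul ?_
    -- replace `L ∘ (z + ·)` by a continuous function of `Y`, truncated at zero
    have hc : ContinuousOn (fun t : ℝ => L (z + t)) (Ioi 0) :=
      hLc.comp (by fun_prop) fun t ht => hSadd z hz t ht
    classical
    have hm : Measurable ((Ioi (0 : ℝ)).piecewise (fun t : ℝ => L (z + t)) fun _ => 0) :=
      hc.measurable_piecewise continuousOn_const measurableSet_Ioi
    refine (hm.comp_aemeasurable hY).aestronglyMeasurable.congr (hY0.mono fun ω hω => ?_)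
    exact piecewise_eq_of_mem _ _ _ hω
  have hgd : DifferentiableOn ℂ g S := by
    refine differentiableOn_integral_of_dominated hS hmeas (hY0.mono fun ω hω => ?_)
      fun z _ => ⟨1, one_pos, fun _ => K, integrable_const K, hLb.mono fun ω h w hw => h w hw.2⟩
    exact (hLd.comp (by fun_prop) fun z hz => hSadd z hz _ hω).const_mul _
  have heq : ∀ x : ℝ, 1 < x → H x = g x := by
    intro x hx
    obtain ⟨C, hC⟩ := hLC x hx
    obtain ⟨h1, h2⟩ := integral_mul_transform hP hW hY hW0
      (hY0.mono fun ω hω => (hL (x + Y ω) (by linarith)).1) hC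
    have hfe : ∀ u ∈ Ioi (0 : ℝ), Real.exp (-(x * u)) * f u = Real.exp (-(x * u)) *
        (P u * ∫ ω, W ω * Real.exp (-(u * Y ω)) ∂μ) := fun u hu => by rw [hf u hu]
    have h3 : IntegrableOn (fun u => Real.exp (-(x * u)) * f u) (Ioi 0) :=
      h1.congr_fun (fun u hu => (hfe u hu).symm) measurableSet_Ioi
    have h4 := (Complex.continuous_ofReal.tendsto _).comp
      (intervalIntegral_tendsto_integral_Ioi 0 h3 tendsto_id)
    have h5 := tendsto_nhds_unique (hHt x (by linarith)) h4
    rw [h5, setIntegral_congr_fun measurableSet_Ioi hfe, h2, ← integral_complex_ofReal, hg]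
    refine integral_congr_ae (hY0.mono fun ω hω => ?_)
    have := (hL (x + Y ω) (by linarith)).2
    push_cast at this ⊢
    rw [← this]
  have hEq : EqOn H g S := eqOn_of_eq_on_real hS hSc (hHd.mono hSre) hgd (x₀ := 1)
    (hSpos 1 one_pos) heq
  have hg0 : Tendsto (fun x : ℝ => g x) (𝓝[>] 0) (𝓝 (∫ ω, (W ω : ℂ) * L (Y ω) ∂μ)) := by
    refine tendsto_integral_filter_of_dominated_convergence (fun _ => K) ?_ ?_
      (integrable_const K) ?_
    · filter_upwards [self_mem_nhdsWithin] with x hx using hmeas x (hSpos x hx)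
    · filter_upwards [self_mem_nhdsWithin] with x hx
      exact hLb.mono fun ω h => h x (hSpos x hx)
    · refine hY0.mono fun ω hω => Tendsto.const_mul _ ?_
      have h1 : ContinuousAt L (Y ω) := hLc.continuousAt (hS.mem_nhds (hSpos _ hω))
      have h2 : Tendsto (fun x : ℝ => (x : ℂ) + Y ω) (𝓝[>] 0) (𝓝 (Y ω)) := by
        have : Continuous fun x : ℝ => (x : ℂ) + Y ω := by fun_prop
        simpa using (this.tendsto 0).mono_left nhdsWithin_le_nhds
      exact h1.tendsto.comp h2
  refine tendsto_nhds_unique hH0 (hg0.congr' ?_)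
  filter_upwards [self_mem_nhdsWithin] with x hx using (hEq (hSpos x hx)).symm

end Transform

/-! ### The transform in a sector -/

/-- The open sector `|arg z| < arctan m`. -/
def sector (m : ℝ) : Set ℂ := {z | 0 < z.re ∧ |z.im| < m * z.re}

lemma isOpen_sector (m : ℝ) : IsOpen (sector m) :=
  (isOpen_lt continuous_const Complex.continuous_re).inter
    (isOpen_lt Complex.continuous_im.abs (continuous_const.mul Complex.continuous_re))

lemma isPreconnected_sector (m : ℝ) : IsPreconnected (sector m) := by
  refine Convex.isPreconnected (convex_iff_forall_pos.2 ?_)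
  rintro x ⟨hx1, hx2⟩ y ⟨hy1, hy2⟩ a b ha hb -
  refine ⟨by simp; positivity, ?_⟩
  simp only [Complex.add_im, Complex.add_re, Complex.real_smul, Complex.mul_im, Complex.mul_re,
    Complex.ofReal_re, Complex.ofReal_im, zero_mul, sub_zero, add_zero]
  calc |a * x.im + b * y.im| ≤ |a * x.im| + |b * y.im| := abs_add_le _ _
    _ = a * |x.im| + b * |y.im| := by rw [abs_mul, abs_mul, abs_of_pos ha, abs_of_pos hb]
    _ < a * (m * x.re) + b * (m * y.re) := by gcongr
    _ = _ := by ring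

lemma ofReal_mem_sector {m : ℝ} (hm : 0 < m) {x : ℝ} (hx : 0 < x) : (x : ℂ) ∈ sector m :=
  ⟨by simpa using hx, by simpa using mul_pos hm hx⟩

lemma add_mem_sector {m : ℝ} (hm : 0 < m) {z : ℂ} (hz : z ∈ sector m) {t : ℝ} (ht : 0 < t) :
    z + t ∈ sector m := by
  obtain ⟨h1, h2⟩ := hz
  refine ⟨by simp; positivity, ?_⟩
  simp only [Complex.add_im, Complex.add_re, Complex.ofReal_re, Complex.ofReal_im, add_zero]
  nlinarith

/-- A sector on which `z ^ (-ρ)` has positive real part. -/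
lemma exists_sector_re_cpow_pos {ρ : ℝ} (hρ : 0 < ρ) :
    ∃ m : ℝ, 0 < m ∧ ∀ z ∈ sector m, 0 < (z ^ (-ρ : ℂ)).re := by
  set φ := min (Real.pi / 4) (Real.pi / (4 * ρ)) with hφ
  have hπ := Real.pi_pos
  have hφ0 : 0 < φ := lt_min (by positivity) (by positivity)
  have hφ1 : φ ≤ Real.pi / 4 := min_le_left _ _
  have hφ2 : ρ * φ ≤ Real.pi / 4 := by
    calc ρ * φ ≤ ρ * (Real.pi / (4 * ρ)) := by gcongr; exact min_le_right _ _
      _ = Real.pi / 4 := by field_simp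
  refine ⟨Real.tan φ, Real.tan_pos_of_pos_of_lt_pi_div_two hφ0 (by linarith), ?_⟩
  rintro z ⟨h1, h2⟩
  have hz0 : z ≠ 0 := by rintro rfl; simp at h1
  have harg : |z.arg| < φ := by
    have h3 := abs_lt.1 (Complex.abs_arg_lt_pi_div_two_iff.2 (Or.inl h1))
    have h4 : z.arg = Real.arctan (z.im / z.re) := by
      rw [← Complex.tan_arg, Real.arctan_tan h3.1 h3.2]
    have h5 : Real.arctan (Real.tan φ) = φ := Real.arctan_tan (by linarith) (by linarith)
    have h6 := abs_lt.1 h2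
    rw [h4, abs_lt, ← h5, ← Real.arctan_neg]
    refine ⟨Real.arctan_strictMono ?_, Real.arctan_strictMono ?_⟩
    · rw [lt_div_iff₀ h1]; linarith [h6.1]
    · rw [div_lt_iff₀ h1]; exact h6.2
  have h7 : |z.arg * -ρ| < Real.pi / 2 := by
    rw [abs_mul, abs_neg, abs_of_pos hρ]
    nlinarith
  rw [← Complex.ofReal_neg, Complex.cpow_ofReal]
  have := Real.cos_pos_of_mem_Ioo (abs_lt.1 h7)
  have h8 : 0 < ‖z‖ ^ (-ρ) := Real.rpow_pos_of_pos (norm_pos_iff.2 hz0) _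
  simp only [Complex.mul_re, Complex.add_re, Complex.add_im, Complex.ofReal_re, Complex.ofReal_im,
    Complex.I_re, Complex.I_im, Complex.mul_im, mul_zero, zero_mul, sub_zero, mul_one, add_zero]
  positivity

lemma differentiableOn_laplacePrabhakar_sector {A ρ b m : ℝ}
    (hm : ∀ z ∈ sector m, 0 < (z ^ (-ρ : ℂ)).re) :
    DifferentiableOn ℂ (laplacePrabhakar A ρ b) (sector m) := by
  intro z hz
  have hz' : z ∈ Complex.slitPlane := Or.inl hz.1
  have d0 : ∀ c : ℂ, DifferentiableAt ℂ (fun x : ℂ => x ^ c) z := fun c =>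
    differentiableAt_id.cpow_const hz'
  exact ((d0 _).mul (((d0 _).const_add 1).cpow_const
    (one_add_mem_slitPlane (Or.inl (hm z hz))))).differentiableWithinAt

lemma norm_laplacePrabhakar_le {A ρ b m : ℝ} (hA : 0 < A)
    (hm : ∀ z ∈ sector m, 0 < (z ^ (-ρ : ℂ)).re) {z : ℂ} (hz : z ∈ sector m) :
    ‖laplacePrabhakar A ρ b z‖ ≤ ‖z‖ ^ (-b) ∧ ‖laplacePrabhakar A ρ b z‖ ≤ ‖z‖ ^ (ρ * A - b) := by
  have hz0 : z ≠ 0 := by rintro rfl; simpa using hz.1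
  have hw := hm z hz
  set w := z ^ (-ρ : ℂ) with hwdef
  have hwn : ‖w‖ = ‖z‖ ^ (-ρ) := norm_cpow_neg_of_re_pos hz.1 ρ
  have h1 : 1 ≤ ‖1 + w‖ := by
    refine le_trans ?_ (Complex.re_le_norm _)
    simp; linarith
  have h2 : ‖w‖ ≤ ‖1 + w‖ := by
    rw [Complex.norm_def, Complex.norm_def]
    refine Real.sqrt_le_sqrt ?_
    simp only [Complex.normSq_apply, Complex.add_re, Complex.add_im, Complex.one_re, Complex.one_im]
    nlinarith
  have h3 : ‖(1 + w) ^ (-A : ℂ)‖ = ‖1 + w‖ ^ (-A) :=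
    norm_cpow_neg_of_re_pos (by simp; linarith) A
  have hzp : 0 < ‖z‖ := norm_pos_iff.2 hz0
  rw [laplacePrabhakar, norm_mul, ← hwdef, h3, norm_cpow_neg_of_re_pos hz.1]
  constructor
  · exact mul_le_of_le_one_right (by positivity)
      (Real.rpow_le_one_of_one_le_of_nonpos h1 (by linarith))
  · calc ‖z‖ ^ (-b) * ‖1 + w‖ ^ (-A) ≤ ‖z‖ ^ (-b) * ‖w‖ ^ (-A) := by
          refine mul_le_mul_of_nonneg_left (Real.rpow_le_rpow_of_nonpos ?_ h2 (by linarith))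
            (by positivity)
          rw [hwn]; positivity
      _ = ‖z‖ ^ (ρ * A - b) := by
          rw [hwn, ← Real.rpow_mul hzp.le, ← Real.rpow_add hzp]; ring_nf

/-- The factor that turns `e^{-uy}` into the function that the kernel is integrated against:
`e^{-uy}` itself for `q > 0`, and minus its derivative `y e^{-uy}` for `q < 0`. -/
noncomputable def kernelWeight (q y : ℝ) : ℝ := if 0 < q then 1 else y

lemma kernelWeight_pos (q : ℝ) {y : ℝ} (hy : 0 < y) : 0 < kernelWeight q y := by
  rw [kernelWeight]; split_ifs <;> positivity

lemma measurable_kernelWeight (q : ℝ) : Measurable (kernelWeight q) := by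
  unfold kernelWeight; split_ifs <;> fun_prop

lemma kernelWeight_mul_exp_le (q : ℝ) {u y : ℝ} (hu : 0 < u) (hy : 0 < y) :
    kernelWeight q y * Real.exp (-(u * y)) ≤ 1 + 1 / u := by
  have h0 : Real.exp (-(u * y)) ≤ 1 := Real.exp_le_one_iff.2 (by nlinarith)
  have h1 : 0 < 1 / u := by positivity
  rw [kernelWeight]
  split_ifs
  · linarith
  · have h2 : u * y * Real.exp (-(u * y)) ≤ 1 := by
      rw [Real.exp_neg, ← div_eq_mul_inv, div_le_one (Real.exp_pos _)]
      linarith [Real.add_one_le_exp (u * y)]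
    have h3 : y * Real.exp (-(u * y)) ≤ 1 / u := by
      rw [le_div_iff₀ hu]; linarith
    linarith

lemma kernelWeight_mul_rpow_le {A : ℝ} (hA : 0 < A) (q : ℝ) {x y : ℝ} (hx : 1 < x) (hy : 0 < y) :
    kernelWeight q y * (x + y) ^ (-kernelShift A q) ≤ 1 := by
  have h := kernelShift_pos (q := q) hA
  rw [kernelWeight]
  split_ifs with hq
  · rw [one_mul]
    exact Real.rpow_le_one_of_one_le_of_nonpos (by linarith) (by linarith)
  · rw [kernelShift, if_neg hq, Real.rpow_neg_one, ← div_eq_mul_inv, div_le_one (by linarith)]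
    linarith

/-- For `q > 0` this holds because `L(z) = (z ^ ρ + 1) ^ (-A)`, for `q < 0` because
`‖L(z)‖ ≤ 1 / ‖z‖`. -/
lemma norm_kernelWeight_mul_laplacePrabhakar_le {A q m : ℝ} (hA : 0 < A) (hm0 : 0 < m)
    (hm : ∀ z ∈ sector m, 0 < (z ^ (-(|q| : ℝ) : ℂ)).re) {z : ℂ} (hz : z ∈ sector m)
    {y : ℝ} (hy : 0 < y) :
    ‖(kernelWeight q y : ℂ) * laplacePrabhakar A |q| (kernelShift A q) (z + y)‖ ≤ 1 := by
  obtain ⟨h1, h2⟩ := norm_laplacePrabhakar_le (b := kernelShift A q) hA hm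
    (add_mem_sector hm0 hz hy)
  rw [norm_mul, Complex.norm_real, Real.norm_of_nonneg (kernelWeight_pos q hy).le]
  by_cases hq : 0 < q
  · rw [kernelShift, if_pos hq, sub_self, Real.rpow_zero] at h2
    rw [kernelWeight, if_pos hq, one_mul, kernelShift, if_pos hq]
    exact h2
  · rw [kernelShift, if_neg hq, Real.rpow_neg_one] at h1
    rw [kernelWeight, if_neg hq, kernelShift, if_neg hq]
    have hzy : y ≤ ‖z + y‖ := by
      refine le_trans ?_ (Complex.re_le_norm _)
      have := hz.1
      simp; linarith
    have hp : 0 < ‖z + y‖ := by linarith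
    calc y * _ ≤ y * ‖z + y‖⁻¹ := by gcongr
      _ ≤ 1 := by rw [← div_eq_mul_inv, div_le_one hp]; exact hzy

/-- The factor `W` is chosen so that `W L(Y)` is `(1 + Y ^ q) ^ (-A)` for both signs of `q`. -/
lemma kernelWeight_mul_laplacePrabhakar {A q : ℝ} (hq : q ≠ 0) {y : ℝ} (hy : 0 < y) :
    (kernelWeight q y : ℂ) * laplacePrabhakar A |q| (kernelShift A q) y
      = (((1 + y ^ q) ^ (-A) : ℝ) : ℂ) := by
  have hy' : 0 < y ^ (-|q|) := Real.rpow_pos_of_pos hy _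
  have hL : laplacePrabhakar A |q| (kernelShift A q) y
      = ((y ^ (-kernelShift A q) * (1 + y ^ (-|q|)) ^ (-A) : ℝ) : ℂ) := by
    rw [laplacePrabhakar]
    push_cast [Complex.ofReal_cpow hy.le, Complex.ofReal_cpow (by positivity : 0 ≤ 1 + y ^ (-|q|))]
    rfl
  rw [hL, ← Complex.ofReal_mul]
  congr 1
  rcases hq.lt_or_gt with hq' | hq'
  · rw [kernelWeight, kernelShift, if_neg hq'.not_gt, if_neg hq'.not_gt, abs_of_neg hq', neg_neg,
      Real.rpow_neg_one, ← mul_assoc, mul_inv_cancel₀ hy.ne', one_mul]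
  · rw [kernelWeight, kernelShift, if_pos hq', if_pos hq', abs_of_pos hq'] at *
    rw [one_mul, show -(q * A) = q * -A by ring, Real.rpow_mul hy.le,
      ← Real.mul_rpow (by positivity) (by positivity), mul_add, ← Real.rpow_add hy]
    simp [add_comm]

/-! ### The integral against the kernel -/

section KernelTransform

variable {Ω : Type*} [MeasurableSpace Ω] {μ : Measure Ω} [IsFiniteMeasure μ] {Y : Ω → ℝ}

/-- Whenever the improper integral of the kernel against the transform of `Y` converges, its value
is `E[(1 + Y ^ q) ^ (-A)]`. -/
theorem eq_integral_one_add_rpow {A q : ℝ} (hA : 0 < A) (hq : q ≠ 0) (hY : AEMeasurable Y μ)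
    (hY0 : ∀ᵐ ω ∂μ, 0 < Y ω) {f : ℝ → ℝ}
    (hf : ∀ u, 0 < u → f u =
      kernelC A q u * ∫ ω, kernelWeight q (Y ω) * Real.exp (-(u * Y ω)) ∂μ) {I : ℝ}
    (hI : HasImproperIntegral f I) :
    I = ∫ ω, (1 + Y ω ^ q) ^ (-A) ∂μ := by
  have hρ : 0 < |q| := abs_pos.2 hq
  have hb := kernelShift_pos (q := q) hA
  obtain ⟨m, hm0, hm⟩ := exists_sector_re_cpow_pos hρ
  have h := eq_integral_of_hasImproperIntegral (K := 1) (S := sector m)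
    (W := fun ω => kernelWeight q (Y ω))
    (continuousOn_prabhakar hA hρ hb) ((measurable_kernelWeight q).comp_aemeasurable hY) hY
    (hY0.mono fun ω h => (kernelWeight_pos q h).le) hY0
    (fun u hu => ⟨_, hY0.mono fun ω h => kernelWeight_mul_exp_le q hu h⟩)
    (fun x hx => ⟨(laplace_prabhakar hA hρ hb hx).1, (laplace_prabhakar hA hρ hb hx).2.1⟩)
    (fun x hx => ⟨∑' k, negBinom A k * (x ^ (-|q|)) ^ k, hY0.mono fun ω h => ?_⟩)
    (isOpen_sector m) (isPreconnected_sector m) (fun z hz => hz.1)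
    (fun x hx => ofReal_mem_sector hm0 hx) (fun z hz t ht => add_mem_sector hm0 hz ht)
    (differentiableOn_laplacePrabhakar_sector hm)
    (hY0.mono fun ω h z hz => norm_kernelWeight_mul_laplacePrabhakar_le hA hm0 hm hz h)
    (fun u hu => by rw [hf u hu, kernelC_eq_prabhakar hA hq hu]) hI
  · rw [integral_congr_ae (hY0.mono fun ω h => kernelWeight_mul_laplacePrabhakar hq h),
      integral_complex_ofReal] at h
    exact_mod_cast h
  · have hx0 : 0 < x := by linarith
    have hxY : 1 < x + Y ω := by linarith
    have hs : ∀ t : ℝ, 1 < t → Summable fun k : ℕ => negBinom A k * (t ^ (-|q|)) ^ k := fun t ht =>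
      summable_negBinom hA (by positivity) (Real.rpow_lt_one_of_one_lt_of_neg ht (by linarith))
    calc kernelWeight q (Y ω) * _
        ≤ kernelWeight q (Y ω) * ((x + Y ω) ^ (-kernelShift A q) *
          ∑' k, negBinom A k * ((x + Y ω) ^ (-|q|)) ^ k) :=
          mul_le_mul_of_nonneg_left (laplace_prabhakar hA hρ hb hxY).2.2 (kernelWeight_pos q h).le
      _ ≤ 1 * ∑' k, negBinom A k * (x ^ (-|q|)) ^ k := by
          rw [← mul_assoc]
          refine mul_le_mul (kernelWeight_mul_rpow_le hA q hx h)
            ((hs _ hxY).tsum_le_tsum (fun k => ?_) (hs _ hx)) (tsum_nonneg fun k => ?_) zero_le_one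
          · refine mul_le_mul_of_nonneg_left (pow_le_pow_left₀ (by positivity)
              (Real.rpow_le_rpow_of_nonpos hx0 (by linarith) (by linarith)) k)
              (negBinom_nonneg hA k)
          · have := negBinom_nonneg hA k
            positivity
      _ = _ := one_mul _

/-- For `q > 0` the kernel is integrable and the transform bounded, for `q < 0` it is the other way
round. -/
theorem integrableOn_kernelC_mul {A q : ℝ} (hA : 0 < A) (hq : q ≠ 0) (hq2 : |q| < 2)
    (hY : AEMeasurable Y μ) (hY0 : ∀ᵐ ω ∂μ, 0 < Y ω) :
    IntegrableOn (fun u => kernelC A q u *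
      ∫ ω, kernelWeight q (Y ω) * Real.exp (-(u * Y ω)) ∂μ) (Ioi 0) := by
  have hρ : 0 < |q| := abs_pos.2 hq
  have hb := kernelShift_pos (q := q) hA
  have hW := (measurable_kernelWeight q).comp_aemeasurable hY
  obtain ⟨C, hC⟩ : ∃ C : ℝ, ∀ᵐ ω ∂μ, kernelWeight q (Y ω) * ∫ u in Ioi (0 : ℝ),
      |Real.exp (-((0 + Y ω) * u)) * prabhakar A |q| (kernelShift A q) u| ≤ C := by
    rcases hq.lt_or_gt with hq' | hq'
    · obtain ⟨C, hC⟩ := exists_abs_prabhakar_one_le hA hρ hq2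
      refine ⟨C, hY0.mono fun ω h => ?_⟩
      have he : IntegrableOn (fun u : ℝ => Real.exp (-Y ω * u)) (Ioi 0) :=
        integrableOn_exp_mul_Ioi (by linarith) 0
      have h1 := integral_exp_mul_Ioi (a := -Y ω) (by linarith) 0
      rw [kernelWeight, kernelShift, if_neg hq'.not_gt, if_neg hq'.not_gt]
      calc Y ω * _ ≤ Y ω * ∫ u in Ioi (0 : ℝ), Real.exp (-Y ω * u) * C := by
            refine mul_le_mul_of_nonneg_left ?_ h.le
            refine integral_mono_of_nonneg (Eventually.of_forall fun u => abs_nonneg _)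
              (he.mul_const C) ((ae_restrict_mem measurableSet_Ioi).mono fun u hu => ?_)
            simp only
            rw [abs_mul, abs_of_pos (Real.exp_pos _), zero_add, neg_mul]
            exact mul_le_mul_of_nonneg_left (hC u hu) (Real.exp_pos _).le
        _ = C := by
            rw [integral_mul_const, h1]
            simp [h.ne']
    · have hP := integrableOn_prabhakar_mul hA hρ hq2
      refine ⟨∫ u in Ioi (0 : ℝ), |prabhakar A |q| (|q| * A) u|, hY0.mono fun ω h => ?_⟩
      rw [kernelWeight, kernelShift, if_pos hq', if_pos hq', one_mul]
      refine integral_mono_of_nonneg (Eventually.of_forall fun u => abs_nonneg _)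
        hP.abs ((ae_restrict_mem measurableSet_Ioi).mono fun u hu => ?_)
      simp only
      rw [abs_mul, abs_of_pos (Real.exp_pos _)]
      refine mul_le_of_le_one_left (abs_nonneg _) (Real.exp_le_one_iff.2 ?_)
      have : 0 < u := hu
      rw [zero_add]
      nlinarith
  have h := (integral_mul_transform (x := 0) (C := C) (continuousOn_prabhakar hA hρ hb) hW hY
    (hY0.mono fun ω h => (kernelWeight_pos q h).le)
    (hY0.mono fun ω h => integrableOn_exp_mul_prabhakar hA hρ hq2.le hb (by linarith)) hC).1
  refine h.congr_fun (fun u hu => ?_) measurableSet_Ioi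
  simp only
  rw [kernelC_eq_prabhakar hA hq hu]
  simp

end KernelTransform

/-! ### The kernel as an inverse Laplace transform -/

lemma hasImproperIntegral_of_integrableOn {f : ℝ → ℝ} (hf : IntegrableOn f (Ioi 0)) :
    HasImproperIntegral f (∫ u in Ioi (0 : ℝ), f u) := by
  refine ⟨fun N hN => ?_, intervalIntegral_tendsto_integral_Ioi 0 hf tendsto_id⟩
  rw [intervalIntegrable_iff_integrableOn_Ioc_of_le hN.le]
  exact hf.mono_set Ioc_subset_Ioi_self

theorem laplace_kernelC {A q : ℝ} (hA : 0 < A) (hq : 0 < q) {x : ℝ} (hx : 0 < x) {v : ℝ}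
    (hv : HasImproperIntegral (fun u => Real.exp (-x * u) * kernelC A q u) v) :
    v = (1 + x ^ q) ^ (-A) := by
  -- the transform of a constant random variable
  have h := eq_integral_one_add_rpow (μ := Measure.dirac ()) (Y := fun _ => x) hA hq.ne'
    aemeasurable_const (Eventually.of_forall fun _ => hx) (fun u _ => ?_) hv
  · simpa using h
  · simp [kernelWeight, hq, mul_comm]

theorem integrableOn_exp_mul_kernelC {A q : ℝ} (hA : 0 < A) (hq : 0 < q) {x : ℝ} (hx : 0 < x)
    (h : q ≤ 2 ∨ 1 < x) :
    IntegrableOn (fun u => Real.exp (-x * u) * kernelC A q u) (Ioi 0) := by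
  have hρ : 0 < |q| := abs_pos.2 hq.ne'
  have hb := kernelShift_pos (q := q) hA
  have h1 : IntegrableOn (fun u => Real.exp (-(x * u)) *
      prabhakar A |q| (kernelShift A q) u) (Ioi 0) := by
    rcases h with h | h
    · exact integrableOn_exp_mul_prabhakar hA hρ (by rwa [abs_of_pos hq]) hb hx
    · exact (laplace_prabhakar hA hρ hb h).1
  refine h1.congr_fun (fun u hu => ?_) measurableSet_Ioi
  simp only
  rw [kernelC_eq_prabhakar hA hq.ne' hu, neg_mul]

/-! ### Special cases -/

lemma kernelC_one {A u : ℝ} (hA : 0 < A) (hu : 0 < u) :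
    kernelC A 1 u = u ^ (A - 1) * Real.exp (-u) / Real.Gamma A := by
  rw [kernelC_eq_prabhakar hA one_ne_zero hu, kernelShift, if_pos one_pos, abs_one, one_mul,
    prabhakar, Real.exp_eq_exp_ℝ, NormedSpace.exp_eq_tsum_div, mul_div_assoc, ← tsum_div_const,
    ← tsum_mul_left]
  congr 1; ext k
  have h := Real.Gamma_pos_of_pos (s := A + k) (by positivity)
  have hG := Real.Gamma_pos_of_pos hA
  rw [rpow_add_mul_nat hu, Real.rpow_one, negBinom, one_mul, neg_pow u]
  field_simp

/-- The Gamma factors are matched by Legendre's duplication formula. -/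
lemma kernelC_two {A u : ℝ} (hA : 0 < A) (hu : 0 < u) :
    kernelC A 2 u =
      √Real.pi / Real.Gamma A * (u / 2) ^ (A - 1 / 2) * besselJ (A - 1 / 2) u := by
  rw [kernelC_eq_prabhakar hA two_ne_zero hu, kernelShift, if_pos two_pos, abs_two, prabhakar,
    besselJ, ← tsum_mul_left]
  congr 1; ext k
  have h1 := Real.Gamma_pos_of_pos (s := A + k) (by positivity)
  have h2 := Real.Gamma_pos_of_pos (s := A + k + 1 / 2) (by positivity)
  have h3 := Real.Gamma_pos_of_pos (s := 2 * (A + k)) (by positivity)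
  have hG := Real.Gamma_pos_of_pos hA
  have hdup := Real.Gamma_mul_Gamma_add_half (A + k)
  have e1 : 2 * A - 1 + 2 * k = (A - 1 / 2) + (2 * (k : ℝ) + (A - 1 / 2)) := by ring
  have e2 : (2 : ℝ) ^ (1 - 2 * (A + k)) = ((2 : ℝ) ^ (2 * A - 1 + 2 * k))⁻¹ := by
    rw [← Real.rpow_neg two_pos.le]; ring_nf
  have e3 : (u / 2) ^ (A - 1 / 2) * (u / 2) ^ (2 * (k : ℝ) + (A - 1 / 2))
      = u ^ (2 * A - 1 + 2 * k) * ((2 : ℝ) ^ (2 * A - 1 + 2 * k))⁻¹ := by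
    rw [← Real.rpow_add (by positivity), ← e1, Real.div_rpow hu.le two_pos.le, div_eq_mul_inv]
  rw [negBinom, show 2 * A + 2 * (k : ℝ) = 2 * (A + k) by ring,
    show (k : ℝ) + (A - 1 / 2) + 1 = A + k + 1 / 2 by ring]
  rw [e2] at hdup
  calc _ = (-1) ^ k / (Real.Gamma A * k.factorial) * u ^ (2 * A - 1 + 2 * k) *
        (Real.Gamma (A + k) * Real.Gamma (A + k + 1 / 2)) /
        (Real.Gamma (2 * (A + k)) * Real.Gamma (A + k + 1 / 2)) := by
        field_simp
    _ = √Real.pi / Real.Gamma A * ((-1) ^ k / (k.factorial * Real.Gamma (A + k + 1 / 2))) *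
        (u ^ (2 * A - 1 + 2 * k) * ((2 : ℝ) ^ (2 * A - 1 + 2 * k))⁻¹) := by
        rw [hdup]; field_simp
    _ = _ := by rw [← e3]; ring

lemma kernelC_neg_one {A u : ℝ} (hA : 0 < A) (hu : 0 < u) :
    (kernelC A (-1) u : ℂ) = kummer A 1 (-u) := by
  rw [kernelC_eq_prabhakar hA (by norm_num) hu, kernelShift, if_neg (by norm_num), abs_neg, abs_one,
    prabhakar, kummer, Complex.regularizedHGFun, Complex.regularizedHGFunSeries,
    Complex.ofReal_one, Complex.Gamma_one, one_mul, Complex.ofReal_tsum]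
  change _ = FormalMultilinearSeries.ofScalarsSum _ _
  rw [FormalMultilinearSeries.ofScalars_sum_eq]
  congr 1; ext k
  have hA' : ∀ m : ℕ, (A : ℂ) ≠ -m := by
    intro m hm
    have : A = -m := by exact_mod_cast hm
    have : (0 : ℝ) ≤ m := m.cast_nonneg
    linarith
  have h := Complex.Gamma_add_nat_div_Gamma_eq (n := k) (A : ℂ) hA'
  rw [Complex.regularizedHGFunCoeff, rpow_add_mul_nat hu, negBinom]
  simp only [Multiset.map_singleton, Multiset.prod_singleton, ← h, smul_eq_mul]
  push_cast [← Complex.Gamma_ofReal]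
  simp only [sub_self, Real.rpow_zero, Real.rpow_one, Complex.ofReal_one, one_mul, neg_pow (u : ℂ)]
  ring_nf

/-! ### The effective capacity -/

lemma hasDerivAt_integral_exp_neg_mul {Ω : Type*} [MeasurableSpace Ω] {μ : Measure Ω}
    [IsFiniteMeasure μ] {Y : Ω → ℝ} (hY : AEMeasurable Y μ) (hY0 : ∀ᵐ ω ∂μ, 0 ≤ Y ω) {u : ℝ}
    (hu : 0 < u) :
    HasDerivAt (fun u => ∫ ω, Real.exp (-(u * Y ω)) ∂μ) (-∫ ω, Y ω * Real.exp (-(u * Y ω)) ∂μ)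
      u := by
  have hm : ∀ v : ℝ, AEMeasurable (fun ω => Real.exp (-(v * Y ω))) μ := fun v =>
    Real.measurable_exp.comp_aemeasurable (hY.const_mul v).neg
  rw [← integral_neg]
  refine (hasDerivAt_integral_of_dominated_loc_of_deriv_le (bound := fun _ => 2 / u)
    (F := fun v ω => Real.exp (-(v * Y ω))) (F' := fun v ω => -(Y ω * Real.exp (-(v * Y ω))))
    (Ioi_mem_nhds (by linarith : u / 2 < u))
    (Eventually.of_forall fun v => (hm v).aestronglyMeasurable) ?_
    (hY.mul (hm u)).neg.aestronglyMeasurable (hY0.mono fun ω h v hv => ?_) (integrable_const _)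
    (Eventually.of_forall fun ω v _ => ?_)).2
  · refine Integrable.of_bound (hm u).aestronglyMeasurable 1 (hY0.mono fun ω h => ?_)
    rw [Real.norm_of_nonneg (Real.exp_pos _).le]
    exact Real.exp_le_one_iff.2 (by nlinarith)
  · have hv' : u / 2 < v := hv
    rw [norm_neg, Real.norm_of_nonneg (by positivity), Real.exp_neg, ← div_eq_mul_inv,
      div_le_div_iff₀ (Real.exp_pos _) hu]
    nlinarith [Real.add_one_le_exp (v * Y ω)]
  · have h := (((hasDerivAt_id v).mul_const (Y ω)).neg).exp
    exact h.congr_deriv (by simp; ring)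

/-- For i.i.d. service rates the effective capacity is that of a single block. -/
lemma isEffectiveCapacity_of_iIndepFun {Ω Ω' E : Type*} [MeasurableSpace Ω] [MeasurableSpace Ω']
    [MeasurableSpace E] {μ : Measure Ω} {P : Measure Ω'} {θ T B : ℝ}
    {X : Ω → E} {X' : ℕ → Ω' → E} (hind : iIndepFun X' P)
    (hid : ∀ n, IdentDistrib (X' n) X P μ) {g : E → ℝ} (hg : Measurable g) :
    IsEffectiveCapacity P θ T B (fun n ω => g (X' n ω))
      (-(1 / (θ * T * B)) * Real.log (∫ ω, Real.exp (-θ * g (X ω)) ∂μ)) := by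
  refine tendsto_const_nhds.congr' ?_
  filter_upwards [eventually_gt_atTop 0] with N hN
  have h1 : ∫ ω, Real.exp (-θ * ∑ n ∈ Finset.range N, g (X' n ω)) ∂P
      = (∫ ω, Real.exp (-θ * g (X ω)) ∂μ) ^ N := by
    have h2 := (hind.comp (fun _ => g) fun _ => hg).mgf_sum₀ (t := -θ)
      (fun n => hg.comp_aemeasurable (hid n).aemeasurable_fst) (Finset.range N)
    rw [Finset.prod_congr rfl fun n _ => mgf_congr_of_identDistrib _ _ ((hid n).comp hg) (-θ)] at h2
    simpa [mgf] using h2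
  rw [h1, Real.log_pow]
  have hN' : (N : ℝ) ≠ 0 := by exact_mod_cast hN.ne'
  field_simp

lemma measurable_powerSum {L : ℕ} (p : ℝ) : Measurable (powerSum p : (Fin L → ℝ) → ℝ) := by
  unfold powerSum; fun_prop

lemma powerSum_pos {L : ℕ} (hL : 0 < L) (p : ℝ) {r : Fin L → ℝ} (hr : ∀ l, 0 < r l) :
    0 < powerSum p r :=
  Finset.sum_pos (fun l _ => Real.rpow_pos_of_pos (hr l) p) ⟨⟨0, hL⟩, Finset.mem_univ _⟩

/-- Both branches of the integrand are the kernel times `E[w(Y) e^{-uY}]`, where `Y = κ X` and `w`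
is the weight; for `q < 0` this is the derivative of the transform of `Y`. -/
lemma capacityIntegrand_eq {Ω : Type*} [MeasurableSpace Ω] {μ : Measure Ω} [IsFiniteMeasure μ]
    {L : ℕ} {p A q κ : ℝ} {R : Fin L → Ω → ℝ}
    (hY : AEMeasurable (fun ω => κ * powerSum p fun l => R l ω) μ)
    (hY0 : ∀ᵐ ω ∂μ, 0 < κ * powerSum p fun l => R l ω) {u : ℝ} (hu : 0 < u) :
    capacityIntegrand A q κ (jointMGF μ p R) u = kernelC A q u *
      ∫ ω, kernelWeight q (κ * powerSum p fun l => R l ω) *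
        Real.exp (-(u * (κ * powerSum p fun l => R l ω))) ∂μ := by
  have hM : ∀ v : ℝ, jointMGF μ p R (κ * v)
      = ∫ ω, Real.exp (-(v * (κ * powerSum p fun l => R l ω))) ∂μ := by
    intro v
    rw [jointMGF]
    congr 1; ext ω
    ring_nf
  rw [capacityIntegrand]
  simp only [kernelWeight]
  split_ifs with hq
  · simp only [hM, one_mul]
  · simp only [hM]
    rw [(hasDerivAt_integral_exp_neg_mul hY (hY0.mono fun ω h => h.le) hu).deriv]
    ring

lemma exp_oraServiceRate {θ T B γ : ℝ} (hγ : 0 < 1 + γ) :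
    Real.exp (-θ * oraServiceRate T B γ) = (1 + γ) ^ (-qosExponent θ T B) := by
  rw [Real.rpow_def_of_pos hγ, oraServiceRate, qosExponent, Real.logb]
  congr 1; ring

lemma integral_one_add_rpow_pos {Ω : Type*} [MeasurableSpace Ω] {μ : Measure Ω}
    [IsProbabilityMeasure μ] {γ : Ω → ℝ} (hγm : AEMeasurable γ μ) (hγ : ∀ᵐ ω ∂μ, 0 < γ ω) {A : ℝ}
    (hA : 0 ≤ A) : 0 < ∫ ω, (1 + γ ω) ^ (-A) ∂μ := by
  have hm : AEStronglyMeasurable (fun ω => (1 + γ ω) ^ (-A)) μ :=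
    ((hγm.const_add 1).pow_const _).aestronglyMeasurable
  have hpos : ∀ᵐ ω ∂μ, 0 < (1 + γ ω) ^ (-A) := hγ.mono fun ω h =>
    Real.rpow_pos_of_pos (by linarith) _
  have hint : Integrable (fun ω => (1 + γ ω) ^ (-A)) μ := by
    refine Integrable.of_bound hm 1 ?_
    filter_upwards [hγ, hpos] with ω h1 h2
    rw [Real.norm_of_nonneg h2.le]
    exact Real.rpow_le_one_of_one_le_of_nonpos (by linarith) (by linarith)
  refine (integral_nonneg_of_ae (hpos.mono fun ω h => h.le)).lt_of_ne' fun h0 => ?_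
  have h1 := (integral_eq_zero_iff_of_nonneg_ae (hpos.mono fun ω h => h.le) hint).1 h0
  obtain ⟨ω, h2, h3⟩ := (hpos.and h1).exists
  exact h2.ne' h3

theorem proposition1 {Ω : Type*} [MeasurableSpace Ω] (μ : Measure Ω) [IsProbabilityMeasure μ]
    {L : ℕ} (hL : 0 < L) (R : Fin L → Ω → ℝ)
    (hRm : ∀ l, AEMeasurable (R l) μ) (hRpos : ∀ l, ∀ᵐ ω ∂μ, 0 < R l ω)
    (p q K Es N0 θ T B A κ : ℝ) (hq : q ≠ 0) (hK : 0 < K) (hEs : 0 < Es) (hN0 : 0 < N0)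
    (hθ : 0 < θ) (hT : 0 < T) (hB : 0 < B)
    (hA : A = qosExponent θ T B) (hκ : κ = (K * (Es / N0)) ^ (1 / q)) :
    -- the single integral and the effective capacity
    ((2 ≤ |q| → ∃ I, HasImproperIntegral (capacityIntegrand A q κ (jointMGF μ p R)) I) →
      ∃ I : ℝ, 0 < I ∧
      HasImproperIntegral (capacityIntegrand A q κ (jointMGF μ p R)) I ∧
      (|q| < 2 → IntegrableOn (capacityIntegrand A q κ (jointMGF μ p R)) (Ioi 0) ∧
        I = ∫ u in Ioi (0 : ℝ), capacityIntegrand A q κ (jointMGF μ p R) u) ∧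
      oraEffectiveCapacity μ θ T B (fun ω => endSNR K Es N0 p q (fun l => R l ω))
        = -(1 / (θ * T * B)) * Real.log I ∧
      ∀ {Ω' : Type*} [MeasurableSpace Ω'] (P : Measure Ω') [IsProbabilityMeasure P]
        (R' : ℕ → Ω' → Fin L → ℝ),
        iIndepFun R' P → (∀ n, IdentDistrib (R' n) (fun ω l => R l ω) P μ) →
        IsEffectiveCapacity P θ T B
          (fun n ω => oraServiceRate T B (endSNR K Es N0 p q (R' n ω)))
          (-(1 / (θ * T * B)) * Real.log I)) ∧
    -- the H-function expression of the kernel is real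
    (∀ u : ℝ, 0 < u → (kernelC A q u : ℂ) = kernelH A q u) ∧
    -- for `q > 0` the kernel is the inverse Laplace transform of `(1 + x ^ q) ^ (-A)`
    (0 < q → ∀ x : ℝ, 0 < x →
      ((q ≤ 2 ∨ 1 < x) →
        IntegrableOn (fun u => Real.exp (-x * u) * kernelC A q u) (Ioi 0) ∧
        ∫ u in Ioi (0 : ℝ), Real.exp (-x * u) * kernelC A q u = (1 + x ^ q) ^ (-A)) ∧
      (∀ v : ℝ, HasImproperIntegral (fun u => Real.exp (-x * u) * kernelC A q u) v →
        v = (1 + x ^ q) ^ (-A))) ∧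
    -- special cases
    (q = 1 → ∀ u : ℝ, 0 < u →
      kernelC A q u = u ^ (A - 1) * Real.exp (-u) / Real.Gamma A) ∧
    (q = 2 → ∀ u : ℝ, 0 < u →
      kernelC A q u =
        √Real.pi / Real.Gamma A * (u / 2) ^ (A - 1 / 2) * besselJ (A - 1 / 2) u) ∧
    (q = -1 → ∀ u : ℝ, 0 < u → (kernelC A q u : ℂ) = kummer A 1 (-u)) := by
  have hA0 : 0 < A := by
    rw [hA, qosExponent]
    have := Real.log_pos one_lt_two
    positivity
  refine ⟨fun hconv => ?_, fun u hu => ?_, fun hq0 x hx => ⟨fun h => ?_, fun v hv =>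
    laplace_kernelC hA0 hq0 hx hv⟩, ?_, ?_, ?_⟩
  · have hSNR : 0 < K * (Es / N0) := by positivity
    have hκ0 : 0 < κ := by rw [hκ]; positivity
    have hκq : κ ^ q = K * (Es / N0) := by
      rw [hκ, ← Real.rpow_mul hSNR.le, one_div_mul_cancel hq, Real.rpow_one]
    set Y : Ω → ℝ := fun ω => κ * powerSum p fun l => R l ω with hYdef
    have hRm' : AEMeasurable (fun ω l => R l ω) μ := aemeasurable_pi_lambda _ hRm
    have hX0 : ∀ᵐ ω ∂μ, 0 < powerSum p fun l => R l ω :=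
      (ae_all_iff.2 hRpos).mono fun ω h => powerSum_pos hL p h
    have hY : AEMeasurable Y μ := ((measurable_powerSum p).comp_aemeasurable hRm').const_mul κ
    have hY0 : ∀ᵐ ω ∂μ, 0 < Y ω := hX0.mono fun ω h => mul_pos hκ0 h
    have hγ : ∀ᵐ ω ∂μ, endSNR K Es N0 p q (fun l => R l ω) = Y ω ^ q := hX0.mono fun ω h => by
      rw [hYdef, endSNR, Real.mul_rpow hκ0.le h.le, hκq]
    have hf : ∀ u, 0 < u → capacityIntegrand A q κ (jointMGF μ p R) u = kernelC A q u *
        ∫ ω, kernelWeight q (Y ω) * Real.exp (-(u * Y ω)) ∂μ := fun u hu =>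
      capacityIntegrand_eq hY hY0 hu
    have habs : |q| < 2 → IntegrableOn (capacityIntegrand A q κ (jointMGF μ p R)) (Ioi 0) :=
      fun h => (integrableOn_kernelC_mul hA0 hq h hY hY0).congr_fun
        (fun u hu => (hf u hu).symm) measurableSet_Ioi
    obtain ⟨I, hI⟩ : ∃ I, HasImproperIntegral (capacityIntegrand A q κ (jointMGF μ p R)) I := by
      rcases lt_or_ge |q| 2 with h | h
      · exact ⟨_, hasImproperIntegral_of_integrableOn (habs h)⟩
      · exact hconv h
    have hIY := eq_integral_one_add_rpow hA0 hq hY hY0 hf hI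
    have hIγ : ∫ ω, (1 + endSNR K Es N0 p q (fun l => R l ω)) ^ (-A) ∂μ = I := by
      rw [hIY]
      exact integral_congr_ae (hγ.mono fun ω h => by simp only [h])
    refine ⟨I, ?_, hI, fun h => ⟨habs h, tendsto_nhds_unique hI.2
      (hasImproperIntegral_of_integrableOn (habs h)).2⟩, ?_, fun P _ R' hind hid => ?_⟩
    · rw [hIY]
      exact integral_one_add_rpow_pos (hY.pow_const q)
        (hY0.mono fun ω h => Real.rpow_pos_of_pos h q) hA0.le
    · rw [oraEffectiveCapacity, ← hA, hIγ]
    · have hg : Measurable fun r : Fin L → ℝ => oraServiceRate T B (endSNR K Es N0 p q r) := by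
        have := measurable_powerSum (L := L) p
        unfold oraServiceRate endSNR Real.logb
        fun_prop
      have hc := isEffectiveCapacity_of_iIndepFun (θ := θ) (T := T) (B := B) hind hid hg
      have he : ∫ ω, Real.exp (-θ * oraServiceRate T B (endSNR K Es N0 p q fun l => R l ω)) ∂μ
          = I := by
        rw [← hIγ, hA]
        refine integral_congr_ae ?_
        filter_upwards [hγ, hY0] with ω h1 h2
        refine exp_oraServiceRate ?_
        rw [h1]
        positivity
      rwa [he] at hc
  · rw [kernelC_eq_prabhakar hA0 hq hu, kernelH_eq_prabhakar hA0 hq hu]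
  · have hint := integrableOn_exp_mul_kernelC hA0 hq0 hx h
    exact ⟨hint, laplace_kernelC hA0 hq0 hx (hasImproperIntegral_of_integrableOn hint)⟩
  · rintro rfl u hu
    exact kernelC_one hA0 hu
  · rintro rfl u hu
    exact kernelC_two hA0 hu
  · rintro rfl u hu
    exact kernelC_neg_one hA0 hu
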